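/- Let $n\ge 2$, $\ell\ge 2$, $w\ge 1$ be integers. Let $\underline R$ be the complex vector space with basis $v_{ij}^k$ ($1\le i\ne j\le n$, $1\le k\le \ell-1$) and $q_i^m$ ($1\le i\le n$, $1\le m\le w$); it is the representation space, with dimension vector $(1,\dots,1)$, of the quiver with $n$ vertices, $\ell-1$ arrows $i\to j$ for each ordered pair $i\neq j$, and a framing $\mathrm{Hom}(V_i,\mathbb C^w)$ at each vertex (edge loops contribute nothing, as traceless endomorphisms of a line vanish). The torus $H=(\mathbb C^*)^n$ acts by $h.v_{ij}^k=h_jh_i^{-1}v_{ij}^k$ and $h.q_i^m=h_i^{-1}q_i^m$. Let $D(\underline R)$ be the algebra of differential operators on $\underline R$, generated by the coordinates $x_a$ and the derivations $\partial_a$ ($a$ running over the basis), with $[x_a,x_b]=[\partial_a,\partial_b]=0$ and $[x_a,\partial_b]=-\delta_{ab}$; $H$ acts on it through the corresponding characters. For $\eta\in\mathfrak h=\mathbb C^n$ put $$\underline\Phi(\eta)=\sum_{i\ne j}\sum_{k=1}^{\ell-1}(\eta_j-\eta_i)\,x_{v_{ij}^k}\partial_{v_{ij}^k}-\sum_{i=1}^n\sum_{m=1}^{w}\eta_i\,x_{q_i^m}\partial_{q_i^m},$$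 and for $\lambda\in\mathbb C$ let $$\underline{\mathcal A}_\lambda=U\big/U\Big(\underline\Phi(\eta)-\lambda\sum_{i=1}^n\eta_i\ \Big|\ \eta\in\mathfrak h\Big),\qquad U=D(\underline R)^H,$$ be the quantized slice algebra. The symmetric group $S_n$ acts on $\underline{\mathcal A}_\lambda$ by algebra automorphisms, by permuting the vertices, and hence, by twisting, on the set of isomorphism classes of its finite-dimensional simple left modules. (1) If $\lambda\in\mathbb Z$ and $\lambda\ge (n-1)(\ell-1)+w$ or $\lambda\le -(n-1)(\ell-1)$, then the set of isomorphism classes of finite-dimensional simple left $\underline{\mathcal A}_\lambda$-modules is non-empty, and $S_n$ acts on it freely and transitively. (2) For the same $\lambda$, there are exactly $n!$ isomorphism classes of finite-dimensional $S_n$-equivariant $\underline{\mathcal A}_\lambda$-bimodules that are simple as equivariant bimodules. (An $S_n$-equivariant bimodule is a bimodule $B$ with a linear action of $S_n$ such that $\sigma(abc)=\sigma(a)\sigma(b)\sigma(c)$ for $a,c\in\underline{\mathcal A}_\lambda$, $b\in B$; it is simple if it is nonzero and its only $S_n$-stable subbimodules are $0$ and $B$.) (3) If $\lambda\in\mathbb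 R$ and $-(n-1)(\ell-1)<\lambda<(n-1)(\ell-1)+w$, then $\underline{\mathcal A}_\lambda$ has no finite-dimensional simple bimodules and no finite-dimensional simple $S_n$-equivariant bimodules. -/

import Mathlib

open scoped TensorProduct

/-! ## Weyl algebras

`Weyl ι` is the algebra of differential operators on the complex affine space with
coordinates `x a`, `a : ι`, presented by generators `x a`, `∂ a` and the canonical
commutation relations. -/

/-- The relations `[x a, x b] = 0`, `[∂ a, ∂ b] = 0`, `[x a, ∂ b] = -δ a b`; the generator
`x a` is `Sum.inl a` and the generator `∂ a` is `Sum.inr a`. -/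
inductive WeylRel (ι : Type) [DecidableEq ι] :
    FreeAlgebra ℂ (ι ⊕ ι) → FreeAlgebra ℂ (ι ⊕ ι) → Prop
  | xx (a b : ι) : WeylRel ι
      (FreeAlgebra.ι ℂ (Sum.inl a) * FreeAlgebra.ι ℂ (Sum.inl b))
      (FreeAlgebra.ι ℂ (Sum.inl b) * FreeAlgebra.ι ℂ (Sum.inl a))
  | dd (a b : ι) : WeylRel ι
      (FreeAlgebra.ι ℂ (Sum.inr a) * FreeAlgebra.ι ℂ (Sum.inr b))
      (FreeAlgebra.ι ℂ (Sum.inr b) * FreeAlgebra.ι ℂ (Sum.inr a))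
  | xd (a b : ι) : WeylRel ι
      (FreeAlgebra.ι ℂ (Sum.inl a) * FreeAlgebra.ι ℂ (Sum.inr b)
        - FreeAlgebra.ι ℂ (Sum.inr b) * FreeAlgebra.ι ℂ (Sum.inl a))
      (-(if a = b then 1 else 0))

/-- The Weyl algebra with coordinates indexed by `ι`. -/
def Weyl (ι : Type) [DecidableEq ι] : Type := RingQuot (WeylRel ι)

namespace Weyl

section
variable {ι : Type} [DecidableEq ι]

instance : Ring (Weyl ι) := inferInstanceAs (Ring (RingQuot (WeylRel ι)))

instance : Algebra ℂ (Weyl ι) := inferInstanceAs (Algebra ℂ (RingQuot (WeylRel ι)))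

/-- The coordinate function `x a`. -/
def x (a : ι) : Weyl ι := RingQuot.mkAlgHom ℂ (WeylRel ι) (FreeAlgebra.ι ℂ (Sum.inl a))

/-- The partial derivative `∂ a`. -/
def d (a : ι) : Weyl ι := RingQuot.mkAlgHom ℂ (WeylRel ι) (FreeAlgebra.ι ℂ (Sum.inr a))

theorem x_mul_x (a b : ι) : (x a * x b : Weyl ι) = x b * x a := by
  have h := RingQuot.mkAlgHom_rel ℂ (WeylRel.xx a b)
  rw [map_mul, map_mul] at h
  exact h

theorem d_mul_d (a b : ι) : (d a * d b : Weyl ι) = d b * d a := by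
  have h := RingQuot.mkAlgHom_rel ℂ (WeylRel.dd a b)
  rw [map_mul, map_mul] at h
  exact h

theorem x_mul_d_sub (a b : ι) :
    (x a * d b - d b * x a : Weyl ι) = -(if a = b then 1 else 0) := by
  have h := RingQuot.mkAlgHom_rel ℂ (WeylRel.xd a b)
  rw [map_sub, map_mul, map_mul, map_neg] at h
  refine h.trans (congrArg Neg.neg ?_)
  split_ifs
  · exact map_one _
  · exact map_zero _

/-- The universal property of the presentation. -/
def lift {B : Type*} [Ring B] [Algebra ℂ B] (X Y : ι → B)
    (hX : ∀ a b, X a * X b = X b * X a) (hY : ∀ a b, Y a * Y b = Y b * Y a)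
    (hXY : ∀ a b, X a * Y b - Y b * X a = -(if a = b then 1 else 0)) : Weyl ι →ₐ[ℂ] B :=
  RingQuot.liftAlgHom ℂ ⟨FreeAlgebra.lift ℂ (Sum.elim X Y), by
    intro p q h
    cases h with
    | xx a b => simpa using hX a b
    | dd a b => simpa using hY a b
    | xd a b =>
      have := hXY a b
      split_ifs at this ⊢ with hab <;> simpa [hab] using this⟩

section lift
variable {B : Type*} [Ring B] [Algebra ℂ B] (X Y : ι → B)
    (hX : ∀ a b, X a * X b = X b * X a) (hY : ∀ a b, Y a * Y b = Y b * Y a)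
    (hXY : ∀ a b, X a * Y b - Y b * X a = -(if a = b then 1 else 0))

@[simp] theorem lift_x (a : ι) : lift X Y hX hY hXY (x a) = X a := by
  refine (RingQuot.liftAlgHom_mkAlgHom_apply ℂ _ _ _).trans ?_
  simp

@[simp] theorem lift_d (a : ι) : lift X Y hX hY hXY (d a) = Y a := by
  refine (RingQuot.liftAlgHom_mkAlgHom_apply ℂ _ _ _).trans ?_
  simp

end lift

theorem algHom_ext {B : Type*} [Ring B] [Algebra ℂ B] {f g : Weyl ι →ₐ[ℂ] B}
    (hx : ∀ a, f (x a) = g (x a)) (hd : ∀ a, f (d a) = g (d a)) : f = g := by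
  refine RingQuot.ringQuot_ext' (S := ℂ) (s := WeylRel ι) f g ?_
  refine FreeAlgebra.hom_ext (funext ?_)
  rintro (a | a)
  · exact hx a
  · exact hd a

/-- A subalgebra containing all the generators is everything. -/
theorem mem_of_generators (S : Subalgebra ℂ (Weyl ι)) (hx : ∀ a, x a ∈ S)
    (hd : ∀ a, d a ∈ S) (u : Weyl ι) : u ∈ S := by
  obtain ⟨p, rfl⟩ := RingQuot.mkAlgHom_surjective ℂ (WeylRel ι) u
  induction p using FreeAlgebra.induction with
  | grade0 r =>
    rw [AlgHom.commutes]
    exact S.algebraMap_mem r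
  | grade1 a =>
    rcases a with a | a
    · exact hx a
    · exact hd a
  | mul a b ha hb => rw [map_mul]; exact S.mul_mem ha hb
  | add a b ha hb => rw [map_add]; exact S.add_mem ha hb

/-- The automorphism induced by a diagonal change of coordinates:
`x a ↦ c a • x a`, `∂ a ↦ (c a)⁻¹ • ∂ a`. -/
def scale (c : ι → ℂˣ) : Weyl ι →ₐ[ℂ] Weyl ι :=
  lift (fun a => (c a : ℂ) • x a) (fun a => ((c a)⁻¹ : ℂˣ).val • d a)
    (by intro a b; simp only [smul_mul_smul_comm, x_mul_x a b, mul_comm])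
    (by intro a b; simp only [smul_mul_smul_comm, d_mul_d a b, mul_comm])
    (by
      intro a b
      rw [smul_mul_smul_comm, smul_mul_smul_comm, mul_comm ((c b)⁻¹ : ℂˣ).val, ← smul_sub,
        x_mul_d_sub]
      split_ifs with h
      · subst h; simp
      · simp)

@[simp] theorem scale_x (c : ι → ℂˣ) (a : ι) : scale c (x a) = (c a : ℂ) • x a := lift_x ..

@[simp] theorem scale_d (c : ι → ℂˣ) (a : ι) :
    scale c (d a) = ((c a)⁻¹ : ℂˣ).val • d a := lift_d ..

/-- The automorphism induced by a permutation of the coordinates: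
`x a ↦ x (e a)`, `∂ a ↦ ∂ (e a)`. -/
def perm (e : Equiv.Perm ι) : Weyl ι →ₐ[ℂ] Weyl ι :=
  lift (fun a => x (e a)) (fun a => d (e a)) (fun _ _ => x_mul_x _ _) (fun _ _ => d_mul_d _ _)
    (fun a b => by rw [x_mul_d_sub]; simp)

@[simp] theorem perm_x (e : Equiv.Perm ι) (a : ι) : perm e (x a) = x (e a) := lift_x ..

@[simp] theorem perm_d (e : Equiv.Perm ι) (a : ι) : perm e (d a) = d (e a) := lift_d ..

end

end Weyl

/-! ## The slice quiver

It has `n` vertices, `ℓ - 1` arrows `i → j` for every ordered pair `i ≠ j`, and a framing of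
dimension `w` at each vertex. The dimension vector is `(1, …, 1)`, so the (traceless) edge loops
contribute nothing to the representation space
`R = ⨁_{i ≠ j} Hom(V i, V j)^{ℓ - 1} ⊕ ⨁_i Hom(V i, W i)`. -/

/-- The coordinates on `R`: `Sum.inl (⟨(i, j), _⟩, k)` is the `k`-th arrow `i → j`, and
`Sum.inr (i, m)` is the `m`-th coordinate of `Hom(V i, W i) ≅ ℂ ^ w`. -/
abbrev SliceArrow (n ℓ w : ℕ) : Type :=
  ({p : Fin n × Fin n // p.1 ≠ p.2} × Fin (ℓ - 1)) ⊕ (Fin n × Fin w)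

/-- The algebra of differential operators on `R`. -/
abbrev SliceWeyl (n ℓ w : ℕ) : Type := Weyl (SliceArrow n ℓ w)

section Slice
variable {n ℓ w : ℕ}

/-- The character by which the torus `H = (ℂˣ) ^ n` acts on a coordinate line of `R`:
`h j * (h i)⁻¹` on an arrow `i → j`, and `(h i)⁻¹` on the framing at `i`. -/
def sliceChar (h : Fin n → ℂˣ) : SliceArrow n ℓ w → ℂˣ
  | Sum.inl (p, _) => h p.1.2 * (h p.1.1)⁻¹
  | Sum.inr (i, _) => (h i)⁻¹

/-- The differential of `sliceChar`: `η j - η i` on an arrow `i → j`, and `-η i` on the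
framing at `i`. -/
def sliceLieChar (η : Fin n → ℂ) : SliceArrow n ℓ w → ℂ
  | Sum.inl (p, _) => η p.1.2 - η p.1.1
  | Sum.inr (i, _) => -η i

/-- The action of an element of the torus `H` on differential operators. -/
def sliceTorus (h : Fin n → ℂˣ) : SliceWeyl n ℓ w →ₐ[ℂ] SliceWeyl n ℓ w :=
  Weyl.scale (sliceChar h)

/-- The quantum comoment map `Φ(η) = ∑_a χ_a(η) x_a ∂_a`, that is
`∑_{i ≠ j} ∑_k (η j - η i) x_{ij}^k ∂_{ij}^k - ∑_i ∑_m η i x_i^m ∂_i^m`. -/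
noncomputable def sliceComoment (η : Fin n → ℂ) : SliceWeyl n ℓ w :=
  ∑ a : SliceArrow n ℓ w, sliceLieChar η a • (Weyl.x a * Weyl.d a)

/-- The permutation of the coordinates of `R` induced by a permutation of the vertices. -/
def arrowPerm (σ : Equiv.Perm (Fin n)) : Equiv.Perm (SliceArrow n ℓ w) where
  toFun
    | Sum.inl (p, k) => Sum.inl (⟨(σ p.1.1, σ p.1.2), fun h => p.2 (σ.injective h)⟩, k)
    | Sum.inr (i, m) => Sum.inr (σ i, m)
  invFun
    | Sum.inl (p, k) =>
        Sum.inl (⟨(σ.symm p.1.1, σ.symm p.1.2), fun h => p.2 (σ.symm.injective h)⟩, k)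
    | Sum.inr (i, m) => Sum.inr (σ.symm i, m)
  left_inv := by rintro (⟨⟨⟨i, j⟩, h⟩, k⟩ | ⟨i, m⟩) <;> simp
  right_inv := by rintro (⟨⟨⟨i, j⟩, h⟩, k⟩ | ⟨i, m⟩) <;> simp

/-- The action of a permutation of the vertices on differential operators. -/
def slicePermWeyl (σ : Equiv.Perm (Fin n)) : SliceWeyl n ℓ w →ₐ[ℂ] SliceWeyl n ℓ w :=
  Weyl.perm (arrowPerm σ)

variable (n ℓ w) in
/-- The algebra `U = D(R) ^ H` of torus invariant differential operators. -/
def sliceInvariants : Subalgebra ℂ (SliceWeyl n ℓ w) where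
  carrier := {u | ∀ h : Fin n → ℂˣ, sliceTorus h u = u}
  mul_mem' hu hv h := by rw [map_mul, hu h, hv h]
  add_mem' hu hv h := by rw [map_add, hu h, hv h]
  algebraMap_mem' r h := AlgHom.commutes _ r

theorem sliceComoment_mem (η : Fin n → ℂ) :
    (sliceComoment η : SliceWeyl n ℓ w) ∈ sliceInvariants n ℓ w := by
  intro h
  rw [sliceComoment, map_sum]
  refine Finset.sum_congr rfl fun a _ => ?_
  rw [map_smul, map_mul, sliceTorus, Weyl.scale_x, Weyl.scale_d, smul_mul_smul_comm,
    Units.mul_inv, one_smul]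

variable (n ℓ w) in
/-- The element `Φ(η) - ⟨(λ, …, λ), η⟩` of `U`. -/
noncomputable def sliceMoment (lam : ℂ) (η : Fin n → ℂ) : sliceInvariants n ℓ w :=
  ⟨sliceComoment η, sliceComoment_mem η⟩ - algebraMap ℂ _ (∑ i, lam * η i)

variable (n ℓ w) in
/-- The left ideal `U (Φ(η) - ⟨(λ, …, λ), η⟩ | η ∈ 𝔥)` of `U`. -/
noncomputable def sliceIdeal (lam : ℂ) : Ideal (sliceInvariants n ℓ w) :=
  Ideal.span (Set.range (sliceMoment n ℓ w lam))

/-! Invariant operators commute with the comoment map, so the left ideal is two-sided. -/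

theorem sliceLieChar_sum (η : Fin n → ℂ) (a : SliceArrow n ℓ w) :
    sliceLieChar η a = ∑ i, η i * sliceLieChar (Pi.single i 1) a := by
  rcases a with ⟨p, k⟩ | ⟨i, m⟩
  · simp [sliceLieChar, mul_sub, Finset.sum_sub_distrib, Pi.single_apply]
  · simp [sliceLieChar, Pi.single_apply]

theorem sliceComoment_sum (η : Fin n → ℂ) :
    (sliceComoment η : SliceWeyl n ℓ w) = ∑ i, η i • sliceComoment (Pi.single i 1) := by
  simp only [sliceComoment, Finset.smul_sum, smul_smul]
  rw [Finset.sum_comm]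
  refine Finset.sum_congr rfl fun a _ => ?_
  rw [← Finset.sum_smul, ← sliceLieChar_sum]

theorem sliceComoment_comm_x (η : Fin n → ℂ) (b : SliceArrow n ℓ w) :
    sliceComoment η * Weyl.x b - Weyl.x b * sliceComoment η = sliceLieChar η b • Weyl.x b := by
  rw [sliceComoment, Finset.sum_mul, Finset.mul_sum, ← Finset.sum_sub_distrib]
  rw [Finset.sum_eq_single b]
  · rw [smul_mul_assoc, mul_smul_comm, ← smul_sub]
    congr 1
    have h := Weyl.x_mul_d_sub b b
    rw [if_pos rfl] at h
    calc _ = -(Weyl.x b * (Weyl.x b * Weyl.d b - Weyl.d b * Weyl.x b)) := by noncomm_ring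
      _ = _ := by rw [h]; simp
  · intro a _ hab
    rw [smul_mul_assoc, mul_smul_comm, ← smul_sub]
    have h := Weyl.x_mul_d_sub b a
    rw [if_neg (Ne.symm hab), neg_zero, sub_eq_zero] at h
    rw [mul_assoc, ← h, ← mul_assoc, ← mul_assoc, Weyl.x_mul_x a b, sub_self, smul_zero]
  · simp

theorem sliceComoment_comm_d (η : Fin n → ℂ) (b : SliceArrow n ℓ w) :
    sliceComoment η * Weyl.d b - Weyl.d b * sliceComoment η
      = (-sliceLieChar η b) • Weyl.d b := by
  rw [sliceComoment, Finset.sum_mul, Finset.mul_sum, ← Finset.sum_sub_distrib]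
  rw [Finset.sum_eq_single b]
  · rw [smul_mul_assoc, mul_smul_comm, ← smul_sub, neg_smul, ← smul_neg]
    congr 1
    have h := Weyl.x_mul_d_sub b b
    rw [if_pos rfl] at h
    calc _ = (Weyl.x b * Weyl.d b - Weyl.d b * Weyl.x b) * Weyl.d b := by noncomm_ring
      _ = _ := by rw [h]; simp
  · intro a _ hab
    rw [smul_mul_assoc, mul_smul_comm, ← smul_sub]
    have h := Weyl.x_mul_d_sub a b
    rw [if_neg hab, neg_zero, sub_eq_zero] at h
    rw [mul_assoc, Weyl.d_mul_d a b, ← mul_assoc, h, ← mul_assoc, sub_self, smul_zero]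
  · simp

/-- The operators of weight `k` for the `i`-th factor of the torus and of its Lie algebra. -/
def sliceWeight (i : Fin n) (k : ℤ) : Submodule ℂ (SliceWeyl n ℓ w) where
  carrier := {u | sliceTorus (Pi.mulSingle i (Units.mk0 2 two_ne_zero)) u = ((2 : ℂ) ^ k) • u ∧
    sliceComoment (Pi.single i 1) * u - u * sliceComoment (Pi.single i 1) = (k : ℂ) • u}
  add_mem' {u v} hu hv := by
    refine ⟨by rw [map_add, hu.1, hv.1, smul_add], ?_⟩
    rw [smul_add, ← hu.2, ← hv.2]; noncomm_ring
  zero_mem' := by simp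
  smul_mem' c u hu := by
    refine ⟨by rw [map_smul, hu.1, smul_comm], ?_⟩
    rw [mul_smul_comm, smul_mul_assoc, ← smul_sub, hu.2, smul_comm]

theorem sliceWeight_mul {i : Fin n} {k l : ℤ} {u v : SliceWeyl n ℓ w}
    (hu : u ∈ sliceWeight i k) (hv : v ∈ sliceWeight i l) : u * v ∈ sliceWeight i (k + l) := by
  refine ⟨by rw [map_mul, hu.1, hv.1, smul_mul_smul_comm, zpow_add₀ two_ne_zero], ?_⟩
  have h : ∀ f : SliceWeyl n ℓ w,
      f * (u * v) - u * v * f = (f * u - u * f) * v + u * (f * v - v * f) := by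
    intro f; noncomm_ring
  rw [h, hu.2, hv.2, smul_mul_assoc, mul_smul_comm, ← add_smul]
  push_cast; rfl

theorem mem_iSup_sliceWeight (i : Fin n) (u : SliceWeyl n ℓ w) : u ∈ ⨆ k, sliceWeight i k := by
  let S : Subalgebra ℂ (SliceWeyl n ℓ w) := Submodule.toSubalgebra (⨆ k, sliceWeight i k)
    (Submodule.mem_iSup_of_mem 0 ⟨by simp, by simp⟩) (by
      intro a b ha hb
      induction ha using Submodule.iSup_induction' with
      | mem k a ha =>
        induction hb using Submodule.iSup_induction' with
        | mem l b hb => exact Submodule.mem_iSup_of_mem (k + l) (sliceWeight_mul ha hb)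
        | zero => rw [mul_zero]; exact Submodule.zero_mem _
        | add b c _ _ hb hc => rw [mul_add]; exact Submodule.add_mem _ hb hc
      | zero => rw [zero_mul]; exact Submodule.zero_mem _
      | add a c _ _ ha hc => rw [add_mul]; exact Submodule.add_mem _ ha hc)
  have key : ∀ a : SliceArrow n ℓ w, ∃ k : ℤ,
      ((sliceChar (Pi.mulSingle i (Units.mk0 2 two_ne_zero)) a : ℂˣ) : ℂ) = 2 ^ k ∧
      sliceLieChar (Pi.single i 1) a = (k : ℂ) := by
    rintro (⟨⟨⟨p, q⟩, hpq⟩, k⟩ | ⟨p, m⟩)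
    · refine ⟨(if q = i then 1 else 0) - (if p = i then 1 else 0), ?_, ?_⟩
      · simp only [sliceChar, Pi.mulSingle_apply]
        split_ifs <;> simp
      · simp only [sliceLieChar, Pi.single_apply]
        split_ifs <;> simp
    · refine ⟨-(if p = i then 1 else 0), ?_, ?_⟩
      · simp only [sliceChar, Pi.mulSingle_apply]
        split_ifs <;> simp
      · simp only [sliceLieChar, Pi.single_apply]
        split_ifs <;> simp
  refine Weyl.mem_of_generators S (fun a => ?_) (fun a => ?_) u
  · obtain ⟨k, h1, h2⟩ := key a
    refine Submodule.mem_iSup_of_mem k ⟨?_, ?_⟩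
    · rw [sliceTorus, Weyl.scale_x, h1]
    · rw [sliceComoment_comm_x, h2]
  · obtain ⟨k, h1, h2⟩ := key a
    refine Submodule.mem_iSup_of_mem (-k) ⟨?_, ?_⟩
    · rw [sliceTorus, Weyl.scale_d, Units.val_inv_eq_inv_val, h1, zpow_neg]
    · rw [sliceComoment_comm_d, h2, Int.cast_neg]

theorem sliceComoment_commute (η : Fin n → ℂ) {u : SliceWeyl n ℓ w}
    (hu : u ∈ sliceInvariants n ℓ w) : sliceComoment η * u = u * sliceComoment η := by
  have key : ∀ i : Fin n, sliceComoment (Pi.single i 1) * u = u * sliceComoment (Pi.single i 1) := by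
    intro i
    have hmem := mem_iSup_sliceWeight i u
    rw [iSup_split_single _ (0 : ℤ), Submodule.mem_sup] at hmem
    obtain ⟨a, ha, b, hb, rfl⟩ := hmem
    set t : Module.End ℂ (SliceWeyl n ℓ w) :=
      (sliceTorus (Pi.mulSingle i (Units.mk0 2 two_ne_zero))).toLinearMap with ht
    have h1 : b ∈ t.eigenspace 1 := by
      rw [Module.End.mem_eigenspace_iff, one_smul]
      have h2 := hu (Pi.mulSingle i (Units.mk0 2 two_ne_zero))
      rw [map_add, ha.1, zpow_zero, one_smul] at h2
      exact add_left_cancel h2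
    have h3 : b ∈ ⨆ μ : ℂ, ⨆ _ : μ ≠ 1, t.eigenspace μ := by
      refine (iSup₂_le fun k hk => ?_ :
        (⨆ k : ℤ, ⨆ _ : k ≠ 0, sliceWeight i k) ≤ _) hb
      refine le_trans ?_ (le_iSup₂ (f := fun (μ : ℂ) (_ : μ ≠ 1) => t.eigenspace μ)
        ((2 : ℂ) ^ k) ?_)
      · intro c hc
        exact Module.End.mem_eigenspace_iff.2 hc.1
      · intro h
        apply hk
        have h5 : (2 : ℝ) ^ k = 1 := by
          have h7 : (((2 : ℝ) ^ k : ℝ) : ℂ) = ((1 : ℝ) : ℂ) := by push_cast; exact h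
          exact Complex.ofReal_injective h7
        exact (zpow_eq_one_iff_right₀ (by norm_num) (by norm_num)).1 h5
    have h4 : b = 0 := Submodule.disjoint_def.1 (Module.End.eigenspaces_iSupIndep t 1) b h1 h3
    rw [h4, add_zero]
    have h6 := ha.2
    rw [Int.cast_zero, zero_smul, sub_eq_zero] at h6
    exact h6
  rw [sliceComoment_sum, Finset.sum_mul, Finset.mul_sum]
  refine Finset.sum_congr rfl fun i _ => ?_
  rw [smul_mul_assoc, mul_smul_comm, key i]

theorem sliceMoment_commute (lam : ℂ) (η : Fin n → ℂ) (u : sliceInvariants n ℓ w) :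
    sliceMoment n ℓ w lam η * u = u * sliceMoment n ℓ w lam η := by
  rw [sliceMoment, sub_mul, mul_sub, Algebra.commutes]
  congr 1
  exact Subtype.ext (sliceComoment_commute η u.2)

instance (lam : ℂ) : (sliceIdeal n ℓ w lam).IsTwoSided := ⟨by
  intro a b ha
  refine Submodule.span_induction (p := fun a _ => a * b ∈ sliceIdeal n ℓ w lam)
    ?_ ?_ ?_ ?_ ha
  · rintro _ ⟨η, rfl⟩
    rw [sliceMoment_commute]
    exact Ideal.mul_mem_left _ _ (Ideal.subset_span ⟨η, rfl⟩)
  · rw [zero_mul]; exact Ideal.zero_mem _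
  · intro c d _ _ hc hd
    rw [add_mul]; exact Ideal.add_mem _ hc hd
  · intro c d _ hd
    rw [smul_eq_mul, mul_assoc]; exact Ideal.mul_mem_left _ _ hd⟩

variable (n ℓ w) in
/-- The quantized slice algebra with parameter `(λ, …, λ)`:
`U / U (Φ(η) - ⟨(λ, …, λ), η⟩ | η ∈ 𝔥)`. -/
abbrev SliceAlgebra (lam : ℂ) : Type := sliceInvariants n ℓ w ⧸ sliceIdeal n ℓ w lam

/-! The symmetric group acts on everything by permuting the vertices. -/

theorem slicePermWeyl_torus (σ : Equiv.Perm (Fin n)) (h : Fin n → ℂˣ) (u : SliceWeyl n ℓ w) :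
    sliceTorus h (slicePermWeyl σ u) = slicePermWeyl σ (sliceTorus (fun i => h (σ i)) u) := by
  have key : (sliceTorus h).comp (slicePermWeyl σ)
      = (slicePermWeyl σ).comp (sliceTorus (ℓ := ℓ) (w := w) (fun i => h (σ i))) := by
    refine Weyl.algHom_ext (fun a => ?_) (fun a => ?_)
    · rcases a with ⟨p, k⟩ | ⟨i, m⟩ <;>
        simp [sliceTorus, slicePermWeyl, sliceChar, arrowPerm]
    · rcases a with ⟨p, k⟩ | ⟨i, m⟩ <;>
        simp [sliceTorus, slicePermWeyl, sliceChar, arrowPerm]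
  exact DFunLike.congr_fun key u

theorem slicePermWeyl_mem (σ : Equiv.Perm (Fin n)) {u : SliceWeyl n ℓ w}
    (hu : u ∈ sliceInvariants n ℓ w) : slicePermWeyl σ u ∈ sliceInvariants n ℓ w := by
  intro h
  rw [slicePermWeyl_torus, hu]

theorem slicePermWeyl_comoment (σ : Equiv.Perm (Fin n)) (η : Fin n → ℂ) :
    slicePermWeyl σ (sliceComoment η : SliceWeyl n ℓ w)
      = sliceComoment (fun i => η (σ.symm i)) := by
  rw [sliceComoment, sliceComoment, map_sum]
  conv_rhs => rw [← Equiv.sum_comp (arrowPerm σ)]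
  refine Finset.sum_congr rfl fun a _ => ?_
  rw [map_smul, map_mul, slicePermWeyl, Weyl.perm_x, Weyl.perm_d]
  congr 1
  rcases a with ⟨p, k⟩ | ⟨i, m⟩ <;> simp [sliceLieChar, arrowPerm]

/-- The action of a permutation of the vertices on `U`. -/
def slicePermInv (σ : Equiv.Perm (Fin n)) : sliceInvariants n ℓ w →ₐ[ℂ] sliceInvariants n ℓ w :=
  ((slicePermWeyl σ).comp (sliceInvariants n ℓ w).val).codRestrict (sliceInvariants n ℓ w)
    fun u => slicePermWeyl_mem σ u.2

theorem slicePermInv_moment (σ : Equiv.Perm (Fin n)) (lam : ℂ) (η : Fin n → ℂ) :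
    slicePermInv σ (sliceMoment n ℓ w lam η)
      = sliceMoment n ℓ w lam (fun i => η (σ.symm i)) := by
  rw [sliceMoment, sliceMoment, map_sub, AlgHom.commutes,
    Equiv.sum_comp σ.symm (fun i => lam * η i)]
  congr 1
  exact Subtype.ext (slicePermWeyl_comoment σ η)

theorem slicePermInv_ideal (σ : Equiv.Perm (Fin n)) (lam : ℂ) {u : sliceInvariants n ℓ w}
    (hu : u ∈ sliceIdeal n ℓ w lam) : slicePermInv σ u ∈ sliceIdeal n ℓ w lam := by
  refine Submodule.span_induction (p := fun u _ => slicePermInv σ u ∈ sliceIdeal n ℓ w lam)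
    ?_ ?_ ?_ ?_ hu
  · rintro _ ⟨η, rfl⟩
    rw [slicePermInv_moment]
    exact Ideal.subset_span ⟨_, rfl⟩
  · rw [map_zero]; exact Ideal.zero_mem _
  · intro c d _ _ hc hd
    rw [map_add]; exact Ideal.add_mem _ hc hd
  · intro c d _ hd
    rw [smul_eq_mul, map_mul]; exact Ideal.mul_mem_left _ _ hd

/-- The action of a permutation of the vertices on the slice algebra. -/
noncomputable def slicePermHom (lam : ℂ) (σ : Equiv.Perm (Fin n)) :
    SliceAlgebra n ℓ w lam →ₐ[ℂ] SliceAlgebra n ℓ w lam :=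
  Ideal.Quotient.liftₐ (sliceIdeal n ℓ w lam)
    ((Ideal.Quotient.mkₐ ℂ (sliceIdeal n ℓ w lam)).comp (slicePermInv σ))
    fun _ hu => Ideal.Quotient.eq_zero_iff_mem.2 (slicePermInv_ideal σ lam hu)

theorem slicePermWeyl_one (u : SliceWeyl n ℓ w) : slicePermWeyl 1 u = u := by
  have key : slicePermWeyl 1 = AlgHom.id ℂ (SliceWeyl n ℓ w) := by
    refine Weyl.algHom_ext (fun a => ?_) (fun a => ?_) <;>
      rcases a with ⟨p, k⟩ | ⟨i, m⟩ <;> simp [slicePermWeyl, arrowPerm]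
  exact DFunLike.congr_fun key u

theorem slicePermWeyl_mul (σ τ : Equiv.Perm (Fin n)) (u : SliceWeyl n ℓ w) :
    slicePermWeyl (σ * τ) u = slicePermWeyl σ (slicePermWeyl τ u) := by
  have key : slicePermWeyl (σ * τ)
      = (slicePermWeyl σ).comp (slicePermWeyl τ : SliceWeyl n ℓ w →ₐ[ℂ] _) := by
    refine Weyl.algHom_ext (fun a => ?_) (fun a => ?_) <;>
      rcases a with ⟨p, k⟩ | ⟨i, m⟩ <;> simp [slicePermWeyl, arrowPerm]
  exact DFunLike.congr_fun key u

variable (n ℓ w) in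
/-- The action of the symmetric group on the slice algebra by algebra automorphisms. -/
noncomputable def slicePerm (lam : ℂ) :
    Equiv.Perm (Fin n) →* (SliceAlgebra n ℓ w lam →ₐ[ℂ] SliceAlgebra n ℓ w lam) where
  toFun := slicePermHom lam
  map_one' := by
    refine AlgHom.ext fun a => ?_
    obtain ⟨u, rfl⟩ := Ideal.Quotient.mk_surjective a
    exact congrArg (Ideal.Quotient.mk _) (Subtype.ext (slicePermWeyl_one u.1))
  map_mul' σ τ := by
    refine AlgHom.ext fun a => ?_
    obtain ⟨u, rfl⟩ := Ideal.Quotient.mk_surjective a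
    exact congrArg (Ideal.Quotient.mk _) (Subtype.ext (slicePermWeyl_mul σ τ u.1))

end Slice

/-! ## Finite-dimensional simple modules up to isomorphism -/

/-- A finite-dimensional simple left module over a complex algebra. -/
structure FDSimple (A : Type) [Ring A] [Algebra ℂ A] where
  /-- the underlying vector space -/
  carrier : Type
  [addCommGroup : AddCommGroup carrier]
  [vectorSpace : Module ℂ carrier]
  [module : Module A carrier]
  [isScalarTower : IsScalarTower ℂ A carrier]
  [finiteDimensional : FiniteDimensional ℂ carrier]
  [isSimple : IsSimpleModule A carrier]

attribute [instance] FDSimple.addCommGroup FDSimple.vectorSpace FDSimple.module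
  FDSimple.isScalarTower FDSimple.finiteDimensional FDSimple.isSimple

/-- Isomorphism of modules. -/
instance FDSimple.setoid (A : Type) [Ring A] [Algebra ℂ A] : Setoid (FDSimple A) where
  r M N := Nonempty (M.carrier ≃ₗ[A] N.carrier)
  iseqv := ⟨fun _ => ⟨LinearEquiv.refl _ _⟩, fun ⟨e⟩ => ⟨e.symm⟩, fun ⟨e⟩ ⟨f⟩ => ⟨e.trans f⟩⟩

/-- The set of isomorphism classes of finite-dimensional simple left modules. -/
def FDSimpleClasses (A : Type) [Ring A] [Algebra ℂ A] : Type 1 := Quotient (FDSimple.setoid A)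

section Twist
variable {A : Type} [Ring A] [Algebra ℂ A] {G : Type} [Group G] (φ : G →* (A →ₐ[ℂ] A))

theorem inv_apply_apply (g : G) (a : A) : φ g⁻¹ (φ g a) = a := by
  rw [← AlgHom.mul_apply, ← map_mul, inv_mul_cancel, map_one, AlgHom.one_apply]

/-- The vector space `V`, on which `a` acts as `f a` does. -/
def Pullback (_f : A →ₐ[ℂ] A) (V : Type) : Type := V

namespace Pullback

section
variable (f : A →ₐ[ℂ] A) (V : Type) [AddCommGroup V]

instance : AddCommGroup (Pullback f V) := inferInstanceAs (AddCommGroup V)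

instance [Module A V] : Module A (Pullback f V) := Module.compHom V (f : A →+* A)

variable {V} in
theorem smul_eq [Module A V] (a : A) (v : V) :
    (a • (show Pullback f V from v) : Pullback f V) = (f a • v : V) := rfl

theorem isSimpleModule [Module A V] (hf : Function.Surjective f) [IsSimpleModule A V] :
    IsSimpleModule A (Pullback f V) := by
  have : RingHomSurjective (f : A →+* A) := ⟨hf⟩
  let l : Pullback f V →ₛₗ[(f : A →+* A)] V :=
    { toFun := fun v => v
      map_add' := fun _ _ => rfl
      map_smul' := fun _ _ => rfl }
  exact (LinearMap.isSimpleModule_iff_of_bijective l Function.bijective_id).2 inferInstance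

variable [Module ℂ V]

instance : Module ℂ (Pullback f V) := inferInstanceAs (Module ℂ V)

instance [FiniteDimensional ℂ V] : FiniteDimensional ℂ (Pullback f V) :=
  inferInstanceAs (FiniteDimensional ℂ V)

instance [Module A V] [IsScalarTower ℂ A V] : IsScalarTower ℂ A (Pullback f V) :=
  ⟨fun c a v => (congrArg (fun b => (b • (show V from v) : V)) (map_smul f c a)).trans
    (smul_assoc c (f a) (show V from v))⟩

end

end Pullback

/-- The twist of a module by `g`: the same vector space, on which `a` acts as `g⁻¹ a` did. -/
def FDSimple.twist (g : G) (M : FDSimple A) : FDSimple A where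
  carrier := Pullback (φ g⁻¹) M.carrier
  isSimple := Pullback.isSimpleModule _ _ fun a => ⟨φ g a, inv_apply_apply φ g a⟩

/-- A group acting on an algebra by automorphisms acts on the isomorphism classes of its
finite-dimensional simple modules by twisting. -/
@[reducible]
def twistAction : MulAction G (FDSimpleClasses A) where
  smul g := Quotient.map (FDSimple.twist φ g) fun M N ⟨e⟩ =>
    ⟨{ e with map_smul' := fun a v => e.map_smul (φ g⁻¹ a) v }⟩
  one_smul x := by
    induction x using Quotient.inductionOn with
    | h M =>
      refine Quotient.sound ⟨{ LinearEquiv.refl ℂ M.carrier with map_smul' := fun a v => ?_ }⟩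
      have h : φ 1⁻¹ a = a := by rw [inv_one, map_one, AlgHom.one_apply]
      exact congrArg (fun b : A => b • (show M.carrier from v)) h
  mul_smul g h x := by
    induction x using Quotient.inductionOn with
    | h M =>
      refine Quotient.sound ⟨{ LinearEquiv.refl ℂ M.carrier with map_smul' := fun a v => ?_ }⟩
      have h : φ (g * h)⁻¹ a = φ h⁻¹ (φ g⁻¹ a) := by
        rw [mul_inv_rev, map_mul, AlgHom.mul_apply]
      exact congrArg (fun b : A => b • (show M.carrier from v)) h

/-- A finite-dimensional `G`-equivariant module over an algebra with an action of `G`, simple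
in the category of equivariant modules: it is nonzero and has no proper nonzero submodule that is
stable under `G`. -/
structure EquivariantFDSimple where
  /-- the underlying vector space -/
  carrier : Type
  [addCommGroup : AddCommGroup carrier]
  [vectorSpace : Module ℂ carrier]
  [module : Module A carrier]
  [isScalarTower : IsScalarTower ℂ A carrier]
  [finiteDimensional : FiniteDimensional ℂ carrier]
  /-- the action of the group -/
  rep : Representation ℂ G carrier
  rep_smul : ∀ (g : G) (a : A) (v : carrier), rep g (a • v) = φ g a • rep g v
  nontrivial : Nontrivial carrier
  eq_bot_or_eq_top : ∀ N : Submodule A carrier, (∀ g, ∀ v ∈ N, rep g v ∈ N) → N = ⊥ ∨ N = ⊤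

attribute [instance] EquivariantFDSimple.addCommGroup EquivariantFDSimple.vectorSpace
  EquivariantFDSimple.module EquivariantFDSimple.isScalarTower
  EquivariantFDSimple.finiteDimensional

/-- Isomorphism of equivariant modules. -/
instance EquivariantFDSimple.setoid : Setoid (EquivariantFDSimple φ) where
  r M N := ∃ e : M.carrier ≃ₗ[A] N.carrier, ∀ g v, e (M.rep g v) = N.rep g (e v)
  iseqv :=
    ⟨fun _ => ⟨LinearEquiv.refl _ _, fun _ _ => rfl⟩,
      fun ⟨e, he⟩ => ⟨e.symm, fun g v => by
        rw [LinearEquiv.symm_apply_eq, he, LinearEquiv.apply_symm_apply]⟩,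
      fun ⟨e, he⟩ ⟨f, hf⟩ => ⟨e.trans f, fun g v => by
        rw [LinearEquiv.trans_apply, he, hf, LinearEquiv.trans_apply]⟩⟩

/-- The set of isomorphism classes of finite-dimensional simple equivariant modules. -/
def EquivariantFDSimpleClasses : Type 1 := Quotient (EquivariantFDSimple.setoid φ)

/-- The diagonal action on the enveloping algebra `A ⊗ Aᵐᵒᵖ`, the left modules over which are the
`A`-bimodules: `(a ⊗ b) • v = a v b`. -/
noncomputable def bimoduleAction : G →* (A ⊗[ℂ] Aᵐᵒᵖ →ₐ[ℂ] A ⊗[ℂ] Aᵐᵒᵖ) where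
  toFun g := Algebra.TensorProduct.map (φ g) (AlgHom.op (φ g))
  map_one' := by
    ext a <;> simp
  map_mul' g h := by
    ext a <;> simp

end Twist

/-- The symmetric group acts on the isomorphism classes of finite-dimensional simple left modules
over the slice algebra. -/
noncomputable instance sliceSimpleAction (n ℓ w : ℕ) (lam : ℂ) :
    MulAction (Equiv.Perm (Fin n)) (FDSimpleClasses (SliceAlgebra n ℓ w lam)) :=
  twistAction (slicePerm n ℓ w lam)

/-! Write `θ_a = x_a ∂_a`. These commuting operators act semisimply on the slice algebra by
commutators, with the monomials in the `x_a` and `∂_a` as weight vectors, and the elements of weight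
zero are the polynomials in the `θ_a` (`isWeightAlgebra_sliceTheta`). Hence a simple module is
determined by any one of its weights, that is, joint eigenvalues of the `θ_a`
(`IsWeightAlgebra.nonempty_linearEquiv`), and it remains to find the weights that occur.

A weight `p` of a finite-dimensional module satisfies the moment map equations (`IsConserved`). A
torus invariant monomial with exponents `m` moves `p` to `p + m`, and it can kill a weight vector
only if some coordinate crosses between the negative and the nonnegative integers. If a nonzero `m`
never crosses, its multiples produce infinitely many weights, so finite dimension forces
`IsBoundedWeight`. Tested on cycles of length two and three in the quiver with one extra framing
vertex, this makes `p` integral on the arrows between vertices, with the signs given by a total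
order of the vertices. In the equation at the first vertex, nonnegative framings force `λ ≤
-(n-1)(ℓ-1)`; at the last vertex, negative framings force `λ ≥ (n-1)(ℓ-1) + w`. Strictly between the
bounds both vertices have a framing of the wrong kind, and a cycle through the framing vertex
contradicts boundedness (`IsBoundedWeight.not_conserved`). In the outer ranges the framings all have
one sign, so a sign pattern amounts to an order of the vertices
(`IsBoundedWeight.exists_mem_weightRegion`), and the symmetric group permutes the orders simply
transitively.

Conversely, the integral solutions of the equations with the sign pattern of an order form a finite
nonempty set. They index a basis of a module of Laurent monomials, which is simple because invariant
monomials connect any two basis vectors (`isSimpleModule_sliceRep`).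

The simple bimodules are the spaces of linear maps between two simple modules, labelled by pairs of
orders (`classifiesSimple_bimodule`). The diagonal action on pairs is free, so the simple
equivariant bimodules are the induced ones, one for each of the `n!` orbits
(`ClassifiesSimple.card_equivariant`). -/

/-! ## Weights of commuting operators -/

section Weights
variable {J V : Type*} [AddCommGroup V] [Module ℂ V]

/-- A subspace stable under a family of operators contains the components of its elements along
joint eigenvectors with distinct joint eigenvalues. -/
theorem Submodule.mem_of_sum_weight_mem {κ : Type*} (T : J → Module.End ℂ V) (N : Submodule ℂ V)
    (hN : ∀ j, ∀ v ∈ N, T j v ∈ N) (wt : κ → J → ℂ) (hwt : Function.Injective wt)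
    (s : Finset κ) (f : κ → V) (hf : ∀ m ∈ s, ∀ j, T j (f m) = wt m j • f m)
    (hs : ∑ m ∈ s, f m ∈ N) {m₀ : κ} (hm₀ : m₀ ∈ s) : f m₀ ∈ N := by
  classical
  induction hc : s.card generalizing s f with
  | zero => simp [Finset.card_eq_zero.1 hc] at hm₀
  | succ c ih =>
    by_cases h : ∃ m₁ ∈ s, m₁ ≠ m₀
    · obtain ⟨m₁, hm₁, hne⟩ := h
      obtain ⟨j, hj⟩ : ∃ j, wt m₀ j ≠ wt m₁ j := by
        by_contra! h
        exact hne (hwt (funext h)).symm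
      -- The operator `T j - wt m₁ j` removes the component `m₁` and multiplies the component `m₀`
      -- by a nonzero scalar.
      have key : (wt m₀ j - wt m₁ j) • f m₀ ∈ N := by
        refine ih (s.erase m₁) (fun m => (wt m j - wt m₁ j) • f m) ?_ ?_
          (Finset.mem_erase.2 ⟨hne.symm, hm₀⟩) (by rw [Finset.card_erase_of_mem hm₁, hc]; rfl)
        · intro m hm i
          rw [map_smul, hf m (Finset.mem_of_mem_erase hm), smul_comm]
        · have h1 : ∑ m ∈ s.erase m₁, (wt m j - wt m₁ j) • f m
              = T j (∑ m ∈ s, f m) - wt m₁ j • ∑ m ∈ s, f m := by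
            rw [map_sum, Finset.smul_sum, ← Finset.sum_sub_distrib]
            rw [← Finset.sum_erase_add _ _ hm₁, hf m₁ hm₁, sub_self, add_zero]
            refine Finset.sum_congr rfl fun m hm => ?_
            rw [hf m (Finset.mem_of_mem_erase hm), sub_smul]
          rw [h1]
          exact N.sub_mem (hN j _ hs) (N.smul_mem _ hs)
      exact (N.smul_mem_iff (sub_ne_zero.2 hj)).1 key
    · push Not at h
      rwa [Finset.sum_eq_single_of_mem m₀ hm₀ fun m hm hne => (hne (h m hm)).elim] at hs

/-- Commuting operators preserve each other's eigenspaces, so a further operator has an eigenvector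
inside the joint eigenspace of the earlier ones. -/
theorem Module.End.exists_joint_eigenvector [Finite J] [FiniteDimensional ℂ V] [Nontrivial V]
    (T : J → Module.End ℂ V) (hT : ∀ i j, Commute (T i) (T j)) :
    ∃ (p : J → ℂ) (v : V), v ≠ 0 ∧ ∀ j, T j v = p j • v := by
  classical
  have := Fintype.ofFinite J
  suffices h : ∀ s : Finset J, ∃ (p : J → ℂ) (v : V), v ≠ 0 ∧ ∀ j ∈ s, T j v = p j • v by
    obtain ⟨p, v, hv, h⟩ := h Finset.univ
    exact ⟨p, v, hv, fun j => h j (Finset.mem_univ j)⟩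
  intro s
  induction s using Finset.induction_on with
  | empty =>
    obtain ⟨v, hv⟩ := exists_ne (0 : V)
    exact ⟨0, v, hv, by simp⟩
  | insert k s hk ih =>
    obtain ⟨p, v, hv, h⟩ := ih
    let W : Submodule ℂ V := ⨅ j ∈ s, (T j).eigenspace (p j)
    have memW : ∀ u, u ∈ W ↔ ∀ j ∈ s, T j u = p j • u := by
      intro u
      simp [W, Submodule.mem_iInf]
    have hW : ∀ u ∈ W, T k u ∈ W := by
      intro u hu
      rw [memW] at hu ⊢
      intro j hj
      rw [← Module.End.mul_apply, (hT j k).eq, Module.End.mul_apply, hu j hj, map_smul]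
    have : Nontrivial W := ⟨⟨⟨v, (memW v).2 h⟩, 0, fun e => hv (congrArg Subtype.val e)⟩⟩
    obtain ⟨c, hc⟩ := Module.End.exists_eigenvalue ((T k).restrict hW)
    obtain ⟨u, hu⟩ := hc.exists_hasEigenvector
    refine ⟨Function.update p k c, u.1, fun e => hu.2 (Subtype.ext e), fun j hj => ?_⟩
    rcases eq_or_ne j k with rfl | hjk
    · rw [Function.update_self]
      exact congrArg Subtype.val hu.apply_eq_smul
    · rw [Function.update_of_ne hjk]
      exact (memW _).1 u.2 j (Finset.mem_of_mem_insert_of_ne hj hjk)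

end Weights

/-! ### Algebras graded by a commuting family, and simple modules determined by one weight -/

section WeightAlgebra
variable {J E : Type} [Ring E] [Algebra ℂ E] (Θ : J → E)

/-- `p` is a joint eigenvalue of the family `Θ` on the module `M`. -/
def IsWeightOf (M : Type) [AddCommGroup M] [Module ℂ M] [Module E M] (p : J → ℂ) : Prop :=
  ∃ v : M, v ≠ 0 ∧ ∀ j, Θ j • v = p j • v

/-- The elements of weight `m` for the adjoint action of the family `Θ`, restricted in weight zero
to the subalgebra generated by `Θ`. -/
def weightPart (m : J → ℂ) : Submodule ℂ E where
  carrier := {u | (∀ j, Θ j * u - u * Θ j = m j • u) ∧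
    (m = 0 → u ∈ Algebra.adjoin ℂ (Set.range Θ))}
  add_mem' {u v} hu hv := by
    refine ⟨fun j => ?_, fun h => add_mem (hu.2 h) (hv.2 h)⟩
    rw [smul_add, ← hu.1, ← hv.1]; noncomm_ring
  zero_mem' := ⟨by simp, fun _ => zero_mem _⟩
  smul_mem' c u hu := by
    refine ⟨fun j => ?_, fun h => Subalgebra.smul_mem _ (hu.2 h) c⟩
    rw [mul_smul_comm, smul_mul_assoc, ← smul_sub, hu.1, smul_comm]

/-- The commuting family `Θ` acts semisimply on `E` by commutators, and generates the centralizer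
of `Θ`. -/
structure IsWeightAlgebra : Prop where
  commute : ∀ i j, Commute (Θ i) (Θ j)
  iSup_eq_top : ⨆ m, weightPart Θ m = ⊤

variable {Θ}

theorem IsWeightAlgebra.exists_finsupp (h : IsWeightAlgebra Θ) (u : E) :
    ∃ F : (J → ℂ) →₀ E, (∀ m, F m ∈ weightPart Θ m) ∧ F.sum (fun _ y => y) = u :=
  (Submodule.mem_iSup_iff_exists_finsupp _ _).1 (h.iSup_eq_top ▸ Submodule.mem_top)

section Modules
variable {M N : Type} [AddCommGroup M] [Module ℂ M] [Module E M] [IsScalarTower ℂ E M]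
  [AddCommGroup N] [Module ℂ N] [Module E N] [IsScalarTower ℂ E N]

theorem smul_smul_weight {p m : J → ℂ} {v : M} (hv : ∀ j, Θ j • v = p j • v) {u : E}
    (hu : u ∈ weightPart Θ m) (j : J) : Θ j • u • v = (p j + m j) • u • v := by
  have h : Θ j * u = u * Θ j + m j • u := by rw [← hu.1 j]; abel
  rw [smul_smul, h, add_smul, mul_smul, hv, smul_assoc, add_smul, smul_comm u (p j) v]

/-- A polynomial in `Θ` acts on a weight vector by its value at the weight. The point is that one
scalar serves for two modules with a common weight. -/
theorem exists_eq_smul_of_mem_adjoin {p : J → ℂ} {v : M} {v' : N}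
    (hv : ∀ j, Θ j • v = p j • v) (hv' : ∀ j, Θ j • v' = p j • v') {u : E}
    (hu : u ∈ Algebra.adjoin ℂ (Set.range Θ)) : ∃ c : ℂ, u • v = c • v ∧ u • v' = c • v' := by
  induction hu using Algebra.adjoin_induction with
  | mem x hx => obtain ⟨j, rfl⟩ := hx; exact ⟨p j, hv j, hv' j⟩
  | algebraMap r => exact ⟨r, by simp, by simp⟩
  | add x y _ _ hx hy =>
    obtain ⟨c, h1, h2⟩ := hx
    obtain ⟨d, h3, h4⟩ := hy
    exact ⟨c + d, by simp [add_smul, h1, h3], by simp [add_smul, h2, h4]⟩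
  | mul x y _ _ hx hy =>
    obtain ⟨c, h1, h2⟩ := hx
    obtain ⟨d, h3, h4⟩ := hy
    refine ⟨d * c, ?_, ?_⟩
    · rw [mul_smul, h3, smul_comm, h1, smul_smul]
    · rw [mul_smul, h4, smul_comm, h2, smul_smul]

/-- Only the weight-zero component of `u` preserves the weight `p`. It is a polynomial in `Θ`, so it
acts on `v` and `v'` by one scalar `c`; the two equations give `c = 0` and `c • v' = v'`. -/
theorem IsWeightAlgebra.eq_zero_of_smul_eq (h : IsWeightAlgebra Θ) {p : J → ℂ} {v : M} {v' : N}
    (hv : ∀ j, Θ j • v = p j • v) (hv' : ∀ j, Θ j • v' = p j • v') (hv0 : v ≠ 0) {u : E}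
    (hu : u • v = 0) (hu' : u • v' = v') : v' = 0 := by
  classical
  obtain ⟨F, hF, rfl⟩ := h.exists_finsupp u
  have hinj : Function.Injective fun (m : J → ℂ) j => p j + m j := fun m m' e =>
    funext fun j => add_left_cancel (congrFun e j)
  set s := insert 0 F.support with hs
  have hsum : F.sum (fun _ y => y) = ∑ m ∈ s, F m :=
    Finsupp.sum_of_support_subset _ (Finset.subset_insert _ _) _ (by simp)
  rw [hsum, Finset.sum_smul] at hu hu'
  have h0 : (0 : J → ℂ) ∈ s := Finset.mem_insert_self _ _
  have h1 : F 0 • v ∈ (⊥ : Submodule ℂ M) :=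
    Submodule.mem_of_sum_weight_mem (fun j => Algebra.lsmul ℂ ℂ M (Θ j)) ⊥ (by simp)
      (fun m j => p j + m j) hinj s (fun m => F m • v)
      (fun m _ j => smul_smul_weight hv (hF m) j) (by rw [hu]; exact zero_mem _) h0
  -- With `v'` subtracted in weight zero, `u • v' = v'` becomes a vanishing sum of weight vectors.
  have h2 : F 0 • v' - v' ∈ (⊥ : Submodule ℂ N) := by
    have := Submodule.mem_of_sum_weight_mem (fun j => Algebra.lsmul ℂ ℂ N (Θ j)) ⊥ (by simp)
      (fun m j => p j + m j) hinj s (fun m => F m • v' - if m = 0 then v' else 0) ?_ ?_ h0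
    · simpa using this
    · intro m _ j
      rw [map_sub, smul_sub]
      congr 1
      · exact smul_smul_weight hv' (hF m) j
      · split_ifs with hm
        · subst hm; simpa using hv' j
        · simp
    · rw [Finset.sum_sub_distrib, hu', Finset.sum_ite_eq' s, if_pos h0, sub_self]
      exact zero_mem _
  obtain ⟨c, hc, hc'⟩ := exists_eq_smul_of_mem_adjoin hv hv' ((hF 0).2 rfl)
  rw [Submodule.mem_bot, hc] at h1
  have hc0 : c = 0 := (smul_eq_zero.1 h1).resolve_right hv0
  rw [Submodule.mem_bot, hc', hc0, zero_smul, zero_sub, neg_eq_zero] at h2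
  exact h2

/-- Simple modules with a common weight are isomorphic. -/
theorem IsWeightAlgebra.nonempty_linearEquiv (h : IsWeightAlgebra Θ) [IsSimpleModule E M]
    [IsSimpleModule E N] {p : J → ℂ} (hM : IsWeightOf Θ M p) (hN : IsWeightOf Θ N p) :
    Nonempty (M ≃ₗ[E] N) := by
  obtain ⟨v, hv0, hv⟩ := hM
  obtain ⟨v', hv0', hv'⟩ := hN
  -- As in Goursat's lemma, the submodule generated by the pair is the graph of an isomorphism.
  let Γ : Submodule E (M × N) := Submodule.span E {(v, v')}
  have hmem : (v, v') ∈ Γ := Submodule.mem_span_singleton_self _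
  let f : Γ →ₗ[E] M := (LinearMap.fst E M N).comp Γ.subtype
  let g : Γ →ₗ[E] N := (LinearMap.snd E M N).comp Γ.subtype
  have hf : Function.Surjective f := by
    rw [← LinearMap.range_eq_top]
    refine (eq_bot_or_eq_top _).resolve_left fun e => hv0 ?_
    have : v ∈ LinearMap.range f := ⟨⟨_, hmem⟩, rfl⟩
    rwa [e, Submodule.mem_bot] at this
  have hg : Function.Surjective g := by
    rw [← LinearMap.range_eq_top]
    refine (eq_bot_or_eq_top _).resolve_left fun e => hv0' ?_
    have : v' ∈ LinearMap.range g := ⟨⟨_, hmem⟩, rfl⟩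
    rwa [e, Submodule.mem_bot] at this
  have hf' : Function.Injective f := by
    -- The kernel of the projection to `M` is a submodule of `N`. Were it everything, some `u` would
    -- kill `v` and fix `v'`.
    have hK : Γ.comap (LinearMap.inr E M N) = ⊥ := by
      refine (eq_bot_or_eq_top _).resolve_right fun e => hv0' ?_
      have : v' ∈ Γ.comap (LinearMap.inr E M N) := by rw [e]; exact Submodule.mem_top
      obtain ⟨u, hu⟩ := Submodule.mem_span_singleton.1 (Submodule.mem_comap.1 this)
      exact h.eq_zero_of_smul_eq hv hv' hv0 (congrArg Prod.fst hu) (congrArg Prod.snd hu)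
    rw [injective_iff_map_eq_zero]
    rintro ⟨⟨a, b⟩, hab⟩ (e : a = 0)
    subst e
    have : b ∈ Γ.comap (LinearMap.inr E M N) := hab
    rw [hK, Submodule.mem_bot] at this
    subst this; rfl
  have hg' : Function.Injective g := by
    have hK : Γ.comap (LinearMap.inl E M N) = ⊥ := by
      refine (eq_bot_or_eq_top _).resolve_right fun e => hv0 ?_
      have : v ∈ Γ.comap (LinearMap.inl E M N) := by rw [e]; exact Submodule.mem_top
      obtain ⟨u, hu⟩ := Submodule.mem_span_singleton.1 (Submodule.mem_comap.1 this)
      exact h.eq_zero_of_smul_eq hv' hv hv0' (congrArg Prod.snd hu) (congrArg Prod.fst hu)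
    rw [injective_iff_map_eq_zero]
    rintro ⟨⟨a, b⟩, hab⟩ (e : b = 0)
    subst e
    have : a ∈ Γ.comap (LinearMap.inl E M N) := hab
    rw [hK, Submodule.mem_bot] at this
    subst this; rfl
  exact ⟨(LinearEquiv.ofBijective f ⟨hf', hf⟩).symm.trans (LinearEquiv.ofBijective g ⟨hg', hg⟩)⟩

theorem exists_isWeightOf [Finite J] (hΘ : ∀ i j, Commute (Θ i) (Θ j)) [FiniteDimensional ℂ M]
    [Nontrivial M] : ∃ p, IsWeightOf Θ M p := by
  obtain ⟨p, v, hv, h⟩ := Module.End.exists_joint_eigenvector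
    (fun j => Algebra.lsmul ℂ ℂ M (Θ j)) fun i j => (hΘ i j).map _
  exact ⟨p, v, hv, h⟩

theorem IsWeightOf.of_injective (f : M →ₗ[E] N) (hf : Function.Injective f) {p : J → ℂ} :
    IsWeightOf Θ M p → IsWeightOf Θ N p := by
  rintro ⟨v, hv, h⟩
  refine ⟨f v, fun e => hv (hf (e.trans (map_zero f).symm)), fun j => ?_⟩
  rw [← map_smul, h, LinearMap.map_smul_of_tower]

end Modules

theorem IsWeightAlgebra.map {E' : Type} [Ring E'] [Algebra ℂ E'] (h : IsWeightAlgebra Θ)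
    (f : E →ₐ[ℂ] E') (hf : Function.Surjective f) : IsWeightAlgebra fun j => f (Θ j) where
  commute i j := (h.commute i j).map f
  iSup_eq_top := by
    rw [eq_top_iff, ← LinearMap.range_eq_top.2 (show Function.Surjective f.toLinearMap from hf),
      LinearMap.range_eq_map, ← h.iSup_eq_top, Submodule.map_iSup]
    refine iSup_mono fun m => ?_
    rintro _ ⟨u, hu, rfl⟩
    refine ⟨fun j => ?_, fun hm => ?_⟩
    · have := congrArg f (hu.1 j)
      simpa using this
    · have h1 := Subalgebra.mem_map.2 ⟨u, hu.2 hm, (rfl : f u = f u)⟩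
      rwa [AlgHom.map_adjoin, ← Set.range_comp] at h1

-- Passing to the opposite algebra reverses commutators, so weight `m` becomes weight `-m` and
-- weight zero is kept.
open MulOpposite in
theorem IsWeightAlgebra.op (h : IsWeightAlgebra Θ) : IsWeightAlgebra fun j => MulOpposite.op (Θ j) where
  commute i j := (h.commute i j).op
  iSup_eq_top := by
    rw [eq_top_iff, ← LinearEquiv.range (opLinearEquiv ℂ : E ≃ₗ[ℂ] Eᵐᵒᵖ),
      LinearMap.range_eq_map, ← h.iSup_eq_top, Submodule.map_iSup]
    refine iSup_le fun m => le_iSup_of_le (-m) ?_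
    rintro _ ⟨u, hu, rfl⟩
    refine ⟨fun j => ?_, fun hm => ?_⟩
    · have := congrArg MulOpposite.op (hu.1 j)
      simp only [op_sub, op_mul, op_smul] at this
      simp only [LinearEquiv.coe_coe, coe_opLinearEquiv, Pi.neg_apply, neg_smul]
      rw [← this, neg_sub]
    · have h1 := hu.2 (neg_eq_zero.1 hm)
      have h2 : MulOpposite.op u ∈ (Algebra.adjoin ℂ (Set.range Θ)).op := h1
      rw [Subalgebra.op_adjoin] at h2
      have h3 : MulOpposite.unop ⁻¹' Set.range Θ = Set.range fun j => MulOpposite.op (Θ j) := by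
        ext y
        exact exists_congr fun j =>
          ⟨fun e => MulOpposite.unop_injective e, fun e => congrArg MulOpposite.unop e⟩
      rwa [h3] at h2

/-- A tensor of weight vectors has the pair of their weights. When both vanish, it is a polynomial
in the left operators times one in the right operators. -/
theorem IsWeightAlgebra.tensor {J' E' : Type} [Ring E'] [Algebra ℂ E'] {Θ' : J' → E'}
    (h : IsWeightAlgebra Θ) (h' : IsWeightAlgebra Θ') :
    IsWeightAlgebra (Sum.elim (fun j => Θ j ⊗ₜ[ℂ] (1 : E')) fun j => (1 : E) ⊗ₜ[ℂ] Θ' j) where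
  commute := by
    rintro (i | i) (j | j) <;> simp only [Sum.elim_inl, Sum.elim_inr, Commute, SemiconjBy,
      Algebra.TensorProduct.tmul_mul_tmul, one_mul, mul_one]
    · rw [(h.commute i j).eq]
    · rw [(h'.commute i j).eq]
  iSup_eq_top := by
    rw [eq_top_iff]
    rintro u -
    induction u using TensorProduct.induction_on with
    | zero => exact zero_mem _
    | add u v hu hv => exact add_mem hu hv
    | tmul a b =>
      have ha : a ∈ ⨆ m, weightPart Θ m := h.iSup_eq_top ▸ Submodule.mem_top
      have hb : b ∈ ⨆ m, weightPart Θ' m := h'.iSup_eq_top ▸ Submodule.mem_top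
      induction ha using Submodule.iSup_induction' with
      | zero => rw [TensorProduct.zero_tmul]; exact zero_mem _
      | add a c _ _ ha hc => rw [TensorProduct.add_tmul]; exact add_mem ha hc
      | mem m a ha =>
        induction hb using Submodule.iSup_induction' with
        | zero => rw [TensorProduct.tmul_zero]; exact zero_mem _
        | add a c _ _ ha hc => rw [TensorProduct.tmul_add]; exact add_mem ha hc
        | mem m' b hb =>
          refine Submodule.mem_iSup_of_mem (Sum.elim m m') ⟨?_, fun hm => ?_⟩
          · rintro (j | j)
            · simp only [Sum.elim_inl, Algebra.TensorProduct.tmul_mul_tmul, one_mul, mul_one]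
              rw [← TensorProduct.sub_tmul, ha.1, TensorProduct.smul_tmul']
            · simp only [Sum.elim_inr, Algebra.TensorProduct.tmul_mul_tmul, one_mul, mul_one]
              rw [← TensorProduct.tmul_sub, hb.1, TensorProduct.tmul_smul]
          · have hm1 : m = 0 := funext fun j => congrFun hm (Sum.inl j)
            have hm2 : m' = 0 := funext fun j => congrFun hm (Sum.inr j)
            have e1 : a ⊗ₜ[ℂ] b = Algebra.TensorProduct.includeLeft (R := ℂ) (S := ℂ) a
                * Algebra.TensorProduct.includeRight b := by simp
            rw [e1]
            refine mul_mem ?_ ?_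
            · have h1 := Subalgebra.mem_map.2 ⟨a, ha.2 hm1, (rfl :
                (Algebra.TensorProduct.includeLeft : E →ₐ[ℂ] E ⊗[ℂ] E') a = _)⟩
              rw [AlgHom.map_adjoin] at h1
              refine Algebra.adjoin_mono ?_ h1
              rintro _ ⟨_, ⟨j, rfl⟩, rfl⟩
              exact ⟨Sum.inl j, rfl⟩
            · have h1 := Subalgebra.mem_map.2 ⟨b, hb.2 hm2, (rfl :
                (Algebra.TensorProduct.includeRight : E' →ₐ[ℂ] E ⊗[ℂ] E') b = _)⟩
              rw [AlgHom.map_adjoin] at h1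
              refine Algebra.adjoin_mono ?_ h1
              rintro _ ⟨_, ⟨j, rfl⟩, rfl⟩
              exact ⟨Sum.inr j, rfl⟩

end WeightAlgebra

/-! ## Classifications by weights -/

/-- The vector space `V` with the action of `E` given by a homomorphism to its endomorphisms. -/
def RepModule {E V : Type} [Ring E] [Algebra ℂ E] [AddCommGroup V] [Module ℂ V]
    (_ρ : E →ₐ[ℂ] Module.End ℂ V) : Type := V

namespace RepModule

section
variable {E V : Type} [Ring E] [Algebra ℂ E] [AddCommGroup V] [Module ℂ V]
    (ρ : E →ₐ[ℂ] Module.End ℂ V)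

instance : AddCommGroup (RepModule ρ) := inferInstanceAs (AddCommGroup V)

instance : Module ℂ (RepModule ρ) := inferInstanceAs (Module ℂ V)

instance [FiniteDimensional ℂ V] : FiniteDimensional ℂ (RepModule ρ) :=
  inferInstanceAs (FiniteDimensional ℂ V)

instance : Module E (RepModule ρ) := Module.compHom V (ρ : E →+* Module.End ℂ V)

instance : IsScalarTower ℂ E (RepModule ρ) :=
  ⟨fun c u v => by
    exact LinearMap.congr_fun (map_smul ρ c u) (show V from v)⟩

end

end RepModule

section Classify
variable {J E X : Type} [Ring E] [Algebra ℂ E]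

/-- The sets of weights of the finite-dimensional simple modules are the `Ω x`, and these are
pairwise disjoint. -/
structure ClassifiesSimple (Θ : J → E) (Ω : X → Set (J → ℂ)) : Prop where
  isWeightAlgebra : IsWeightAlgebra Θ
  eq_of_mem : ∀ {x y : X} {p : J → ℂ}, p ∈ Ω x → p ∈ Ω y → x = y
  exists_simple : ∀ x, ∃ L : FDSimple E, ∀ p, IsWeightOf Θ L.carrier p ↔ p ∈ Ω x
  exists_mem : ∀ (M : FDSimple E) (p : J → ℂ), IsWeightOf Θ M.carrier p → ∃ x, p ∈ Ω x

namespace ClassifiesSimple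

variable {Θ : J → E} {Ω : X → Set (J → ℂ)} (h : ClassifiesSimple Θ Ω)
include h

/-- A simple module has some weight `p`, which lies in some `Ω x`; the model for `x` shares this
weight and is therefore isomorphic to it. -/
theorem exists_isWeightOf_iff [Finite J] (M : FDSimple E) :
    ∃ x, ∀ p, IsWeightOf Θ M.carrier p ↔ p ∈ Ω x := by
  have := IsSimpleModule.nontrivial E M.carrier
  obtain ⟨p, hp⟩ := exists_isWeightOf (M := M.carrier) h.isWeightAlgebra.commute
  obtain ⟨x, hx⟩ := h.exists_mem M p hp
  obtain ⟨L, hL⟩ := h.exists_simple x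
  obtain ⟨e⟩ := h.isWeightAlgebra.nonempty_linearEquiv hp ((hL p).2 hx)
  refine ⟨x, fun q => Iff.trans ⟨fun hq => ?_, fun hq => ?_⟩ (hL q)⟩
  · exact hq.of_injective e.toLinearMap e.injective
  · exact hq.of_injective e.symm.toLinearMap e.symm.injective

theorem nonempty_equiv [Finite J] {M N : FDSimple E} {x : X}
    (hM : ∀ p, IsWeightOf Θ M.carrier p ↔ p ∈ Ω x) (hN : ∀ p, IsWeightOf Θ N.carrier p ↔ p ∈ Ω x) :
    Nonempty (M.carrier ≃ₗ[E] N.carrier) := by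
  have := IsSimpleModule.nontrivial E M.carrier
  obtain ⟨p, hp⟩ := exists_isWeightOf (M := M.carrier) h.isWeightAlgebra.commute
  exact h.isWeightAlgebra.nonempty_linearEquiv hp ((hN p).2 ((hM p).1 hp))

end ClassifiesSimple

/-- A group `G` acts compatibly on the algebra, on the family `Θ` and on the index set `X`. -/
structure IsEquivariantFamily {G : Type} [Group G] [MulAction G X] (ψ : G →* (E →ₐ[ℂ] E))
    (π : G → J → J) (Θ : J → E) (Ω : X → Set (J → ℂ)) : Prop where
  apply_eq : ∀ g j, ψ g (Θ j) = Θ (π g j)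
  comp_mem : ∀ g x p, p ∈ Ω x → (fun j => p (π g⁻¹ j)) ∈ Ω (g • x)

section Group
variable {G : Type} [Group G] [MulAction G X] {ψ : G →* (E →ₐ[ℂ] E)} {π : G → J → J}
  {Θ : J → E} {Ω : X → Set (J → ℂ)}

theorem IsEquivariantFamily.isWeightOf_pullback (hπ : IsEquivariantFamily ψ π Θ Ω) {M : Type}
    [AddCommGroup M] [Module ℂ M] [Module E M] (g : G) {p : J → ℂ} (hp : IsWeightOf Θ M p) :
    IsWeightOf Θ (Pullback (ψ g⁻¹) M) fun j => p (π g⁻¹ j) := by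
  obtain ⟨v, hv, h⟩ := hp
  refine ⟨v, hv, fun j => ?_⟩
  change (ψ g⁻¹ (Θ j) • v : M) = p (π g⁻¹ j) • v
  rw [hπ.apply_eq, h]

namespace ClassifiesSimple

variable [Finite J] (h : ClassifiesSimple Θ Ω) (hπ : IsEquivariantFamily ψ π Θ Ω)
include h hπ

/-- One weight decides: a weight of `M`, moved by `g`, lies in `Ω (g • x)`, and disjointness leaves
no other label for the twist. -/
theorem isWeightOf_twist_iff {M : FDSimple E} {x : X}
    (hM : ∀ p, IsWeightOf Θ M.carrier p ↔ p ∈ Ω x) (g : G) (p : J → ℂ) :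
    IsWeightOf Θ (M.twist ψ g).carrier p ↔ p ∈ Ω (g • x) := by
  have := IsSimpleModule.nontrivial E M.carrier
  obtain ⟨q, hq⟩ := exists_isWeightOf (M := M.carrier) h.isWeightAlgebra.commute
  have h1 := hπ.isWeightOf_pullback (M := M.carrier) g hq
  have h2 := hπ.comp_mem g x q ((hM q).1 hq)
  obtain ⟨y, hy⟩ := h.exists_isWeightOf_iff (M.twist ψ g)
  exact (hy p).trans (by rw [h.eq_of_mem ((hy _).1 h1) h2])

theorem exists_twist_equiv [MulAction.IsPretransitive G X] (M N : FDSimple E) :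
    ∃ g : G, Nonempty ((M.twist ψ g).carrier ≃ₗ[E] N.carrier) := by
  obtain ⟨x, hx⟩ := h.exists_isWeightOf_iff M
  obtain ⟨y, hy⟩ := h.exists_isWeightOf_iff N
  obtain ⟨g, rfl⟩ := MulAction.exists_smul_eq G x y
  exact ⟨g, h.nonempty_equiv (h.isWeightOf_twist_iff hπ hx g) hy⟩

theorem eq_one_of_twist_equiv (hfree : ∀ (g : G) (x : X), g • x = x → g = 1) (M : FDSimple E)
    (g : G) (e : (M.twist ψ g).carrier ≃ₗ[E] M.carrier) : g = 1 := by
  obtain ⟨x, hx⟩ := h.exists_isWeightOf_iff M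
  have := IsSimpleModule.nontrivial E M.carrier
  obtain ⟨q, hq⟩ := exists_isWeightOf (M := M.carrier) h.isWeightAlgebra.commute
  have h1 : IsWeightOf Θ (M.twist ψ g).carrier q :=
    hq.of_injective e.symm.toLinearMap e.symm.injective
  exact hfree g x (h.eq_of_mem ((h.isWeightOf_twist_iff hπ hx g q).1 h1) ((hx q).1 hq))

end ClassifiesSimple

/-! ## Induced equivariant modules -/

/-- The equivariant module induced from a module `V`: functions on the group with values in `V`,
on which the algebra acts at `g` through the `g`-th twist. -/
def Induced (_ψ : G →* (E →ₐ[ℂ] E)) (V : Type) : Type := G → V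

namespace Induced

section
variable {V : Type} [AddCommGroup V]

instance : AddCommGroup (Induced ψ V) := inferInstanceAs (AddCommGroup (G → V))

instance [Module ℂ V] : Module ℂ (Induced ψ V) := inferInstanceAs (Module ℂ (G → V))

instance [Finite G] [Module ℂ V] [FiniteDimensional ℂ V] : FiniteDimensional ℂ (Induced ψ V) :=
  inferInstanceAs (FiniteDimensional ℂ (G → V))

instance [Module E V] : Module E (Induced ψ V) :=
  inferInstanceAs (Module E (∀ g : G, Pullback (ψ g⁻¹) V))

/-- The value of an element of the induced module, as an element of a twist. -/
def eval [Module E V] (ψ : G →* (E →ₐ[ℂ] E)) (g : G) :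
    Induced ψ V →ₗ[E] Pullback (ψ g⁻¹) V where
  toFun f := (f : G → V) g
  map_add' _ _ := rfl
  map_smul' _ _ := rfl

theorem smul_eq [Module E V] (u : E) (f : G → V) :
    (u • (show Induced ψ V from f) : Induced ψ V) = fun g => ψ g⁻¹ u • f g := rfl

theorem smul_single [Module E V] [DecidableEq G] (g : G) (u : E) (v : V) :
    u • (show Induced ψ V from Pi.single g v) = (Pi.single g (ψ g⁻¹ u • v) : G → V) := by
  refine (smul_eq u _).trans (funext fun l => ?_)
  rcases eq_or_ne l g with rfl | hl
  · rw [Pi.single_eq_same, Pi.single_eq_same]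
  · rw [Pi.single_eq_of_ne hl, Pi.single_eq_of_ne hl, smul_zero]

variable [Module ℂ V]

instance [Module E V] [IsScalarTower ℂ E V] : IsScalarTower ℂ E (Induced ψ V) :=
  inferInstanceAs (IsScalarTower ℂ E (∀ g : G, Pullback (ψ g⁻¹) V))

variable (ψ V) in
/-- The translation action of the group on the induced module. -/
def rep : Representation ℂ G (Induced ψ V) where
  toFun k :=
    { toFun := fun f g => (f : G → V) (k⁻¹ * g)
      map_add' := fun _ _ => rfl
      map_smul' := fun _ _ => rfl }
  map_one' := LinearMap.ext fun f => funext fun g =>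
    congrArg (f : G → V) (show 1⁻¹ * g = g by rw [inv_one, one_mul])
  map_mul' k l := LinearMap.ext fun f => funext fun g =>
    congrArg (f : G → V) (show (k * l)⁻¹ * g = l⁻¹ * (k⁻¹ * g) by rw [mul_inv_rev, mul_assoc])

theorem rep_eq (k : G) (f : G → V) :
    (rep ψ V k (show Induced ψ V from f) : G → V) = fun g => f (k⁻¹ * g) := rfl

theorem rep_smul [Module E V] (k : G) (u : E) (f : Induced ψ V) :
    rep ψ V k (u • f) = ψ k u • rep ψ V k f :=
  funext fun g => congrArg (· • (f : G → V) (k⁻¹ * g))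
    (show ψ (k⁻¹ * g)⁻¹ u = ψ g⁻¹ (ψ k u) by
      rw [mul_inv_rev, inv_inv, map_mul, AlgHom.mul_apply])

theorem rep_single [DecidableEq G] (k g : G) (v : V) :
    rep ψ V k (show Induced ψ V from Pi.single g v) = (Pi.single (k * g) v : G → V) := by
  refine (rep_eq k _).trans (funext fun l => ?_)
  rcases eq_or_ne l (k * g) with rfl | hl
  · rw [inv_mul_cancel_left, Pi.single_eq_same, Pi.single_eq_same]
  · rw [Pi.single_eq_of_ne hl, Pi.single_eq_of_ne]
    rintro rfl
    exact hl (mul_inv_cancel_left k l).symm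

end

variable [Finite J] (h : ClassifiesSimple Θ Ω) (hπ : IsEquivariantFamily ψ π Θ Ω)

section
include h hπ

/-- Evaluation at `g` is a module map to a twist, so it sends a weight vector to zero or to a vector
of the same weight. -/
theorem isWeightOf_eval {N : FDSimple E} {x : X}
    (hN : ∀ p, IsWeightOf Θ N.carrier p ↔ p ∈ Ω x) {f : Induced ψ N.carrier} {P : J → ℂ}
    (hP : ∀ j, Θ j • f = P j • f) {g : G} (hg : (f : G → N.carrier) g ≠ 0) : P ∈ Ω (g • x) :=
  (h.isWeightOf_twist_iff hπ hN g P).1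
    ⟨eval ψ g f, hg, fun j => ((eval ψ g).map_smul (Θ j) f).symm.trans (congrArg (eval ψ g) (hP j))⟩

variable [Finite G]

/-- Since the action on `X` is free, distinct twists of `N` have disjoint sets of weights, and a
weight vector of a stable submodule is supported at one group element. Simplicity of `N` fills that
copy, and translations reach the others. -/
theorem eq_bot_or_eq_top (hfree : ∀ (g : G) (x : X), g • x = x → g = 1) (N : FDSimple E)
    (K : Submodule E (Induced ψ N.carrier))
    (hK : ∀ g, ∀ v ∈ K, rep ψ N.carrier g v ∈ K) : K = ⊥ ∨ K = ⊤ := by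
  classical
  have := Fintype.ofFinite G
  refine or_iff_not_imp_left.2 fun hbot => ?_
  have hnt : Nontrivial K := Submodule.nontrivial_iff_ne_bot.2 hbot
  have hfd : FiniteDimensional ℂ K :=
    inferInstanceAs (FiniteDimensional ℂ (K.restrictScalars ℂ))
  obtain ⟨P, ⟨⟨f, hf⟩, hf0, hP⟩⟩ := exists_isWeightOf (M := K) h.isWeightAlgebra.commute
  obtain ⟨x, hx⟩ := h.exists_isWeightOf_iff N
  have hmem : ∀ g, (f : G → N.carrier) g ≠ 0 → P ∈ Ω (g • x) := fun g =>
    isWeightOf_eval h hπ hx fun j => congrArg Subtype.val (hP j)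
  obtain ⟨g, hg⟩ : ∃ g, (f : G → N.carrier) g ≠ 0 := by
    by_contra! e
    exact hf0 (Subtype.ext (funext e))
  have hsingle : (f : G → N.carrier) = Pi.single g ((f : G → N.carrier) g) := by
    funext l
    rcases eq_or_ne l g with rfl | hl
    · rw [Pi.single_eq_same]
    · rw [Pi.single_eq_of_ne hl]
      by_contra hl0
      apply hl
      have e := h.eq_of_mem (hmem l hl0) (hmem g hg)
      exact (inv_mul_eq_one.1 (hfree (g⁻¹ * l) x (by rw [mul_smul, e, inv_smul_smul]))).symm
  have hall : ∀ v : N.carrier, (show Induced ψ N.carrier from Pi.single g v) ∈ K := by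
    intro v
    have htop : Submodule.span E {(f : G → N.carrier) g} = ⊤ :=
      (IsSimpleOrder.eq_bot_or_eq_top _).resolve_left
        fun e => hg (Submodule.span_singleton_eq_bot.1 e)
    obtain ⟨u, rfl⟩ := Submodule.mem_span_singleton.1 (htop ▸ Submodule.mem_top : v ∈ _)
    -- At position `g` the algebra acts through `ψ g⁻¹`, which turns `ψ g u` back into `u`.
    have e : (show Induced ψ N.carrier from Pi.single g (u • (f : G → N.carrier) g))
        = ψ g u • f := by
      conv_rhs => rw [show f = (show Induced ψ N.carrier from
        Pi.single g ((f : G → N.carrier) g)) from hsingle]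
      rw [smul_single, inv_apply_apply]
    rw [e]
    exact K.smul_mem _ hf
  refine eq_top_iff.2 fun F _ => ?_
  have e : F = ∑ l, (show Induced ψ N.carrier from Pi.single l ((F : G → N.carrier) l)) :=
    (Finset.univ_sum_single (F : G → N.carrier)).symm
  rw [e]
  refine K.sum_mem fun l _ => ?_
  have h2 := hK (l * g⁻¹) _ (hall ((F : G → N.carrier) l))
  have h3 := rep_single (ψ := ψ) (l * g⁻¹) g ((F : G → N.carrier) l)
  rw [inv_mul_cancel_right] at h3
  exact h3 ▸ h2

end

/-- The induced module of a simple module as a simple equivariant module. -/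
@[reducible]
def toEquivariant [Finite G] (hfree : ∀ (g : G) (x : X), g • x = x → g = 1) (N : FDSimple E) :
    EquivariantFDSimple ψ where
  carrier := Induced ψ N.carrier
  rep := rep ψ N.carrier
  rep_smul := rep_smul
  nontrivial :=
    have := IsSimpleModule.nontrivial E N.carrier
    inferInstanceAs (Nontrivial (G → N.carrier))
  eq_bot_or_eq_top := eq_bot_or_eq_top h hπ hfree N

/-- The equivariant map out of the induced module determined by a linear map. -/
noncomputable def lift (B : EquivariantFDSimple ψ) {V : Type} [AddCommGroup V] [Module E V]
    (φ : V →ₗ[E] B.carrier) [Fintype G] : Induced ψ V →ₗ[E] B.carrier where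
  toFun f := ∑ g, B.rep g (φ ((f : G → V) g))
  map_add' f f' := by
    rw [← Finset.sum_add_distrib]
    refine Finset.sum_congr rfl fun g _ => ?_
    rw [← map_add, ← map_add]
    rfl
  map_smul' u f := by
    rw [RingHom.id_apply, Finset.smul_sum]
    refine Finset.sum_congr rfl fun g _ => ?_
    have e : ((u • f : Induced ψ V) : G → V) g = ψ g⁻¹ u • (f : G → V) g := rfl
    rw [e, map_smul, B.rep_smul]
    congr 1
    simpa using inv_apply_apply ψ g⁻¹ u

theorem lift_apply (B : EquivariantFDSimple ψ) {V : Type} [AddCommGroup V] [Module E V]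
    (φ : V →ₗ[E] B.carrier) [Fintype G] (f : Induced ψ V) :
    lift B φ f = ∑ g, B.rep g (φ ((f : G → V) g)) := rfl

theorem lift_single (B : EquivariantFDSimple ψ) {V : Type} [AddCommGroup V] [Module E V]
    (φ : V →ₗ[E] B.carrier) [Fintype G] [DecidableEq G] (v : V) :
    lift B φ (show Induced ψ V from Pi.single 1 v) = φ v := by
  change ∑ g, B.rep g (φ ((Pi.single 1 v : G → V) g)) = φ v
  rw [Finset.sum_eq_single 1, map_one, Module.End.one_apply, Pi.single_eq_same]
  · intro l _ hl
    rw [Pi.single_eq_of_ne hl, map_zero, map_zero]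
  · simp

theorem lift_rep (B : EquivariantFDSimple ψ) {V : Type} [AddCommGroup V] [Module ℂ V] [Module E V]
    (φ : V →ₗ[E] B.carrier) [Fintype G] (k : G) (f : Induced ψ V) :
    lift B φ (rep ψ V k f) = B.rep k (lift B φ f) := by
  rw [lift_apply, lift_apply, map_sum, ← Equiv.sum_comp (Equiv.mulLeft k)]
  refine Finset.sum_congr rfl fun g _ => ?_
  rw [Equiv.coe_mulLeft, map_mul, Module.End.mul_apply]
  congr 3
  exact congrArg (f : G → V) (inv_mul_cancel_left k g)

end Induced

/-- A nonzero equivariant map between simple equivariant modules is an isomorphism. -/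
theorem EquivariantFDSimple.equiv_of_ne_zero (M N : EquivariantFDSimple ψ)
    (f : M.carrier →ₗ[E] N.carrier) (hf : ∀ g v, f (M.rep g v) = N.rep g (f v)) (h0 : f ≠ 0) :
    M ≈ N := by
  have hinj : Function.Injective f := by
    rw [← LinearMap.ker_eq_bot]
    refine (M.eq_bot_or_eq_top _ fun g v hv => ?_).resolve_right
      fun e => h0 (LinearMap.ker_eq_top.1 e)
    rw [LinearMap.mem_ker] at hv ⊢
    rw [hf, hv, map_zero]
  have hsurj : Function.Surjective f := by
    rw [← LinearMap.range_eq_top]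
    refine (N.eq_bot_or_eq_top _ fun g v hv => ?_).resolve_left
      fun e => h0 (LinearMap.range_eq_bot.1 e)
    obtain ⟨u, rfl⟩ := hv
    exact ⟨M.rep g u, hf g u⟩
  exact ⟨LinearEquiv.ofBijective f ⟨hinj, hsurj⟩, hf⟩

/-- When the group acts freely on the simple modules, the simple equivariant modules are in
bijection with the orbits. -/
theorem ClassifiesSimple.card_equivariant [Finite J] [Finite G] (h : ClassifiesSimple Θ Ω)
    (hπ : IsEquivariantFamily ψ π Θ Ω) (hfree : ∀ (g : G) (x : X), g • x = x → g = 1)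
    {T : Type} (r : T → X) (hr : ∀ x, ∃ (g : G) (t : T), g • x = r t)
    (hr' : ∀ (g : G) (t t' : T), g • r t = r t' → t = t') :
    Nat.card (EquivariantFDSimpleClasses ψ) = Nat.card T := by
  classical
  have := Fintype.ofFinite G
  choose L hL using h.exists_simple
  refine (Nat.card_congr (Equiv.ofBijective (fun t =>
    (Quotient.mk _ (Induced.toEquivariant h hπ hfree (L (r t))) :
      EquivariantFDSimpleClasses ψ)) ⟨fun t t' htt => ?_, fun B => ?_⟩)).symm
  -- Injectivity: an isomorphism carries a weight in `Ω (r t)` to the module induced from `L (r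
  -- t')`, whose weights lie in the sets `Ω (g • r t')`.
  · obtain ⟨e, -⟩ := Quotient.exact htt
    have := IsSimpleModule.nontrivial E (L (r t)).carrier
    obtain ⟨P, v, hv, hP⟩ :=
      exists_isWeightOf (M := (L (r t)).carrier) h.isWeightAlgebra.commute
    let f : Induced ψ (L (r t)).carrier := (Pi.single 1 v : G → (L (r t)).carrier)
    have hf : ∀ j, Θ j • f = P j • f := by
      intro j
      refine (Induced.smul_single 1 (Θ j) v).trans ?_
      rw [inv_one, map_one, AlgHom.one_apply, hP]
      exact Pi.single_smul (f := fun _ : G => (L (r t)).carrier) (1 : G) (P j) v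
    have hf0 : f ≠ 0 := fun e0 => hv <|
      (Pi.single_eq_same (M := fun _ : G => (L (r t)).carrier) (1 : G) v).symm.trans
        (congrFun e0 1)
    have hef : ∀ j, Θ j • e f = P j • e f := by
      intro j
      rw [← map_smul, hf]
      exact LinearMap.map_smul_of_tower e.toLinearMap (P j) f
    obtain ⟨g, hg⟩ : ∃ g, ((e f : Induced ψ (L (r t')).carrier) : G → (L (r t')).carrier) g ≠ 0 := by
      by_contra! e0
      exact hf0 (e.map_eq_zero_iff.1 (funext e0))
    have h1 := Induced.isWeightOf_eval h hπ (hL (r t')) hef hg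
    exact (hr' g t' t (h.eq_of_mem h1 ((hL _ _).1 ⟨v, hv, hP⟩))).symm
  -- Surjectivity: `B` has a simple submodule. Translated by a group element, its label becomes a
  -- chosen representative, and the resulting embedding into `B` extends to an equivariant map from
  -- the induced module.
  · induction B using Quotient.inductionOn with
    | h B =>
    have := B.nontrivial
    have hart : IsArtinian E B.carrier := isArtinian_of_tower ℂ inferInstance
    obtain ⟨K, hK⟩ := IsAtomic.exists_atom (Submodule E B.carrier)
    have hKs : IsSimpleModule E K := isSimpleModule_iff_isAtom.2 hK
    have hfd : FiniteDimensional ℂ K :=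
      inferInstanceAs (FiniteDimensional ℂ (K.restrictScalars ℂ))
    let M : FDSimple E := { carrier := K }
    obtain ⟨x, hx⟩ := h.exists_isWeightOf_iff M
    obtain ⟨g, t, ht⟩ := hr x
    refine ⟨t, Quotient.sound ?_⟩
    have hM := h.isWeightOf_twist_iff hπ hx g
    rw [ht] at hM
    obtain ⟨e⟩ := h.nonempty_equiv (hL (r t)) hM
    let φ : (M.twist ψ g).carrier →ₗ[E] B.carrier :=
      { toFun := fun v => B.rep g (show K from v).1
        map_add' := fun v v' => map_add (B.rep g) (show K from v).1 (show K from v').1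
        map_smul' := fun u v => (B.rep_smul g (ψ g⁻¹ u) (show K from v).1).trans
          (congrArg (· • B.rep g (show K from v).1) (by simpa using inv_apply_apply ψ g⁻¹ u)) }
    have hφ : Function.Injective φ := by
      intro v v' hvv
      have h1 := congrArg (B.rep g⁻¹) hvv
      change B.rep g⁻¹ (B.rep g (show K from v).1) = B.rep g⁻¹ (B.rep g (show K from v').1) at h1
      rw [Representation.inv_self_apply, Representation.inv_self_apply] at h1
      exact Subtype.ext h1
    let χ := φ.comp e.toLinearMap
    have hχ : Function.Injective χ := hφ.comp e.injective
    have := IsSimpleModule.nontrivial E (L (r t)).carrier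
    obtain ⟨v, hv⟩ := exists_ne (0 : (L (r t)).carrier)
    refine EquivariantFDSimple.equiv_of_ne_zero _ _ (Induced.lift B χ)
      (Induced.lift_rep B χ) fun h0 => hv (hχ ?_)
    exact (Induced.lift_single B χ v).symm.trans
      ((LinearMap.congr_fun h0 _).trans (map_zero χ).symm)

end Group
end Classify

/-! ## Monomials in the Weyl algebra -/

namespace Weyl

section
variable {ι : Type} [DecidableEq ι]

/-- The Euler operator `x a ∂ a`. -/
def euler (a : ι) : Weyl ι := x a * d a

theorem d_mul_x_self (a : ι) : (d a * x a : Weyl ι) = euler a + 1 := by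
  have h := x_mul_d_sub a a
  rw [if_pos rfl] at h
  rw [euler, ← sub_eq_iff_eq_add', ← neg_sub, h, neg_neg]

theorem commute_x_d {a b : ι} (h : a ≠ b) : Commute (x a : Weyl ι) (d b) := by
  have h1 := x_mul_d_sub a b
  rwa [if_neg h, neg_zero, sub_eq_zero] at h1

theorem euler_mul_x (a : ι) : (euler a * x a : Weyl ι) = x a * (euler a + 1) := by
  rw [euler, mul_assoc, d_mul_x_self, euler]

theorem d_mul_euler (a : ι) : (d a * euler a : Weyl ι) = (euler a + 1) * d a := by
  rw [euler, ← mul_assoc, d_mul_x_self, euler]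

theorem euler_mul_x_pow (a : ι) (k : ℕ) :
    (euler a * x a ^ k : Weyl ι) = x a ^ k * (euler a + algebraMap ℂ _ k) := by
  induction k with
  | zero => simp
  | succ k ih =>
    rw [pow_succ, ← mul_assoc, ih, mul_assoc, add_mul, euler_mul_x, Algebra.commutes, ← mul_add,
      mul_assoc]
    congr 2
    push_cast
    abel

theorem euler_mul_d_pow (a : ι) (k : ℕ) :
    (euler a * d a ^ k : Weyl ι) = d a ^ k * (euler a - algebraMap ℂ _ k) := by
  induction k with
  | zero => simp
  | succ k ih =>
    have h : (euler a * d a : Weyl ι) = d a * (euler a - 1) := by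
      rw [mul_sub, d_mul_euler]; noncomm_ring
    rw [pow_succ, ← mul_assoc, ih, mul_assoc, sub_mul, h, Algebra.commutes, ← mul_sub,
      mul_assoc]
    congr 2
    push_cast
    abel

/-- The `k`-th power of `x a` when `0 ≤ k`, and the `-k`-th power of `∂ a` when `k ≤ 0`. -/
def power (a : ι) (k : ℤ) : Weyl ι := x a ^ k.toNat * d a ^ (-k).toNat

theorem power_natCast (a : ι) (k : ℕ) : power a (k : ℤ) = (x a ^ k : Weyl ι) := by
  simp [power]

theorem power_neg_natCast (a : ι) (k : ℕ) : power a (-(k : ℤ)) = (d a ^ k : Weyl ι) := by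
  simp [power]

theorem power_zero (a : ι) : (power a 0 : Weyl ι) = 1 := by simp [power]

theorem commute_power {a b : ι} (h : a ≠ b) (k l : ℤ) :
    Commute (power a k : Weyl ι) (power b l) := by
  have hx : Commute (x a : Weyl ι) (x b) := x_mul_x a b
  have hd : Commute (d a : Weyl ι) (d b) := d_mul_d a b
  refine Commute.mul_left (Commute.mul_right (hx.pow_pow _ _) ((commute_x_d h).pow_pow _ _))
    (Commute.mul_right ((commute_x_d h.symm).symm.pow_pow _ _) (hd.pow_pow _ _))

theorem commute_x_power {a b : ι} (h : a ≠ b) (l : ℤ) : Commute (x a : Weyl ι) (power b l) := by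
  simpa [power] using commute_power h 1 l

theorem commute_d_power {a b : ι} (h : a ≠ b) (l : ℤ) : Commute (d a : Weyl ι) (power b l) := by
  simpa [power] using commute_power h (-1) l

theorem commute_euler_power {a b : ι} (h : a ≠ b) (l : ℤ) :
    Commute (euler a : Weyl ι) (power b l) :=
  (commute_x_power h l).mul_left (commute_d_power h l)

theorem commute_euler (a b : ι) : Commute (euler a : Weyl ι) (euler b) := by
  rcases eq_or_ne a b with rfl | h
  · exact Commute.refl _
  · have h1 : Commute (euler a : Weyl ι) (x b) := by simpa [power] using commute_euler_power h 1
    have h2 : Commute (euler a : Weyl ι) (d b) := by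
      simpa [power] using commute_euler_power h (-1)
    exact h1.mul_right h2

theorem euler_mul_power (a : ι) (k : ℤ) :
    (euler a * power a k : Weyl ι) = power a k * (euler a + algebraMap ℂ _ k) := by
  obtain ⟨n, rfl | rfl⟩ := k.eq_nat_or_neg
  · rw [power_natCast, euler_mul_x_pow, Int.cast_natCast]
  · rw [power_neg_natCast, euler_mul_d_pow, Int.cast_neg, map_neg, Int.cast_natCast,
      sub_eq_add_neg]

/-- The monomial with exponents `m a`, for `a` running over a list. -/
def listMonomial (l : List ι) (m : ι → ℤ) : Weyl ι := (l.map fun a => power a (m a)).prod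

theorem listMonomial_cons (a : ι) (l : List ι) (m : ι → ℤ) :
    listMonomial (a :: l) m = power a (m a) * listMonomial l m := by
  simp [listMonomial]

theorem listMonomial_congr {l : List ι} {m m' : ι → ℤ} (h : ∀ a ∈ l, m a = m' a) :
    listMonomial l m = listMonomial l m' := by
  unfold listMonomial
  congr 1
  exact List.map_congr_left fun a ha => by rw [h a ha]

theorem commute_listMonomial {u : Weyl ι} {l : List ι} {m : ι → ℤ}
    (h : ∀ a ∈ l, Commute u (power a (m a))) : Commute u (listMonomial l m) := by
  refine Commute.list_prod_right _ _ ?_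
  intro y hy
  obtain ⟨a, ha, rfl⟩ := List.mem_map.1 hy
  exact h a ha

theorem euler_mul_listMonomial (a : ι) (l : List ι) (hl : l.Nodup) (m : ι → ℤ) (hm : a ∈ l) :
    euler a * listMonomial l m = listMonomial l m * (euler a + algebraMap ℂ _ (m a)) := by
  induction l with
  | nil => simp at hm
  | cons b l ih =>
    rw [List.nodup_cons] at hl
    rw [listMonomial_cons]
    rcases eq_or_ne a b with rfl | hab
    · have h1 : Commute (euler a) (listMonomial l m) := commute_listMonomial fun c hc =>
        commute_euler_power (fun e : a = c => hl.1 (e ▸ hc)) _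
      rw [← mul_assoc, euler_mul_power, mul_assoc, mul_assoc, add_mul, h1.eq,
        Algebra.commutes, ← mul_add]
    · rw [← mul_assoc, (commute_euler_power hab _).eq, mul_assoc,
        ih hl.2 ((List.mem_cons.1 hm).resolve_left hab), mul_assoc]

/-- The polynomials in the Euler operators. -/
abbrev eulerAlgebra (ι : Type) [DecidableEq ι] : Subalgebra ℂ (Weyl ι) :=
  Algebra.adjoin ℂ (Set.range euler)

theorem euler_mem (a : ι) : euler a ∈ eulerAlgebra ι := Algebra.subset_adjoin ⟨a, rfl⟩

/-- For negative `k` the factor `x a` meets a derivative and forms an Euler operator, which moves to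
the right at the cost of a constant. So a generator shifts the exponent, up to a polynomial in the
Euler operators. -/
theorem x_mul_power (a : ι) (k : ℤ) : ∃ g ∈ eulerAlgebra ι,
    x a * power a k = power a (k + 1) * g ∧ ∀ b l, a ≠ b → Commute g (power b l) := by
  obtain ⟨n, rfl | rfl⟩ := k.eq_nat_or_neg
  · refine ⟨1, one_mem _, ?_, fun _ _ _ => Commute.one_left _⟩
    rw [mul_one, ← Nat.cast_succ, power_natCast, power_natCast, pow_succ']
  · rcases n with _ | n
    · refine ⟨1, one_mem _, ?_, fun _ _ _ => Commute.one_left _⟩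
      simp [power]
    · refine ⟨euler a - algebraMap ℂ _ n,
        sub_mem (euler_mem a) (Subalgebra.algebraMap_mem _ _), ?_, fun b l h =>
        (commute_euler_power h l).sub_left (Algebra.commutes _ _)⟩
      have e : -((n + 1 : ℕ) : ℤ) + 1 = -(n : ℤ) := by push_cast; ring
      rw [e, power_neg_natCast, power_neg_natCast, pow_succ', ← mul_assoc, ← euler,
        euler_mul_d_pow]

theorem d_mul_power (a : ι) (k : ℤ) : ∃ g ∈ eulerAlgebra ι,
    d a * power a k = power a (k - 1) * g ∧ ∀ b l, a ≠ b → Commute g (power b l) := by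
  obtain ⟨n, rfl | rfl⟩ := k.eq_nat_or_neg
  · rcases n with _ | n
    · refine ⟨1, one_mem _, ?_, fun _ _ _ => Commute.one_left _⟩
      simp [power]
    · refine ⟨euler a + algebraMap ℂ _ n + 1,
        add_mem (add_mem (euler_mem a) (Subalgebra.algebraMap_mem _ _)) (one_mem _), ?_,
        fun b l h => ((commute_euler_power h l).add_left (Algebra.commutes _ _)).add_left
          (Commute.one_left _)⟩
      have e : ((n + 1 : ℕ) : ℤ) - 1 = (n : ℤ) := by push_cast; ring
      rw [e, power_natCast, power_natCast, pow_succ', ← mul_assoc, d_mul_x_self, add_mul,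
        euler_mul_x_pow, mul_add, mul_add, mul_add, one_mul, mul_one]
  · refine ⟨1, one_mem _, ?_, fun _ _ _ => Commute.one_left _⟩
    have e : -(n : ℤ) - 1 = -((n + 1 : ℕ) : ℤ) := by push_cast; ring
    rw [mul_one, e, power_neg_natCast, power_neg_natCast, pow_succ']

/-- Here `ε` is `1` for a coordinate and `-1` for a derivative. The powers of the other variables
commute with `u` and with the correction `g`, so the one-variable rule extends to monomials. -/
theorem mul_listMonomial_of_power {u : Weyl ι} {a : ι} {ε : ℤ}
    (hu : ∀ b l, a ≠ b → Commute u (power b l))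
    (hp : ∀ k, ∃ g ∈ eulerAlgebra ι,
      u * power a k = power a (k + ε) * g ∧ ∀ b l, a ≠ b → Commute g (power b l))
    (l : List ι) (hl : l.Nodup) (m : ι → ℤ) (hm : a ∈ l) :
    ∃ g ∈ eulerAlgebra ι, u * listMonomial l m = listMonomial l (m + Pi.single a ε) * g := by
  induction l with
  | nil => simp at hm
  | cons b l ih =>
    rw [List.nodup_cons] at hl
    rw [listMonomial_cons, listMonomial_cons]
    rcases eq_or_ne a b with rfl | hab
    · obtain ⟨g, hg, h1, h2⟩ := hp (m a)
      refine ⟨g, hg, ?_⟩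
      have hne : ∀ c ∈ l, a ≠ c := fun c hc e => hl.1 (e ▸ hc)
      have h3 : Commute g (listMonomial l m) := commute_listMonomial fun c hc => h2 c _ (hne c hc)
      have h4 : listMonomial l (m + Pi.single a ε) = listMonomial l m :=
        listMonomial_congr fun c hc => by simp [Pi.single_eq_of_ne (hne c hc).symm]
      rw [h4, ← mul_assoc, h1, mul_assoc, h3.eq, mul_assoc]
      simp
    · obtain ⟨g, hg, h1⟩ := ih hl.2 ((List.mem_cons.1 hm).resolve_left hab)
      refine ⟨g, hg, ?_⟩
      rw [← mul_assoc, (hu b _ hab).eq, mul_assoc, h1, mul_assoc]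
      simp [Pi.single_eq_of_ne hab.symm]

/-! ### Products of opposite monomials -/

/-- The scalar by which `power a (-k) * power a k` acts on a vector on which `euler a` acts
by `t`. -/
def factor (t : ℂ) (k : ℤ) : ℂ :=
  (∏ i ∈ Finset.range k.toNat, (t + i + 1)) * ∏ i ∈ Finset.range (-k).toNat, (t - i)

/-- The graph of the character `euler a ↦ p a`. -/
abbrev eulerGraph (p : ι → ℂ) : Subalgebra ℂ (Weyl ι × ℂ) :=
  Algebra.adjoin ℂ (Set.range fun a => (euler a, p a))

theorem euler_mem_graph (p : ι → ℂ) (a : ι) : (euler a, p a) ∈ eulerGraph p :=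
  Algebra.subset_adjoin ⟨a, rfl⟩

/-- A pair in the graph records a polynomial in the Euler operators together with its value at `p`,
so a single induction yields both the polynomial form and the scalar. -/
theorem power_mul_power_mem (p : ι → ℂ) (a : ι) (k : ℤ) :
    (power a (-k) * power a k, factor (p a) k) ∈ eulerGraph p := by
  obtain ⟨n, rfl | rfl⟩ := k.eq_nat_or_neg
  · rw [power_natCast, power_neg_natCast]
    have e : factor (p a) n = ∏ i ∈ Finset.range n, (p a + i + 1) := by simp [factor]
    rw [e]
    induction n with
    | zero =>
      simp only [pow_zero, Finset.range_zero, Finset.prod_empty, mul_one]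
      exact one_mem (eulerGraph p)
    | succ n ih =>
      have h1 : (d a ^ (n + 1) * x a ^ (n + 1) : Weyl ι)
          = d a ^ n * x a ^ n * (euler a + algebraMap ℂ _ (n + 1)) := by
        rw [pow_succ (d a), pow_succ' (x a), mul_assoc, ← mul_assoc (d a) (x a), d_mul_x_self,
          add_mul, euler_mul_x_pow, one_mul, mul_assoc]
        simp only [map_add, map_one, mul_add, mul_one, add_assoc]
      rw [h1, Finset.prod_range_succ]
      have h2 : (euler a + algebraMap ℂ (Weyl ι) (n + 1), p a + n + 1) ∈ eulerGraph p := by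
        have := add_mem (euler_mem_graph p a)
          ((eulerGraph p).algebraMap_mem ((n : ℂ) + 1))
        rwa [show ((euler a : Weyl ι), p a) + algebraMap ℂ (Weyl ι × ℂ) ((n : ℂ) + 1)
          = (euler a + algebraMap ℂ (Weyl ι) (n + 1), p a + n + 1) from
            Prod.ext rfl (add_assoc _ _ _).symm] at this
      exact mul_mem (ih (by simp [factor])) h2
  · rw [neg_neg, power_natCast, power_neg_natCast]
    have e : factor (p a) (-n) = ∏ i ∈ Finset.range n, (p a - i) := by simp [factor]
    rw [e]
    induction n with
    | zero =>
      simp only [pow_zero, Finset.range_zero, Finset.prod_empty, mul_one]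
      exact one_mem (eulerGraph p)
    | succ n ih =>
      have h1 : (x a ^ (n + 1) * d a ^ (n + 1) : Weyl ι)
          = x a ^ n * d a ^ n * (euler a - algebraMap ℂ _ n) := by
        rw [pow_succ (x a), pow_succ' (d a), mul_assoc, ← mul_assoc (x a) (d a), ← euler,
          euler_mul_d_pow, mul_assoc]
      rw [h1, Finset.prod_range_succ]
      have h2 : (euler a - algebraMap ℂ (Weyl ι) n, p a - n) ∈ eulerGraph p :=
        sub_mem (euler_mem_graph p a) ((eulerGraph p).algebraMap_mem (n : ℂ))
      exact mul_mem (ih (by simp [factor])) h2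

theorem listMonomial_mul_mem (p : ι → ℂ) (m : ι → ℤ) (l : List ι) (hl : l.Nodup) :
    (listMonomial l (-m) * listMonomial l m, (l.map fun a => factor (p a) (m a)).prod)
      ∈ eulerGraph p := by
  induction l with
  | nil =>
    simp only [listMonomial, List.map_nil, List.prod_nil, mul_one]
    exact one_mem (eulerGraph p)
  | cons a l ih =>
    rw [List.nodup_cons] at hl
    have hc : Commute (power a (m a)) (listMonomial l (-m)) := commute_listMonomial fun c hc =>
      commute_power (fun e : a = c => hl.1 (e ▸ hc)) _ _
    have h1 : listMonomial (a :: l) (-m) * listMonomial (a :: l) m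
        = power a (-(m a)) * power a (m a) * (listMonomial l (-m) * listMonomial l m) := by
      rw [listMonomial_cons, listMonomial_cons, mul_assoc, ← mul_assoc (listMonomial l (-m)),
        ← hc.eq, Pi.neg_apply, mul_assoc, mul_assoc]
    rw [h1, List.map_cons, List.prod_cons]
    exact mul_mem (power_mul_power_mem p a (m a)) (ih hl.2)

/-! ### Monomials in all the variables -/

variable [Fintype ι]

/-- The monomial with exponents `m`. -/
noncomputable def monomial (m : ι → ℤ) : Weyl ι := listMonomial Finset.univ.toList m

theorem euler_mul_monomial (a : ι) (m : ι → ℤ) :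
    euler a * monomial m = monomial m * (euler a + algebraMap ℂ _ (m a)) :=
  euler_mul_listMonomial a _ (Finset.nodup_toList _) m (by simp)

theorem monomial_mul_mem (p : ι → ℂ) (m : ι → ℤ) :
    (monomial (-m) * monomial m, ∏ a, factor (p a) (m a)) ∈ eulerGraph p := by
  have := listMonomial_mul_mem p m _ (Finset.nodup_toList Finset.univ)
  rwa [Finset.prod_map_toList] at this

/-- The multiples of the monomial `m` by polynomials in the Euler operators. -/
noncomputable def monomialPart (m : ι → ℤ) : Submodule ℂ (Weyl ι) :=
  (Subalgebra.toSubmodule (eulerAlgebra ι)).map (LinearMap.mulLeft ℂ (monomial m))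

theorem mul_mem_iSup_monomialPart {u : Weyl ι} {a : ι} {ε : ℤ}
    (hu : ∀ b l, a ≠ b → Commute u (power b l))
    (hp : ∀ k, ∃ g ∈ eulerAlgebra ι,
      u * power a k = power a (k + ε) * g ∧ ∀ b l, a ≠ b → Commute g (power b l))
    {v : Weyl ι} (hv : v ∈ ⨆ m, monomialPart (ι := ι) m) : u * v ∈ ⨆ m, monomialPart (ι := ι) m := by
  induction hv using Submodule.iSup_induction' with
  | zero => rw [mul_zero]; exact zero_mem _
  | add v w _ _ hv hw => rw [mul_add]; exact add_mem hv hw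
  | mem m v hv =>
    obtain ⟨c, hc, rfl⟩ := hv
    obtain ⟨g, hg, h1⟩ := mul_listMonomial_of_power hu hp Finset.univ.toList
      (Finset.nodup_toList _) m (by simp)
    refine Submodule.mem_iSup_of_mem (m + Pi.single a ε) ⟨g * c, (eulerAlgebra ι).mul_mem hg hc, ?_⟩
    rw [LinearMap.mulLeft_apply, LinearMap.mulLeft_apply, ← mul_assoc, ← mul_assoc]
    exact congrArg (· * c) h1.symm

/-- The sum of the parts contains `1` and is stable under left multiplication by the generators,
hence by the whole algebra. -/
theorem iSup_monomialPart : ⨆ m, monomialPart (ι := ι) m = ⊤ := by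
  rw [eq_top_iff]
  rintro u -
  let S : Subalgebra ℂ (Weyl ι) :=
    { carrier := {u | ∀ v ∈ ⨆ m, monomialPart (ι := ι) m, u * v ∈ ⨆ m, monomialPart (ι := ι) m}
      mul_mem' := fun hu hv w hw => by rw [mul_assoc]; exact hu _ (hv _ hw)
      add_mem' := fun hu hv w hw => by rw [add_mul]; exact add_mem (hu _ hw) (hv _ hw)
      algebraMap_mem' := fun r w hw => by
        rw [← Algebra.smul_def]; exact Submodule.smul_mem _ r hw }
  have h1 : u ∈ S := mem_of_generators S
    (fun a v hv => mul_mem_iSup_monomialPart (fun b l h => commute_x_power h l)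
      (x_mul_power a) hv)
    (fun a v hv => mul_mem_iSup_monomialPart (ε := -1) (fun b l h => commute_d_power h l)
      (d_mul_power a) hv) u
  have h2 := h1 1 (Submodule.mem_iSup_of_mem 0 ⟨1, (eulerAlgebra ι).one_mem, by
    simp [monomial, listMonomial, power_zero]⟩)
  rwa [mul_one] at h2

theorem scale_monomial (c : ι → ℂˣ) (m : ι → ℤ) :
    scale c (monomial m) = ((∏ a, c a ^ m a : ℂˣ) : ℂ) • monomial m := by
  have h1 : ∀ (a : ι) (k : ℤ), scale c (power a k) = ((c a ^ k : ℂˣ) : ℂ) • power a k := by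
    intro a k
    obtain ⟨n, rfl | rfl⟩ := k.eq_nat_or_neg
    · rw [power_natCast, map_pow, scale_x, smul_pow]; simp
    · rw [power_neg_natCast, map_pow, scale_d, smul_pow]; simp
  have h2 : ∀ l : List ι, scale c (listMonomial l m)
      = (((l.map fun a => c a ^ m a).prod : ℂˣ) : ℂ) • listMonomial l m := by
    intro l
    induction l with
    | nil => simp [listMonomial]
    | cons a l ih =>
      rw [listMonomial_cons, map_mul, h1, ih, smul_mul_smul_comm, List.map_cons, List.prod_cons,
        Units.val_mul]
  rw [monomial, h2, Finset.prod_map_toList]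

end

end Weyl

/-! ## Weights of modules over the slice algebra -/

section SliceWeights
variable {n ℓ w : ℕ}

/-- The weight of the `i`-th factor of the torus on a coordinate line: `1` on the arrows into `i`,
`-1` on the arrows out of `i`. -/
def vertexWeight (i : Fin n) : SliceArrow n ℓ w → ℤ
  | Sum.inl (p, _) => (if p.1.2 = i then 1 else 0) - (if p.1.1 = i then 1 else 0)
  | Sum.inr (j, _) => -(if j = i then 1 else 0)

theorem sliceChar_eq_prod (h : Fin n → ℂˣ) (a : SliceArrow n ℓ w) :
    sliceChar h a = ∏ i, h i ^ vertexWeight i a := by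
  rcases a with ⟨p, k⟩ | ⟨j, m⟩
  · simp only [sliceChar, vertexWeight, zpow_sub, Finset.prod_mul_distrib, Finset.prod_inv_distrib]
    congr 1
    · rw [Finset.prod_eq_single p.1.2] <;> simp +contextual [eq_comm]
    · rw [Finset.prod_eq_single p.1.1] <;> simp +contextual [eq_comm]
  · simp only [sliceChar, vertexWeight, zpow_neg, Finset.prod_inv_distrib]
    rw [Finset.prod_eq_single j] <;> simp +contextual [eq_comm]

theorem sliceLieChar_single (i : Fin n) (a : SliceArrow n ℓ w) :
    sliceLieChar (Pi.single i 1) a = (vertexWeight i a : ℂ) := by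
  rcases a with ⟨p, k⟩ | ⟨j, m⟩ <;> simp [sliceLieChar, vertexWeight, Pi.single_apply]

/-- The exponents of the torus invariant monomials. -/
def IsBalanced (m : SliceArrow n ℓ w → ℤ) : Prop := ∀ i, ∑ a, vertexWeight i a * m a = 0

theorem IsBalanced.neg {m : SliceArrow n ℓ w → ℤ} (hm : IsBalanced m) : IsBalanced (-m) := fun i => by
  simp [mul_neg, hm i]

theorem IsBalanced.nsmul {m : SliceArrow n ℓ w → ℤ} (hm : IsBalanced m) (N : ℕ) :
    IsBalanced (N • m) := fun i => by
  have h : ∀ a, vertexWeight i a * (N • m) a = N * (vertexWeight i a * m a) := fun a => by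
    rw [Pi.smul_apply, nsmul_eq_mul, mul_left_comm]
  rw [Finset.sum_congr rfl fun a _ => h a, ← Finset.mul_sum, hm i, mul_zero]

/-- The torus scales the monomial by the product over `i` of `h i` to the power `∑ a, vertexWeight i
a * m a`, and these exponents vanish. -/
theorem IsBalanced.monomial_mem {m : SliceArrow n ℓ w → ℤ} (hm : IsBalanced m) :
    Weyl.monomial m ∈ sliceInvariants n ℓ w := by
  intro h
  rw [sliceTorus, Weyl.scale_monomial]
  have e : ∏ a, sliceChar h a ^ m a = 1 := by
    have h1 : ∀ a, sliceChar h a ^ m a = ∏ i, h i ^ (vertexWeight i a * m a) := by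
      intro a
      rw [sliceChar_eq_prod, ← Finset.prod_zpow]
      exact Finset.prod_congr rfl fun i _ => (zpow_mul _ _ _).symm
    rw [Finset.prod_congr rfl fun a _ => h1 a, Finset.prod_comm]
    refine Finset.prod_eq_one fun i _ => ?_
    have h2 : ∀ s : Finset (SliceArrow n ℓ w), ∏ a ∈ s, h i ^ (vertexWeight i a * m a)
        = h i ^ ∑ a ∈ s, vertexWeight i a * m a := by
      intro s
      induction s using Finset.induction_on with
      | empty => simp
      | insert a s ha ih => rw [Finset.prod_insert ha, Finset.sum_insert ha, zpow_add, ih]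
    rw [h2, hm i, zpow_zero]
  rw [e, Units.val_one, one_smul]

theorem euler_mem_sliceInvariants (a : SliceArrow n ℓ w) :
    Weyl.euler a ∈ sliceInvariants n ℓ w := by
  intro h
  rw [Weyl.euler, map_mul, sliceTorus, Weyl.scale_x, Weyl.scale_d, smul_mul_smul_comm,
    Units.mul_inv, one_smul]

/-- The Euler operators as invariant differential operators. -/
def sliceEuler (a : SliceArrow n ℓ w) : sliceInvariants n ℓ w :=
  ⟨Weyl.euler a, euler_mem_sliceInvariants a⟩

theorem mem_adjoin_sliceEuler {u : sliceInvariants n ℓ w}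
    (hu : u.1 ∈ Weyl.eulerAlgebra (SliceArrow n ℓ w)) :
    u ∈ Algebra.adjoin ℂ (Set.range (sliceEuler (n := n) (ℓ := ℓ) (w := w))) := by
  have h1 : Weyl.eulerAlgebra (SliceArrow n ℓ w) = (Algebra.adjoin ℂ
      (Set.range (sliceEuler (n := n) (ℓ := ℓ) (w := w)))).map (sliceInvariants n ℓ w).val := by
    rw [AlgHom.map_adjoin, ← Set.range_comp]
    rfl
  rw [h1] at hu
  obtain ⟨v, hv, e⟩ := hu
  rwa [← Subtype.ext e]

/-- A monomial times a polynomial in the Euler operators is a weight vector, with the exponents as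
its weight. The invariants are stable under commutators with the Euler operators, so each component
of an invariant operator is again invariant; the component of exponent zero is a polynomial in the
Euler operators. -/
theorem isWeightAlgebra_sliceEuler :
    IsWeightAlgebra (sliceEuler (n := n) (ℓ := ℓ) (w := w)) where
  commute a b := Subtype.ext (Weyl.commute_euler a b)
  iSup_eq_top := by
    rw [eq_top_iff]
    rintro u -
    have hu : u.1 ∈ ⨆ m, Weyl.monomialPart (ι := SliceArrow n ℓ w) m :=
      Weyl.iSup_monomialPart (ι := SliceArrow n ℓ w) ▸ Submodule.mem_top
    obtain ⟨F, hF, hsum⟩ := (Submodule.mem_iSup_iff_exists_finsupp _ _).1 hu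
    have hcomm : ∀ m a, Weyl.euler a * F m - F m * Weyl.euler a = (m a : ℂ) • F m := by
      intro m a
      obtain ⟨c, hc, e⟩ := hF m
      have h1 : Commute (Weyl.euler a) c := by
        refine Algebra.commute_of_mem_adjoin_of_forall_mem_commute hc ?_
        rintro _ ⟨b, rfl⟩
        exact Weyl.commute_euler a b
      rw [← e, LinearMap.mulLeft_apply, ← mul_assoc, Weyl.euler_mul_monomial, mul_assoc, mul_assoc,
        add_mul, h1.eq, mul_add, add_sub_cancel_left, ← Algebra.smul_def, mul_smul_comm]
    have hmem : ∀ m ∈ F.support, F m ∈ sliceInvariants n ℓ w := by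
      intro m hm
      refine Submodule.mem_of_sum_weight_mem
        (fun a => LinearMap.mulLeft ℂ (Weyl.euler a) - LinearMap.mulRight ℂ (Weyl.euler a))
        (Subalgebra.toSubmodule (sliceInvariants n ℓ w)) ?_ (fun m a => (m a : ℂ)) ?_ F.support F
        (fun m _ a => by simpa using hcomm m a) ?_ hm
      · intro a v hv
        exact (sliceInvariants n ℓ w).sub_mem
          ((sliceInvariants n ℓ w).mul_mem (euler_mem_sliceInvariants a) hv)
          ((sliceInvariants n ℓ w).mul_mem hv (euler_mem_sliceInvariants a))
      · intro m m' e
        exact funext fun a => Int.cast_injective (congrFun e a)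
      · exact (show ∑ m ∈ F.support, F m = u.1 from hsum) ▸ u.2
    have hu' : u = ∑ m ∈ F.support.attach, ⟨F m, hmem m m.2⟩ := by
      refine Subtype.ext ?_
      rw [AddSubmonoidClass.coe_finsetSum]
      exact hsum.symm.trans (Finset.sum_attach _ _).symm
    rw [hu']
    refine Submodule.sum_mem _ fun m _ => Submodule.mem_iSup_of_mem (fun a => (m.1 a : ℂ)) ⟨?_, ?_⟩
    · exact fun a => Subtype.ext (hcomm m.1 a)
    · intro e
      have e' : m.1 = 0 := funext fun a => Int.cast_injective ((congrFun e a).trans Int.cast_zero.symm)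
      refine mem_adjoin_sliceEuler ?_
      obtain ⟨c, hc, e1⟩ := hF m.1
      change F m.1 ∈ _
      rw [← e1, e']
      simpa [Weyl.monomial, Weyl.listMonomial, Weyl.power_zero] using hc

/-- The Euler operators in the slice algebra. -/
noncomputable def sliceTheta (lam : ℂ) (a : SliceArrow n ℓ w) : SliceAlgebra n ℓ w lam :=
  Ideal.Quotient.mkₐ ℂ (sliceIdeal n ℓ w lam) (sliceEuler a)

theorem isWeightAlgebra_sliceTheta (lam : ℂ) :
    IsWeightAlgebra (sliceTheta (n := n) (ℓ := ℓ) (w := w) lam) :=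
  isWeightAlgebra_sliceEuler.map _ Ideal.Quotient.mk_surjective

/-- `t` is a negative integer. -/
def IsNegInt (t : ℂ) : Prop := ∃ k : ℕ, t = -(k + 1)

/-- `t` is a nonnegative integer. -/
def IsNonnegInt (t : ℂ) : Prop := ∃ k : ℕ, t = k

/-- No exponents of invariant monomials point in a direction in which all the monomials act without
kernel on vectors of weight `p`. -/
def IsBoundedWeight (p : SliceArrow n ℓ w → ℂ) : Prop :=
  ∀ m : SliceArrow n ℓ w → ℤ, IsBalanced m →
    (∀ a, (0 < m a → ¬ IsNegInt (p a)) ∧ (m a < 0 → ¬ IsNonnegInt (p a))) → m = 0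

/-- The moment map equations for a weight. -/
def IsConserved (lam : ℂ) (p : SliceArrow n ℓ w → ℂ) : Prop :=
  ∀ i, ∑ a, (vertexWeight i a : ℂ) * p a = lam

/-- The factor vanishes only when the shift by `k` crosses from the negative integers to the
nonnegative ones or back. -/
theorem factor_ne_zero {t : ℂ} {k : ℤ} (h1 : 0 < k → ¬ IsNegInt t)
    (h2 : k < 0 → ¬ IsNonnegInt t) : Weyl.factor t k ≠ 0 := by
  refine mul_ne_zero (Finset.prod_ne_zero_iff.2 fun i hi e => ?_)
    (Finset.prod_ne_zero_iff.2 fun i hi e => ?_)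
  · rw [Finset.mem_range] at hi
    exact h1 (by omega) ⟨i, by linear_combination e⟩
  · rw [Finset.mem_range] at hi
    exact h2 (by omega) ⟨i, by linear_combination e⟩

/-! ### Shifting weights by invariant monomials -/

section Rep
variable {M : Type} [AddCommGroup M] [Module ℂ M]

/-- The condition on products admits homomorphisms and antihomomorphisms, so left and right modules
are treated together; the order is immaterial because everything acts on `v` by scalars. -/
theorem apply_of_mem_eulerGraph (f : sliceInvariants n ℓ w →ₗ[ℂ] Module.End ℂ M) (h1 : f 1 = 1)
    (hmul : ∀ u v, f (u * v) = f u * f v ∨ f (u * v) = f v * f u)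
    {p : SliceArrow n ℓ w → ℂ} {v : M} (hv : ∀ a, f (sliceEuler a) v = p a • v)
    {x : SliceWeyl n ℓ w × ℂ} (hx : x ∈ Weyl.eulerGraph p) :
    ∃ hu : x.1 ∈ sliceInvariants n ℓ w, f ⟨x.1, hu⟩ v = x.2 • v := by
  induction hx using Algebra.adjoin_induction with
  | mem x hx => obtain ⟨a, rfl⟩ := hx; exact ⟨euler_mem_sliceInvariants a, hv a⟩
  | algebraMap r =>
    refine ⟨(sliceInvariants n ℓ w).algebraMap_mem r, ?_⟩
    have e : (⟨algebraMap ℂ _ r, (sliceInvariants n ℓ w).algebraMap_mem r⟩ :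
        sliceInvariants n ℓ w) = r • 1 := by
      rw [Algebra.smul_def, mul_one]; rfl
    refine (congrArg (f · v) e).trans ?_
    rw [map_smul, h1]; rfl
  | add x y _ _ hx hy =>
    obtain ⟨hx, hx'⟩ := hx
    obtain ⟨hy, hy'⟩ := hy
    refine ⟨add_mem hx hy, ?_⟩
    rw [Prod.snd_add, add_smul, ← hx', ← hy', ← LinearMap.add_apply, ← map_add]
    rfl
  | mul x y _ _ hx hy =>
    obtain ⟨hx, hx'⟩ := hx
    obtain ⟨hy, hy'⟩ := hy
    refine ⟨mul_mem hx hy, ?_⟩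
    rw [Prod.snd_mul]
    change f (⟨x.1, hx⟩ * ⟨y.1, hy⟩) v = _
    rcases hmul ⟨x.1, hx⟩ ⟨y.1, hy⟩ with h | h
    · rw [h, Module.End.mul_apply, hy', map_smul, hx', smul_smul, mul_comm]
    · rw [h, Module.End.mul_apply, hx', map_smul, hy', smul_smul]

/-- The opposite monomial brings the shifted vector back to `v` times the product of the factors, so
the shifted vector is nonzero. -/
theorem exists_weight_vector_left (ρ : sliceInvariants n ℓ w →ₐ[ℂ] Module.End ℂ M)
    {p : SliceArrow n ℓ w → ℂ} {v : M} (hv0 : v ≠ 0)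
    (hv : ∀ a, ρ (sliceEuler a) v = p a • v) {m : SliceArrow n ℓ w → ℤ} (hm : IsBalanced m)
    (hfac : ∀ a, Weyl.factor (p a) (m a) ≠ 0) :
    ρ ⟨_, hm.monomial_mem⟩ v ≠ 0 ∧
      ∀ a, ρ (sliceEuler a) (ρ ⟨_, hm.monomial_mem⟩ v) = (p a + m a) • ρ ⟨_, hm.monomial_mem⟩ v := by
  refine ⟨fun e => ?_, fun a => ?_⟩
  · obtain ⟨hu, h1⟩ := apply_of_mem_eulerGraph ρ.toLinearMap (map_one ρ)
      (fun u v => Or.inl (map_mul ρ u v)) hv (Weyl.monomial_mul_mem p m)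
    have h2 : ρ (⟨_, hm.neg.monomial_mem⟩ * ⟨_, hm.monomial_mem⟩) v
        = (∏ a, Weyl.factor (p a) (m a)) • v := h1
    rw [map_mul, Module.End.mul_apply, e, map_zero] at h2
    exact smul_ne_zero (Finset.prod_ne_zero_iff.2 fun a _ => hfac a) hv0 h2.symm
  · have h1 : sliceEuler a * ⟨_, hm.monomial_mem⟩
        = ⟨_, hm.monomial_mem⟩ * (sliceEuler a + algebraMap ℂ _ (m a : ℂ)) :=
      Subtype.ext (Weyl.euler_mul_monomial a m)
    rw [← Module.End.mul_apply, ← map_mul, h1, map_mul, Module.End.mul_apply, map_add,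
      AlgHom.commutes, LinearMap.add_apply, hv, Module.algebraMap_end_apply, ← add_smul, map_smul]

/-- On a right module it is the monomial with exponents `-m` that shifts the weight by `m`. -/
theorem exists_weight_vector_right (ρ : (sliceInvariants n ℓ w)ᵐᵒᵖ →ₐ[ℂ] Module.End ℂ M)
    {p : SliceArrow n ℓ w → ℂ} {v : M} (hv0 : v ≠ 0)
    (hv : ∀ a, ρ (MulOpposite.op (sliceEuler a)) v = p a • v) {m : SliceArrow n ℓ w → ℤ}
    (hm : IsBalanced m) (hfac : ∀ a, Weyl.factor (p a) (m a) ≠ 0) :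
    ∃ y, y ≠ 0 ∧ ∀ a, ρ (MulOpposite.op (sliceEuler a)) y = (p a + m a) • y := by
  refine ⟨ρ (MulOpposite.op ⟨_, hm.neg.monomial_mem⟩) v, fun e => ?_, fun a => ?_⟩
  · obtain ⟨hu, h1⟩ := apply_of_mem_eulerGraph
      (ρ.toLinearMap ∘ₗ (MulOpposite.opLinearEquiv ℂ).toLinearMap) (map_one ρ)
      (fun u v => Or.inr (map_mul ρ (MulOpposite.op v) (MulOpposite.op u))) hv
      (Weyl.monomial_mul_mem p m)
    have h2 : ρ (MulOpposite.op ⟨_, hm.monomial_mem⟩ * MulOpposite.op ⟨_, hm.neg.monomial_mem⟩) v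
        = (∏ a, Weyl.factor (p a) (m a)) • v := h1
    rw [map_mul, Module.End.mul_apply, e, map_zero] at h2
    exact smul_ne_zero (Finset.prod_ne_zero_iff.2 fun a _ => hfac a) hv0 h2.symm
  · have h1 : (⟨_, hm.neg.monomial_mem⟩ : sliceInvariants n ℓ w) * sliceEuler a
        = (sliceEuler a + algebraMap ℂ _ (m a : ℂ)) * ⟨_, hm.neg.monomial_mem⟩ := by
      refine Subtype.ext ?_
      have := Weyl.euler_mul_monomial a (-m)
      change Weyl.monomial (-m) * Weyl.euler a
        = (Weyl.euler a + algebraMap ℂ _ (m a : ℂ)) * Weyl.monomial (-m)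
      rw [add_mul, this, Algebra.commutes, ← mul_add, Pi.neg_apply, Int.cast_neg, map_neg,
        neg_add_cancel_right]
    rw [← Module.End.mul_apply, ← map_mul, ← MulOpposite.op_mul, h1, MulOpposite.op_mul, map_mul,
      Module.End.mul_apply, MulOpposite.op_add, map_add, LinearMap.add_apply, hv,
      ← MulOpposite.algebraMap_apply, AlgHom.commutes, Module.algebraMap_end_apply, ← add_smul,
      map_smul]

/-- A nonzero admissible `m` could be repeated: all the `p + N • m` would occur, giving one operator
infinitely many eigenvalues on a finite-dimensional space. -/
theorem isBoundedWeight_of_shift [FiniteDimensional ℂ M]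
    (T : SliceArrow n ℓ w → Module.End ℂ M) {p : SliceArrow n ℓ w → ℂ}
    (h : ∀ m, IsBalanced m → (∀ a, Weyl.factor (p a) (m a) ≠ 0) →
      ∃ y, y ≠ 0 ∧ ∀ a, T a y = (p a + m a) • y) : IsBoundedWeight p := by
  intro m hm hp
  by_contra hne
  obtain ⟨a, ha⟩ := Function.ne_iff.1 hne
  rw [Pi.zero_apply] at ha
  have key : ∀ N : ℕ, (T a).HasEigenvalue (p a + N * m a) := by
    intro N
    obtain ⟨y, hy0, hy⟩ := h (N • m) (hm.nsmul N) fun b => factor_ne_zero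
      (fun hN => (hp b).1 (by
        by_contra! hc
        have : (N • m) b ≤ 0 := by
          rw [Pi.smul_apply]; exact smul_nonpos_of_nonneg_of_nonpos N.zero_le hc
        omega))
      (fun hN => (hp b).2 (by
        by_contra! hc
        have : 0 ≤ (N • m) b := by
          rw [Pi.smul_apply]; exact smul_nonneg N.zero_le hc
        omega))
    refine Module.End.hasEigenvalue_of_hasEigenvector
      ⟨Module.End.mem_eigenspace_iff.2 (?_ : T a y = _), hy0⟩
    rw [hy]
    simp
  have hinj : Function.Injective fun N : ℕ => p a + N * m a := by
    intro N N' e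
    have := mul_right_cancel₀ (Int.cast_ne_zero.2 ha) (add_left_cancel e)
    exact_mod_cast this
  exact Set.infinite_range_of_injective hinj ((Module.End.finite_hasEigenvalue (T a)).subset
    (by rintro _ ⟨N, rfl⟩; exact key N))

/-- The moment element at the `i`-th basis vector is `∑ a, vertexWeight i a • sliceEuler a - lam •
1`, which acts on a weight vector by a scalar. -/
theorem isConserved_of_moment (f : sliceInvariants n ℓ w →ₗ[ℂ] Module.End ℂ M) (h1 : f 1 = 1)
    {lam : ℂ} (hf : ∀ η, f (sliceMoment n ℓ w lam η) = 0) {p : SliceArrow n ℓ w → ℂ} {v : M}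
    (hv0 : v ≠ 0) (hv : ∀ a, f (sliceEuler a) v = p a • v) : IsConserved lam p := by
  intro i
  have e : sliceMoment n ℓ w lam (Pi.single i 1)
      = ∑ a, (vertexWeight i a : ℂ) • sliceEuler a - lam • 1 := by
    rw [sliceMoment]
    congr 1
    · refine Subtype.ext ?_
      rw [AddSubmonoidClass.coe_finsetSum]
      exact Finset.sum_congr rfl fun a _ => by rw [sliceLieChar_single]; rfl
    · rw [← Algebra.algebraMap_eq_smul_one]
      congr 1
      simp [Pi.single_apply]
  have h2 := LinearMap.congr_fun (hf (Pi.single i 1)) v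
  rw [e, map_sub, map_sum, map_smul, h1, LinearMap.sub_apply, LinearMap.sum_apply,
    LinearMap.zero_apply, sub_eq_zero] at h2
  simp only [map_smul, LinearMap.smul_apply, hv, smul_smul, Module.End.one_apply] at h2
  rw [← Finset.sum_smul] at h2
  exact smul_left_injective ℂ hv0 h2

end Rep

theorem sliceMoment_mk (lam : ℂ) (η : Fin n → ℂ) :
    Ideal.Quotient.mkₐ ℂ (sliceIdeal n ℓ w lam) (sliceMoment n ℓ w lam η) = 0 :=
  Ideal.Quotient.eq_zero_iff_mem.2 (Ideal.subset_span ⟨η, rfl⟩)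

section Modules
variable {lam : ℂ} {M : Type} [AddCommGroup M] [Module ℂ M] [FiniteDimensional ℂ M]

theorem isBoundedWeight_of_isWeightOf [Module (SliceAlgebra n ℓ w lam) M]
    [IsScalarTower ℂ (SliceAlgebra n ℓ w lam) M] {p : SliceArrow n ℓ w → ℂ}
    (hp : IsWeightOf (sliceTheta lam) M p) : IsBoundedWeight p ∧ IsConserved lam p := by
  obtain ⟨v, hv0, hv⟩ := hp
  let ρ := (Algebra.lsmul ℂ ℂ M).comp (Ideal.Quotient.mkₐ ℂ (sliceIdeal n ℓ w lam))
  refine ⟨isBoundedWeight_of_shift (fun a => ρ (sliceEuler a)) fun m hm hfac =>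
    ⟨_, exists_weight_vector_left ρ hv0 hv hm hfac⟩,
    isConserved_of_moment ρ.toLinearMap (map_one ρ) (fun η => ?_) hv0 hv⟩
  change Algebra.lsmul ℂ ℂ M (Ideal.Quotient.mkₐ ℂ (sliceIdeal n ℓ w lam) _) = 0
  rw [sliceMoment_mk, map_zero]

theorem isBoundedWeight_of_isWeightOf_op [Module (SliceAlgebra n ℓ w lam)ᵐᵒᵖ M]
    [IsScalarTower ℂ (SliceAlgebra n ℓ w lam)ᵐᵒᵖ M] {p : SliceArrow n ℓ w → ℂ}
    (hp : IsWeightOf (fun a => MulOpposite.op (sliceTheta lam a)) M p) :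
    IsBoundedWeight p ∧ IsConserved lam p := by
  obtain ⟨v, hv0, hv⟩ := hp
  let ρ := (Algebra.lsmul ℂ ℂ M).comp
    (AlgHom.op (Ideal.Quotient.mkₐ ℂ (sliceIdeal n ℓ w lam)))
  refine ⟨isBoundedWeight_of_shift (fun a => ρ (MulOpposite.op (sliceEuler a))) fun m hm hfac =>
    exists_weight_vector_right ρ hv0 hv hm hfac,
    isConserved_of_moment (ρ.toLinearMap ∘ₗ (MulOpposite.opLinearEquiv ℂ).toLinearMap) (map_one ρ)
      (fun η => ?_) hv0 hv⟩
  change Algebra.lsmul ℂ ℂ M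
    (MulOpposite.op (Ideal.Quotient.mkₐ ℂ (sliceIdeal n ℓ w lam) (sliceMoment n ℓ w lam η))) = 0
  rw [sliceMoment_mk, MulOpposite.op_zero, map_zero]

end Modules

end SliceWeights

/-! ## Sign patterns of bounded weights -/

section Signs
variable {n ℓ w : ℕ}

/-- The `k`-th arrow `i → j`. -/
abbrev edge {i j : Fin n} (h : i ≠ j) (k : Fin (ℓ - 1)) : SliceArrow n ℓ w := Sum.inl (⟨(i, j), h⟩, k)

/-- The `m`-th framing coordinate at `i`. -/
abbrev framing (i : Fin n) (m : Fin w) : SliceArrow n ℓ w := Sum.inr (i, m)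

section Counting
variable {R : Type*} [Ring R]

theorem sum_offDiag (f : Fin n → Fin n → R) :
    ∑ p : {p : Fin n × Fin n // p.1 ≠ p.2}, f p.1.1 p.1.2
      = ∑ i, ∑ j, if i ≠ j then f i j else 0 := by
  rw [← Fintype.sum_prod_type' (f := fun i j => if i ≠ j then f i j else 0),
    ← Finset.sum_filter]
  exact (Finset.sum_subtype _ (by simp) fun p : Fin n × Fin n => f p.1 p.2).symm

theorem sum_ite_ne (i : Fin n) : ∑ j : Fin n, (if j ≠ i then (1 : R) else 0) = n - 1 := by
  have h : ∀ j : Fin n, (if j ≠ i then (1 : R) else 0) = 1 - if j = i then 1 else 0 := by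
    intro j; split_ifs <;> simp_all
  rw [Finset.sum_congr rfl fun j _ => h j]
  simp

/-- There are `n - 1` sources for the arrows into `i`, with `ℓ - 1` arrows from each. The count is
needed both over `ℤ` and over `ℝ`. -/
theorem sum_target (hℓ : 1 ≤ ℓ) (i : Fin n) :
    ∑ p : {p : Fin n × Fin n // p.1 ≠ p.2} × Fin (ℓ - 1), (if p.1.1.2 = i then (1 : R) else 0)
      = (n - 1) * (ℓ - 1) := by
  rw [Fintype.sum_prod_type]
  change ∑ p : {p : Fin n × Fin n // p.1 ≠ p.2}, ∑ _ : Fin (ℓ - 1),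
    (if p.1.2 = i then (1 : R) else 0) = _
  simp only [Finset.sum_const, Finset.card_univ, Fintype.card_fin]
  rw [← Finset.smul_sum, sum_offDiag (fun _ j => if j = i then (1 : R) else 0)]
  have h : ∀ j : Fin n, (∑ l, if j ≠ l then (if l = i then (1 : R) else 0) else 0)
      = if j ≠ i then 1 else 0 := by
    intro j
    rw [Finset.sum_eq_single i] <;> simp +contextual
  rw [Finset.sum_congr rfl fun j _ => h j, sum_ite_ne, nsmul_eq_mul,
    (Nat.cast_commute (ℓ - 1) ((n : R) - 1)).eq, Nat.cast_sub hℓ, Nat.cast_one]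

end Counting

/-! ### Cycles -/

/-- A monomial with exponent `ε` in the variable `a` acts without kernel in weight `t`. -/
def IsFree (t : ℂ) (ε : ℤ) : Prop := (0 < ε → ¬ IsNegInt t) ∧ (ε < 0 → ¬ IsNonnegInt t)

theorem isFree_zero (t : ℂ) : IsFree t 0 := ⟨fun h => (lt_irrefl _ h).elim, fun h => (lt_irrefl _ h).elim⟩

theorem isFree_one {t : ℂ} : IsFree t 1 ↔ ¬ IsNegInt t := by simp [IsFree]

theorem isFree_neg_one {t : ℂ} : IsFree t (-1) ↔ ¬ IsNonnegInt t := by simp [IsFree]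

theorem IsNonnegInt.not_isNegInt {t : ℂ} (h : IsNonnegInt t) : ¬ IsNegInt t := by
  rintro ⟨k, rfl⟩
  obtain ⟨l, hl⟩ := h
  have : ((-(k + 1) : ℤ) : ℂ) = ((l : ℤ) : ℂ) := by push_cast; exact hl
  have := Int.cast_injective this
  omega

theorem sum_mul_single (i : Fin n) (a : SliceArrow n ℓ w) (ε : ℤ) :
    ∑ x, vertexWeight i x * (Pi.single a ε : SliceArrow n ℓ w → ℤ) x = vertexWeight i a * ε := by
  rw [Finset.sum_eq_single a, Pi.single_eq_same]
  · intro b _ hb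
    rw [Pi.single_eq_of_ne hb, mul_zero]
  · simp

section Cycles
variable {p : SliceArrow n ℓ w → ℂ} (hp : IsBoundedWeight p)
include hp

/-- Boundedness enters through short cycles in the quiver with one extra framing vertex; an exponent
`1` or `-1` is the direction in which an arrow is traversed. -/
theorem IsBoundedWeight.three_cycle {a b c : SliceArrow n ℓ w} {ε δ γ : ℤ} (hab : a ≠ b)
    (hac : a ≠ c) (hbc : b ≠ c) (hε : ε ≠ 0) (ha : IsFree (p a) ε) (hb : IsFree (p b) δ)
    (hc : IsFree (p c) γ)
    (hbal : ∀ i, vertexWeight i a * ε + vertexWeight i b * δ + vertexWeight i c * γ = 0) :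
    False := by
  have h := hp (Pi.single a ε + Pi.single b δ + Pi.single c γ) (fun i => ?_) (fun x => ?_)
  · have h1 := congrFun h a
    simp [Pi.single_eq_of_ne hab, Pi.single_eq_of_ne hac, hε] at h1
  · simp only [Pi.add_apply, mul_add, Finset.sum_add_distrib, sum_mul_single]
    exact hbal i
  · change IsFree (p x) _
    rcases eq_or_ne x a with rfl | hxa
    · simpa [Pi.single_eq_of_ne hab, Pi.single_eq_of_ne hac] using ha
    rcases eq_or_ne x b with rfl | hxb
    · simpa [Pi.single_eq_of_ne hab.symm, Pi.single_eq_of_ne hbc] using hb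
    rcases eq_or_ne x c with rfl | hxc
    · simpa [Pi.single_eq_of_ne hac.symm, Pi.single_eq_of_ne hbc.symm] using hc
    · simpa [Pi.single_eq_of_ne hxa, Pi.single_eq_of_ne hxb, Pi.single_eq_of_ne hxc] using
        isFree_zero (p x)

theorem IsBoundedWeight.two_cycle {a b : SliceArrow n ℓ w} {ε δ : ℤ} (hab : a ≠ b)
    (hε : ε ≠ 0) (ha : IsFree (p a) ε) (hb : IsFree (p b) δ)
    (hbal : ∀ i, vertexWeight i a * ε + vertexWeight i b * δ = 0) : False := by
  have h := hp (Pi.single a ε + Pi.single b δ) (fun i => ?_) (fun x => ?_)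
  · have h1 := congrFun h a
    simp [Pi.single_eq_of_ne hab, hε] at h1
  · simp only [Pi.add_apply, mul_add, Finset.sum_add_distrib, sum_mul_single]
    exact hbal i
  · change IsFree (p x) _
    rcases eq_or_ne x a with rfl | hxa
    · simpa [Pi.single_eq_of_ne hab] using ha
    rcases eq_or_ne x b with rfl | hxb
    · simpa [Pi.single_eq_of_ne hab.symm] using hb
    · simpa [Pi.single_eq_of_ne hxa, Pi.single_eq_of_ne hxb] using isFree_zero (p x)

end Cycles

/-! ### The order of the vertices -/

/-- All the arrows between `i` and `j` point from `i` to `j`, after reversing those on which `p` is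
a negative integer. -/
def Precedes (p : SliceArrow n ℓ w → ℂ) (i j : Fin n) : Prop :=
  ∃ h : i ≠ j, ∀ k, IsNonnegInt (p (edge h k)) ∧ IsNegInt (p (edge h.symm k))

section Order
variable {p : SliceArrow n ℓ w → ℂ}

/-- An arrow `i → j` and an arrow `j → i` form a cycle. Exponents `1` on both show that one value is
a negative integer, exponents `-1` that one value is a nonnegative integer; comparison with a fixed
arrow makes the choice uniform in `k`. -/
theorem IsBoundedWeight.precedes_or (hp : IsBoundedWeight p) (k₀ : Fin (ℓ - 1)) {i j : Fin n}
    (h : i ≠ j) : Precedes p i j ∨ Precedes p j i := by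
  have ne1 : ∀ k k', (edge h k : SliceArrow n ℓ w) ≠ edge h.symm k' := by
    intro k k' e
    simp only [edge, Sum.inl.injEq, Prod.mk.injEq, Subtype.mk.injEq] at e
    exact h e.1.1
  have cyc : ∀ k k' (ε : ℤ), ε ≠ 0 → IsFree (p (edge h k)) ε → IsFree (p (edge h.symm k')) ε →
      False := by
    intro k k' ε hε h1 h2
    refine hp.two_cycle (ne1 k k') hε h1 h2 fun v => ?_
    simp only [vertexWeight]
    ring
  by_cases h0 : IsNegInt (p (edge h k₀))
  · have h1 : ∀ k, IsNonnegInt (p (edge h.symm k)) := by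
      intro k
      by_contra hk
      exact cyc k₀ k (-1) (by norm_num) (isFree_neg_one.2 fun h2 => h2.not_isNegInt h0)
        (isFree_neg_one.2 hk)
    refine Or.inr ⟨h.symm, fun k => ⟨h1 k, ?_⟩⟩
    by_contra hk
    exact cyc k k₀ 1 one_ne_zero (isFree_one.2 hk) (isFree_one.2 (h1 k₀).not_isNegInt)
  · have h1 : ∀ k, IsNegInt (p (edge h.symm k)) := by
      intro k
      by_contra hk
      exact cyc k₀ k 1 one_ne_zero (isFree_one.2 h0) (isFree_one.2 hk)
    refine Or.inl ⟨h, fun k => ⟨?_, h1 k⟩⟩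
    by_contra hk
    exact cyc k k₀ (-1) (by norm_num) (isFree_neg_one.2 hk)
      (isFree_neg_one.2 fun h2 => h2.not_isNegInt (h1 k₀))

theorem Precedes.asymm (k₀ : Fin (ℓ - 1)) {i j : Fin n} (h : Precedes p i j) :
    ¬ Precedes p j i := by
  rintro ⟨h2, h3⟩
  obtain ⟨h0, h1⟩ := h
  exact (h1 k₀).1.not_isNegInt (h3 k₀).2

/-- The reverse relation would close a directed triangle with nonnegative integers on all three
arrows, along which the exponents `1` are free. -/
theorem IsBoundedWeight.precedes_trans (hp : IsBoundedWeight p) (k₀ : Fin (ℓ - 1)) {i j l : Fin n}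
    (hij : Precedes p i j) (hjl : Precedes p j l) : Precedes p i l := by
  have hil : i ≠ l := by
    rintro rfl
    exact hij.asymm k₀ hjl
  refine (hp.precedes_or k₀ hil).resolve_right fun hli => ?_
  obtain ⟨n1, h1⟩ := hij
  obtain ⟨n2, h2⟩ := hjl
  obtain ⟨n3, h3⟩ := hli
  refine hp.three_cycle (a := edge n1 k₀) (b := edge n2 k₀) (c := edge n3 k₀) (ε := 1) (δ := 1)
    (γ := 1) ?_ ?_ ?_ one_ne_zero
    (isFree_one.2 (h1 k₀).1.not_isNegInt) (isFree_one.2 (h2 k₀).1.not_isNegInt)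
    (isFree_one.2 (h3 k₀).1.not_isNegInt) fun v => ?_
  · intro e
    simp only [edge, Sum.inl.injEq, Prod.mk.injEq, Subtype.mk.injEq] at e
    exact n1 e.1.1
  · intro e
    simp only [edge, Sum.inl.injEq, Prod.mk.injEq, Subtype.mk.injEq] at e
    exact n3 e.1.1.symm
  · intro e
    simp only [edge, Sum.inl.injEq, Prod.mk.injEq, Subtype.mk.injEq] at e
    exact n2 e.1.1
  · simp only [vertexWeight]
    ring

/-- Otherwise the arrow `i → j`, the framing of `j` outwards and the framing of `i` backwards form a
free cycle through the framing vertex. -/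
theorem IsBoundedWeight.framing_of_precedes (hp : IsBoundedWeight p) (k₀ : Fin (ℓ - 1))
    {i j : Fin n} (hij : Precedes p i j) (m m' : Fin w) :
    IsNegInt (p (framing j m')) ∨ IsNonnegInt (p (framing i m)) := by
  by_contra! h
  obtain ⟨n1, h1⟩ := hij
  refine hp.three_cycle (a := edge n1 k₀) (b := framing j m') (c := framing i m) (ε := 1) (δ := 1)
    (γ := -1) (by simp) (by simp) (by simp [n1.symm]) one_ne_zero
    (isFree_one.2 (h1 k₀).1.not_isNegInt) (isFree_one.2 h.1) (isFree_neg_one.2 h.2) fun v => ?_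
  simp only [vertexWeight]
  ring

theorem IsBoundedWeight.framing_of_ne (hp : IsBoundedWeight p) (i : Fin n) {m m' : Fin w}
    (h : m ≠ m') : IsNegInt (p (framing i m')) ∨ IsNonnegInt (p (framing i m)) := by
  by_contra! h'
  refine hp.two_cycle (a := framing i m') (b := framing i m) (ε := 1) (δ := -1)
    (by simp [h.symm]) one_ne_zero (isFree_one.2 h'.1) (isFree_neg_one.2 h'.2) fun v => ?_
  simp only [vertexWeight]
  ring

/-- The position of a vertex is given by a permutation. -/
theorem IsBoundedWeight.exists_perm (hp : IsBoundedWeight p) (k₀ : Fin (ℓ - 1)) :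
    ∃ o : Equiv.Perm (Fin n), ∀ i j, o.symm i < o.symm j ↔ Precedes p i j := by
  classical
  have irr : ∀ i, ¬ Precedes p i i := fun i ⟨h, _⟩ => h rfl
  have hlt : ∀ i, (Finset.univ.filter fun j => Precedes p j i).card < n := by
    intro i
    have h1 : (Finset.univ.filter fun j => Precedes p j i) ⊂ Finset.univ :=
      (Finset.filter_ssubset).2 ⟨i, Finset.mem_univ i, irr i⟩
    simpa using Finset.card_lt_card h1
  -- The position of a vertex is its number of predecessors. By transitivity it increases along the
  -- relation, so it is injective and hence bijective.
  let pos : Fin n → Fin n := fun i => ⟨_, hlt i⟩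
  have hmono : ∀ i j, Precedes p i j → pos i < pos j := by
    intro i j hij
    have hsub : (Finset.univ.filter fun l => Precedes p l i) ⊂
        Finset.univ.filter fun l => Precedes p l j := by
      refine (Finset.ssubset_iff_of_subset fun l hl => ?_).2 ⟨i, ?_, ?_⟩
      · rw [Finset.mem_filter] at hl ⊢
        exact ⟨hl.1, hp.precedes_trans k₀ hl.2 hij⟩
      · simpa using hij
      · simpa using irr i
    exact Finset.card_lt_card hsub
  have hinj : Function.Injective pos := by
    intro i j e
    by_contra hne
    rcases hp.precedes_or k₀ hne with h | h
    · exact (hmono _ _ h).ne e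
    · exact (hmono _ _ h).ne e.symm
  refine ⟨(Equiv.ofBijective pos (Finite.injective_iff_bijective.1 hinj)).symm, fun i j => ?_⟩
  change pos i < pos j ↔ _
  refine ⟨fun h => ?_, hmono i j⟩
  have hne : i ≠ j := by rintro rfl; exact lt_irrefl _ h
  exact (hp.precedes_or k₀ hne).resolve_right fun h' => lt_asymm h (hmono _ _ h')

/-! ### Bounds on the parameter -/

/-- In the equation at the first vertex no term is positive: each of the `(n - 1) * (ℓ - 1)`
incoming arrows contributes at most `-1`, outgoing arrows and framings at most `0`. -/
theorem le_of_first (hℓ : 1 ≤ ℓ) {lam : ℝ} (hc : IsConserved (lam : ℂ) p) (i : Fin n)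
    (h1 : ∀ j, i ≠ j → Precedes p i j) (h2 : ∀ m, IsNonnegInt (p (framing i m))) :
    lam ≤ -(((n : ℝ) - 1) * ((ℓ : ℝ) - 1)) := by
  have hre : ∑ a, (vertexWeight i a : ℝ) * (p a).re = lam := by
    have := congrArg Complex.re (hc i)
    simpa using this
  have nonneg : ∀ t : ℂ, IsNonnegInt t → 0 ≤ t.re := by
    rintro _ ⟨k, rfl⟩; simp
  have neg : ∀ t : ℂ, IsNegInt t → t.re ≤ -1 := by
    rintro _ ⟨k, rfl⟩; simp
  rw [← hre, Fintype.sum_sum_type, ← sum_target hℓ i, ← Finset.sum_neg_distrib]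
  have hfr : ∑ a : Fin n × Fin w, ((vertexWeight i (Sum.inr a : SliceArrow n ℓ w) : ℤ) : ℝ)
      * (p (Sum.inr a)).re ≤ 0 := by
    refine Finset.sum_nonpos ?_
    rintro ⟨j, m⟩ -
    simp only [vertexWeight]
    split_ifs with hj
    · subst hj
      have := nonneg _ (h2 m)
      push_cast
      linarith
    · simp
  refine (add_le_add (Finset.sum_le_sum ?_) hfr).trans (add_zero _).le
  rintro ⟨⟨⟨u, v⟩, huv⟩, k⟩ -
  simp only [vertexWeight]
  simp only at huv
  rcases eq_or_ne v i with rfl | hv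
  · obtain ⟨_, hk⟩ := h1 u huv.symm
    have := neg _ (hk k).2
    rw [if_pos rfl, if_pos rfl, if_neg huv]
    push_cast
    linarith
  · rw [if_neg hv, if_neg hv]
    split_ifs with hu
    · subst hu
      obtain ⟨_, hk⟩ := h1 v hv.symm
      have := nonneg _ (hk k).1
      push_cast
      linarith
    · simp

end Order

/-! ### Duality -/

/-- The involution of the weights which exchanges the two signs. -/
def dualWeight (p : SliceArrow n ℓ w → ℂ) : SliceArrow n ℓ w → ℂ := fun a => -1 - p a

theorem isNegInt_dual {t : ℂ} : IsNegInt (-1 - t) ↔ IsNonnegInt t :=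
  exists_congr fun _ => ⟨fun e => by linear_combination -e, fun e => by linear_combination -e⟩

theorem isNonnegInt_dual {t : ℂ} : IsNonnegInt (-1 - t) ↔ IsNegInt t :=
  exists_congr fun _ => ⟨fun e => by linear_combination -e, fun e => by linear_combination -e⟩

theorem IsBoundedWeight.dual {p : SliceArrow n ℓ w → ℂ} (hp : IsBoundedWeight p) :
    IsBoundedWeight (dualWeight p) := by
  intro m hm h
  refine neg_eq_zero.1 (hp (-m) hm.neg fun a => ?_)
  rw [Pi.neg_apply, neg_pos, neg_neg_iff_pos]
  exact ⟨fun h1 h2 => (h a).2 h1 (isNonnegInt_dual.2 h2), fun h1 h2 =>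
    (h a).1 h1 (isNegInt_dual.2 h2)⟩

/-- Reversal of arrows cancels incoming against outgoing ones, and only the `w` framings remain. -/
theorem sum_vertexWeight (i : Fin n) :
    ∑ a : SliceArrow n ℓ w, vertexWeight i a = -(w : ℤ) := by
  rw [Fintype.sum_sum_type]
  have h1 : ∑ a : {p : Fin n × Fin n // p.1 ≠ p.2} × Fin (ℓ - 1),
      vertexWeight i (Sum.inl a : SliceArrow n ℓ w) = 0 := by
    simp only [vertexWeight]
    rw [Finset.sum_sub_distrib, sub_eq_zero]
    let e : {p : Fin n × Fin n // p.1 ≠ p.2} × Fin (ℓ - 1) ≃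
        {p : Fin n × Fin n // p.1 ≠ p.2} × Fin (ℓ - 1) :=
      { toFun := fun a => (⟨(a.1.1.2, a.1.1.1), a.1.2.symm⟩, a.2)
        invFun := fun a => (⟨(a.1.1.2, a.1.1.1), a.1.2.symm⟩, a.2)
        left_inv := fun _ => rfl
        right_inv := fun _ => rfl }
    exact (Equiv.sum_comp e fun a => if a.1.1.2 = i then (1 : ℤ) else 0).symm
  rw [h1, zero_add, Fintype.sum_prod_type]
  simp [vertexWeight]

/-- The map `p ↦ -1 - p` is the effect of a Fourier transform on the eigenvalues of `x ∂`. It sends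
`λ` to `w - λ`, which exchanges the two outer ranges of the parameter. -/
theorem IsConserved.dual {lam : ℂ} {p : SliceArrow n ℓ w → ℂ}
    (hp : IsConserved lam p) : IsConserved (w - lam) (dualWeight p) := by
  intro i
  have h : ∀ a : SliceArrow n ℓ w, (vertexWeight i a : ℂ) * dualWeight p a
      = -((vertexWeight i a : ℤ) : ℂ) - vertexWeight i a * p a := fun a => by
    rw [dualWeight]; ring
  rw [Finset.sum_congr rfl fun a _ => h a, Finset.sum_sub_distrib, hp i, Finset.sum_neg_distrib,
    ← Int.cast_sum, sum_vertexWeight]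
  simp

theorem Precedes.dual {p : SliceArrow n ℓ w → ℂ} {i j : Fin n} (h : Precedes p i j) :
    Precedes (dualWeight p) j i :=
  ⟨h.1.symm, fun k => ⟨isNonnegInt_dual.2 (h.2 k).2, isNegInt_dual.2 (h.2 k).1⟩⟩

/-- Duality makes the last vertex the first and negative framings nonnegative, so this is the
previous bound for `w - λ`. -/
theorem ge_of_last (hℓ : 1 ≤ ℓ) {p : SliceArrow n ℓ w → ℂ} {lam : ℝ}
    (hc : IsConserved (lam : ℂ) p) (i : Fin n)
    (h1 : ∀ j, i ≠ j → Precedes p j i) (h2 : ∀ m, IsNegInt (p (framing i m))) :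
    ((n : ℝ) - 1) * ((ℓ : ℝ) - 1) + w ≤ lam := by
  have h := le_of_first (p := dualWeight p) (lam := w - lam) hℓ (by
    have := hc.dual
    rw [Complex.ofReal_sub, Complex.ofReal_natCast]
    exact this) i (fun j hj => (h1 j hj).dual) fun m => isNonnegInt_dual.2 (h2 m)
  linarith

section Extremal
variable {p : SliceArrow n ℓ w → ℂ} (hn : 2 ≤ n) (hℓ : 2 ≤ ℓ) (hp : IsBoundedWeight p)
include hn hℓ hp

theorem IsBoundedWeight.exists_first_last : ∃ i j, Precedes p i j ∧
    (∀ l, i ≠ l → Precedes p i l) ∧ (∀ l, j ≠ l → Precedes p l j) := by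
  obtain ⟨o, ho⟩ := hp.exists_perm ⟨0, by omega⟩
  have h1 : ∀ l, o ⟨0, by omega⟩ ≠ l → Precedes p (o ⟨0, by omega⟩) l := by
    intro l hl
    rw [← ho, Equiv.symm_apply_apply, Fin.lt_def]
    refine Nat.pos_of_ne_zero fun e => hl ?_
    rw [← Equiv.eq_symm_apply]
    exact (Fin.ext e).symm
  refine ⟨o ⟨0, by omega⟩, o ⟨n - 1, by omega⟩, h1 _ fun e => ?_, h1, fun l hl => ?_⟩
  · have := congrArg Fin.val (o.injective e)
    simp only at this
    omega
  · rw [← ho, Equiv.symm_apply_apply, Fin.lt_def]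
    refine lt_of_le_of_ne (Nat.le_sub_one_of_lt (o.symm l).2) fun e => hl ?_
    rw [← Equiv.eq_symm_apply]
    exact (Fin.ext e).symm

/-- There are no bounded weights for parameters in the middle range. -/
theorem IsBoundedWeight.not_conserved {lam : ℝ} (h1 : -(((n : ℝ) - 1) * ((ℓ : ℝ) - 1)) < lam)
    (h2 : lam < ((n : ℝ) - 1) * ((ℓ : ℝ) - 1) + w) : ¬ IsConserved (lam : ℂ) p := by
  intro hc
  obtain ⟨i, j, hij, hi, hj⟩ := hp.exists_first_last hn hℓ
  -- The two strict bounds provide a framing at the first vertex that is not a nonnegative integer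
  -- and one at the last vertex that is not a negative integer; these contradict
  -- `framing_of_precedes`.
  obtain ⟨m, hm⟩ : ∃ m, ¬ IsNonnegInt (p (framing i m)) := by
    by_contra! h
    exact absurd (le_of_first (by omega) hc i hi h) (not_le.2 h1)
  obtain ⟨m', hm'⟩ : ∃ m, ¬ IsNegInt (p (framing j m)) := by
    by_contra! h
    exact absurd (ge_of_last (by omega) hc j hj h) (not_le.2 h2)
  exact (hp.framing_of_precedes ⟨0, by omega⟩ hij m m').elim hm' hm

/-- For parameters in the lower range, the framing components of bounded weights are
nonnegative. -/
theorem IsBoundedWeight.isNonnegInt_framing (hw : 1 ≤ w) {lam : ℤ}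
    (hlam : lam ≤ -(((n : ℤ) - 1) * ((ℓ : ℤ) - 1))) (hc : IsConserved (lam : ℂ) p) (i : Fin n)
    (m : Fin w) : IsNonnegInt (p (framing i m)) := by
  obtain ⟨_, j, -, -, hj⟩ := hp.exists_first_last hn hℓ
  -- Negative framings throughout the last vertex would make `λ` positive. A single framing there
  -- that is not a negative integer forces every other framing to be nonnegative, by cycles through
  -- it.
  obtain ⟨m', hm'⟩ : ∃ m, ¬ IsNegInt (p (framing j m)) := by
    by_contra! h
    have h1 := ge_of_last (lam := (lam : ℝ)) (by omega) (by simpa using hc) j hj h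
    have h2 : ((n : ℤ) - 1) * ((ℓ : ℤ) - 1) + w ≤ lam := by exact_mod_cast h1
    have h3 : 0 ≤ ((n : ℤ) - 1) * ((ℓ : ℤ) - 1) := mul_nonneg (by omega) (by omega)
    omega
  rcases eq_or_ne j i with rfl | hji
  swap
  · exact (hp.framing_of_precedes ⟨0, by omega⟩ (hj i hji) m m').resolve_left hm'
  rcases eq_or_ne m m' with rfl | hmm
  swap
  · exact (hp.framing_of_ne j hmm).resolve_left hm'
  -- No cycle constrains the remaining framing. In the equation at `j` all the other terms and `λ`
  -- are integers, so its value is an integer, and not a negative one.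
  have hint : ∀ a, a ≠ framing j m → (∀ u v, a = framing u v → u = j) → ∃ z : ℤ, p a = z := by
    have hneg : ∀ t, IsNegInt t → ∃ z : ℤ, t = z := by
      rintro _ ⟨k, rfl⟩; exact ⟨-(k + 1), by push_cast; ring⟩
    have hnon : ∀ t, IsNonnegInt t → ∃ z : ℤ, t = z := by
      rintro _ ⟨k, rfl⟩; exact ⟨k, by simp⟩
    rintro (⟨⟨⟨u, v⟩, huv⟩, k⟩ | ⟨u, v⟩) ha ha'
    · rcases hp.precedes_or ⟨0, by omega⟩ huv with ⟨_, h⟩ | ⟨_, h⟩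
      · exact hnon _ (h k).1
      · exact hneg _ (h k).2
    · obtain rfl := ha' u v rfl
      exact hnon _ ((hp.framing_of_ne u fun e => ha (by rw [e])).resolve_left hm')
  have hterm : ∀ a, a ≠ framing j m → ∃ z : ℤ, (vertexWeight j a : ℂ) * p a = z := by
    intro a ha
    by_cases h : ∀ u v, a = framing u v → u = j
    · obtain ⟨z, hz⟩ := hint a ha h
      exact ⟨vertexWeight j a * z, by rw [hz]; push_cast; ring⟩
    · push Not at h
      obtain ⟨u, v, rfl, hu⟩ := h
      exact ⟨0, by simp [vertexWeight, hu]⟩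
  choose! z hz using hterm
  have h1 := hc j
  rw [← Finset.add_sum_erase _ _ (Finset.mem_univ (framing j m)),
    Finset.sum_congr rfl fun a ha => hz a (Finset.ne_of_mem_erase ha)] at h1
  have h2 : p (framing j m)
      = ((∑ a ∈ Finset.univ.erase (framing j m), z a - lam : ℤ) : ℂ) := by
    have h3 : vertexWeight j (framing j m : SliceArrow n ℓ w) = -1 := by simp [vertexWeight]
    rw [h3] at h1
    push_cast at h1 ⊢
    linear_combination -h1
  generalize ∑ a ∈ Finset.univ.erase (framing j m), z a - lam = y at h2
  by_contra hcon
  rcases le_or_gt 0 y with hy | hy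
  · exact hcon ⟨y.toNat, by rw [h2, ← Int.cast_natCast, Int.toNat_of_nonneg hy]⟩
  · refine hm' ⟨(-y - 1).toNat, ?_⟩
    rw [h2, ← Int.cast_natCast (R := ℂ), Int.toNat_of_nonneg (by omega)]
    push_cast
    ring

end Extremal

end Signs

/-! ## Weight regions -/

section Regions
variable {n ℓ w : ℕ}

/-- The integral weights with sign pattern `s` that satisfy the moment map equations. -/
def weightRegion (lam : ℤ) (s : SliceArrow n ℓ w → Prop) : Set (SliceArrow n ℓ w → ℤ) :=
  {q | (∀ a, 0 ≤ q a ↔ s a) ∧ ∀ i, ∑ a, vertexWeight i a * q a = lam}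

/-- The arrows that point forward for the order in which the vertex `i` has position `o.symm i`,
the framing vertex being the last. -/
def orderSign (o : Equiv.Perm (Fin n)) : SliceArrow n ℓ w → Prop
  | Sum.inl (p, _) => o.symm p.1.1 < o.symm p.1.2
  | Sum.inr _ => True

/-- The sign patterns of the bounded weights. -/
def boundedSign (lam : ℤ) (o : Equiv.Perm (Fin n)) (a : SliceArrow n ℓ w) : Prop :=
  orderSign o a ↔ lam ≤ 0

theorem dual_mem_weightRegion {lam : ℤ} {s : SliceArrow n ℓ w → Prop}
    {q : SliceArrow n ℓ w → ℤ} (hq : q ∈ weightRegion lam s) :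
    (fun a => -1 - q a) ∈ weightRegion (w - lam) fun a => ¬ s a := by
  refine ⟨fun a => ?_, fun i => ?_⟩
  · change 0 ≤ -1 - q a ↔ ¬ s a
    rw [← hq.1 a]; omega
  · have h : ∀ a : SliceArrow n ℓ w, vertexWeight i a * (-1 - q a)
        = -vertexWeight i a - vertexWeight i a * q a := fun a => by ring
    rw [Finset.sum_congr rfl fun a _ => h a, Finset.sum_sub_distrib, hq.2 i,
      Finset.sum_neg_distrib, sum_vertexWeight, neg_neg]

/-- A suitable combination of the equations gives `q a` a coefficient of its prescribed sign and of
absolute value at least one, so each `|q a|` is bounded by the constant term. -/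
theorem finite_weightRegion_orderSign (lam : ℤ) (o : Equiv.Perm (Fin n)) :
    (weightRegion lam (orderSign (ℓ := ℓ) (w := w) o)).Finite := by
  -- This is the position of `i` relative to the framing vertex, placed at `n`; then `κ a` is the
  -- signed length of the arrow `a`.
  let η : Fin n → ℤ := fun i => (o.symm i : ℕ) - n
  let κ : SliceArrow n ℓ w → ℤ := fun a => ∑ i, η i * vertexWeight i a
  have hκl : ∀ p k, κ (Sum.inl (p, k)) = (o.symm p.1.2 : ℕ) - (o.symm p.1.1 : ℕ) := by
    intro p k
    simp [κ, η, vertexWeight, mul_sub, Finset.sum_sub_distrib]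
  have hκr : ∀ i m, κ (Sum.inr (i, m)) = n - (o.symm i : ℕ) := by
    intro i m
    simp [κ, η, vertexWeight]
  have hle : ∀ q ∈ weightRegion lam (orderSign (ℓ := ℓ) (w := w) o), ∀ a, |q a| ≤ κ a * q a := by
    intro q hq a
    have hs := hq.1 a
    have key : (0 ≤ q a ∧ 1 ≤ κ a) ∨ (q a ≤ 0 ∧ κ a ≤ -1) := by
      rcases a with ⟨⟨⟨u, v⟩, huv⟩, k⟩ | ⟨i, m⟩
      · rw [hκl]
        have hne : o.symm u ≠ o.symm v := fun e => huv (o.symm.injective e)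
        have hne' : (o.symm u : ℕ) ≠ (o.symm v : ℕ) := fun e => hne (Fin.ext e)
        simp only [orderSign, Fin.lt_def] at hs
        simp only
        omega
      · rw [hκr]
        simp only [orderSign, iff_true] at hs
        have := (o.symm i).2
        omega
    rcases key with ⟨h1, h2⟩ | ⟨h1, h2⟩
    · rw [abs_of_nonneg h1]; nlinarith
    · rw [abs_of_nonpos h1]; nlinarith
  set K : ℤ := lam * ∑ i, η i with hK
  refine (Set.finite_Icc (fun _ => -K : SliceArrow n ℓ w → ℤ) fun _ => K).subset fun q hq => ?_
  have hsum : ∑ a, κ a * q a = K := by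
    simp only [κ, Finset.sum_mul]
    rw [Finset.sum_comm, hK, Finset.mul_sum]
    refine Finset.sum_congr rfl fun i _ => ?_
    simp only [mul_assoc]
    rw [← Finset.mul_sum, hq.2 i, mul_comm]
  have hb : ∀ a, |q a| ≤ K := fun a => (hle q hq a).trans (hsum ▸
    Finset.single_le_sum (f := fun a => κ a * q a)
      (fun b _ => (abs_nonneg _).trans (hle q hq b)) (Finset.mem_univ a))
  exact ⟨fun a => (abs_le.1 (hb a)).1, fun a => (abs_le.1 (hb a)).2⟩

theorem finite_weightRegion (lam : ℤ) (o : Equiv.Perm (Fin n)) :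
    (weightRegion lam (boundedSign (ℓ := ℓ) (w := w) lam o)).Finite := by
  by_cases h : lam ≤ 0
  · have e : boundedSign (ℓ := ℓ) (w := w) lam o = orderSign o := by
      funext a; simp [boundedSign, h]
    rw [e]
    exact finite_weightRegion_orderSign lam o
  · have hinj : Function.Injective fun (q : SliceArrow n ℓ w → ℤ) a => -1 - q a := by
      intro q q' e
      funext a
      have := congrFun e a
      simp only at this
      omega
    refine ((finite_weightRegion_orderSign (w - lam) o).preimage hinj.injOn).subset fun q hq => ?_
    have := dual_mem_weightRegion hq
    have e : (fun a => ¬ boundedSign (ℓ := ℓ) (w := w) lam o a) = orderSign o := by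
      funext a; simp [boundedSign, h]
    rwa [e] at this

/-- Take the arrow values closest to the wall: `0` forward and `-1` backward. At each vertex the
arrows then contribute at least minus the number of incoming ones, hence at least `λ`, and the first
framing coordinate absorbs the nonnegative difference. -/
theorem nonempty_weightRegion_orderSign (hℓ : 1 ≤ ℓ) (hw : 1 ≤ w) {lam : ℤ}
    (hlam : lam ≤ -(((n : ℤ) - 1) * ((ℓ : ℤ) - 1))) (o : Equiv.Perm (Fin n)) :
    (weightRegion lam (orderSign (ℓ := ℓ) (w := w) o)).Nonempty := by
  classical
  let q₀ : {p : Fin n × Fin n // p.1 ≠ p.2} × Fin (ℓ - 1) → ℤ := fun a =>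
    if o.symm a.1.1.1 < o.symm a.1.1.2 then 0 else -1
  let base : Fin n → ℤ := fun i => ∑ a, vertexWeight i (Sum.inl a : SliceArrow n ℓ w) * q₀ a
  have hbase : ∀ i, lam ≤ base i := by
    intro i
    refine hlam.trans ?_
    rw [← sum_target hℓ i, ← Finset.sum_neg_distrib]
    refine Finset.sum_le_sum ?_
    rintro ⟨⟨⟨u, v⟩, huv⟩, k⟩ -
    simp only [vertexWeight, q₀]
    split_ifs <;> simp
  refine ⟨Sum.elim q₀ fun b => if b.2 = ⟨0, hw⟩ then base b.1 - lam else 0, ?_, ?_⟩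
  · rintro (⟨⟨⟨u, v⟩, huv⟩, k⟩ | ⟨i, m⟩)
    · simp only [Sum.elim_inl, orderSign, q₀]
      split_ifs with h <;> simp [h]
    · have := hbase i
      simp only [Sum.elim_inr, orderSign, iff_true]
      split_ifs <;> omega
  · intro i
    rw [Fintype.sum_sum_type]
    have h1 : ∑ b : Fin n × Fin w, vertexWeight i (Sum.inr b : SliceArrow n ℓ w)
        * (Sum.elim q₀ (fun b => if b.2 = ⟨0, hw⟩ then base b.1 - lam else 0) (Sum.inr b) : ℤ)
        = -(base i - lam) := by
      rw [Fintype.sum_prod_type]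
      simp [vertexWeight]
    rw [h1]
    simp only [Sum.elim_inl]
    change base i + _ = _
    ring

theorem nonempty_weightRegion (hn : 2 ≤ n) (hℓ : 2 ≤ ℓ) (hw : 1 ≤ w) {lam : ℤ}
    (hlam : ((n : ℤ) - 1) * ((ℓ : ℤ) - 1) + (w : ℤ) ≤ lam ∨
      lam ≤ -(((n : ℤ) - 1) * ((ℓ : ℤ) - 1))) (o : Equiv.Perm (Fin n)) :
    (weightRegion lam (boundedSign (ℓ := ℓ) (w := w) lam o)).Nonempty := by
  have hpos : 0 < ((n : ℤ) - 1) * ((ℓ : ℤ) - 1) := mul_pos (by omega) (by omega)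
  rcases hlam with h | h
  · obtain ⟨q, hq⟩ := nonempty_weightRegion_orderSign (ℓ := ℓ) (w := w) (by omega) hw
      (lam := w - lam) (by omega) o
    have := dual_mem_weightRegion hq
    have e : boundedSign (ℓ := ℓ) (w := w) lam o = fun a => ¬ orderSign o a := by
      funext a
      have : ¬ lam ≤ 0 := by omega
      simp [boundedSign, this]
    rw [sub_sub_cancel] at this
    exact ⟨_, e ▸ this⟩
  · have e : boundedSign (ℓ := ℓ) (w := w) lam o = orderSign o := by
      funext a
      have : lam ≤ 0 := by omega
      simp [boundedSign, this]
    rw [e]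
    exact nonempty_weightRegion_orderSign (by omega) hw h o

/-- Any two vertices are joined by an arrow because `ℓ ≥ 2`, so the signs determine the order, and
`Fin n` has no order automorphism except the identity. -/
theorem boundedSign_injective (hℓ : 2 ≤ ℓ) (lam : ℤ) :
    Function.Injective (boundedSign (n := n) (ℓ := ℓ) (w := w) lam) := by
  intro o o' e
  have h : ∀ i j, i ≠ j → (o.symm i < o.symm j ↔ o'.symm i < o'.symm j) := by
    intro i j hij
    have := congrFun e (edge hij ⟨0, by omega⟩)
    simp only [boundedSign, orderSign, eq_iff_iff] at this
    tauto
  have hmono : StrictMono fun k => o'.symm (o k) := by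
    intro k k' hk
    have := (h (o k) (o k') (fun e => hk.ne (o.injective e))).1 (by simpa using hk)
    exact this
  let f : Fin n ≃o Fin n := hmono.orderIsoOfSurjective _ (o.trans o'.symm).surjective
  refine Equiv.ext fun k => (Equiv.symm_apply_eq _).1 ?_
  exact DFunLike.congr_fun (Subsingleton.elim f (OrderIso.refl _)) k

theorem vertexWeight_arrowPerm (σ : Equiv.Perm (Fin n)) (i : Fin n) (a : SliceArrow n ℓ w) :
    vertexWeight i (arrowPerm σ a) = vertexWeight (σ.symm i) a := by
  rcases a with ⟨p, k⟩ | ⟨j, m⟩ <;> simp [vertexWeight, arrowPerm, Equiv.eq_symm_apply]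

theorem boundedSign_mul (lam : ℤ) (σ o : Equiv.Perm (Fin n)) (a : SliceArrow n ℓ w) :
    boundedSign lam (σ * o) a ↔ boundedSign lam o (arrowPerm σ⁻¹ a) := by
  refine iff_congr ?_ Iff.rfl
  rcases a with ⟨p, k⟩ | ⟨j, m⟩
  · exact Iff.rfl
  · exact Iff.rfl

theorem comp_arrowPerm_mem (lam : ℤ) (σ o : Equiv.Perm (Fin n)) {q : SliceArrow n ℓ w → ℤ}
    (hq : q ∈ weightRegion lam (boundedSign lam o)) :
    (fun a => q (arrowPerm σ⁻¹ a)) ∈ weightRegion lam (boundedSign lam (σ * o)) := by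
  refine ⟨fun a => (hq.1 _).trans (boundedSign_mul lam σ o a).symm, fun i => ?_⟩
  rw [← hq.2 (σ⁻¹ i), ← Equiv.sum_comp (arrowPerm σ⁻¹) fun b => vertexWeight (σ⁻¹ i) b * q b]
  refine Finset.sum_congr rfl fun a _ => ?_
  rw [vertexWeight_arrowPerm, Equiv.symm_apply_apply]

section Classification
variable (hn : 2 ≤ n) (hℓ : 2 ≤ ℓ) (hw : 1 ≤ w)
include hn hℓ hw

theorem IsBoundedWeight.exists_mem_orderSign {p : SliceArrow n ℓ w → ℂ} (hp : IsBoundedWeight p)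
    {lam : ℤ} (hlam : lam ≤ -(((n : ℤ) - 1) * ((ℓ : ℤ) - 1))) (hc : IsConserved (lam : ℂ) p) :
    ∃ o, ∃ q ∈ weightRegion lam (orderSign (ℓ := ℓ) (w := w) o), ∀ a, p a = q a := by
  obtain ⟨o, ho⟩ := hp.exists_perm ⟨0, by omega⟩
  have key : ∀ a, ∃ z : ℤ, p a = z ∧ (0 ≤ z ↔ orderSign o a) := by
    have hnon : ∀ t, IsNonnegInt t → ∃ z : ℤ, t = z ∧ 0 ≤ z := by
      rintro _ ⟨k, rfl⟩; exact ⟨k, by simp, by simp⟩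
    have hneg : ∀ t, IsNegInt t → ∃ z : ℤ, t = z ∧ ¬ 0 ≤ z := by
      rintro _ ⟨k, rfl⟩; exact ⟨-(k + 1), by push_cast; ring, by omega⟩
    rintro (⟨⟨⟨u, v⟩, huv⟩, k⟩ | ⟨i, m⟩)
    · rcases hp.precedes_or ⟨0, by omega⟩ huv with h | h
      · obtain ⟨z, hz, hz'⟩ := hnon _ (h.2 k).1
        exact ⟨z, hz, iff_of_true hz' ((ho u v).2 h)⟩
      · obtain ⟨z, hz, hz'⟩ := hneg _ (h.2 k).2
        exact ⟨z, hz, iff_of_false hz' (not_lt.2 ((ho v u).2 h).le)⟩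
    · obtain ⟨z, hz, hz'⟩ := hnon _ (hp.isNonnegInt_framing hn hℓ hw hlam hc i m)
      exact ⟨z, hz, iff_of_true hz' trivial⟩
  choose q hq hq' using key
  refine ⟨o, q, ⟨hq', fun i => ?_⟩, hq⟩
  have := hc i
  simp only [hq] at this
  exact_mod_cast this

/-- The upper range reduces to the lower one by duality: the order is read off from the dual weight,
and all the signs are reversed, as in `boundedSign`. -/
theorem IsBoundedWeight.exists_mem_weightRegion {p : SliceArrow n ℓ w → ℂ}
    (hp : IsBoundedWeight p) {lam : ℤ}
    (hlam : ((n : ℤ) - 1) * ((ℓ : ℤ) - 1) + (w : ℤ) ≤ lam ∨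
      lam ≤ -(((n : ℤ) - 1) * ((ℓ : ℤ) - 1))) (hc : IsConserved (lam : ℂ) p) :
    ∃ o, ∃ q ∈ weightRegion lam (boundedSign (ℓ := ℓ) (w := w) lam o), ∀ a, p a = q a := by
  have hpos : 0 < ((n : ℤ) - 1) * ((ℓ : ℤ) - 1) := mul_pos (by omega) (by omega)
  rcases hlam with h | h
  · obtain ⟨o, q, hq, hpq⟩ := hp.dual.exists_mem_orderSign hn hℓ hw (lam := w - lam) (by omega)
      (by push_cast; exact hc.dual)
    refine ⟨o, fun a => -1 - q a, ?_, fun a => ?_⟩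
    · have h1 := dual_mem_weightRegion hq
      have e : boundedSign (ℓ := ℓ) (w := w) lam o = fun a => ¬ orderSign o a := by
        funext a
        have : ¬ lam ≤ 0 := by omega
        simp [boundedSign, this]
      rw [sub_sub_cancel] at h1
      exact e ▸ h1
    · have := hpq a
      rw [dualWeight] at this
      push_cast
      linear_combination -this
  · obtain ⟨o, q, hq, hpq⟩ := hp.exists_mem_orderSign hn hℓ hw h hc
    have e : boundedSign (ℓ := ℓ) (w := w) lam o = orderSign o := by
      funext a
      have : lam ≤ 0 := by omega
      simp [boundedSign, this]
    exact ⟨o, q, e ▸ hq, hpq⟩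

end Classification

/-- The weights of the simple module attached to an order of the vertices. -/
def sliceWeights (lam : ℤ) (o : Equiv.Perm (Fin n)) : Set (SliceArrow n ℓ w → ℂ) :=
  {p | ∃ q ∈ weightRegion lam (boundedSign lam o), ∀ a, p a = q a}

theorem eq_of_mem_sliceWeights (hℓ : 2 ≤ ℓ) {lam : ℤ} {o o' : Equiv.Perm (Fin n)}
    {p : SliceArrow n ℓ w → ℂ} (h : p ∈ sliceWeights lam o) (h' : p ∈ sliceWeights lam o') :
    o = o' := by
  obtain ⟨q, hq, hpq⟩ := h
  obtain ⟨q', hq', hpq'⟩ := h'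
  have e : q = q' := funext fun a => Int.cast_injective ((hpq a).symm.trans (hpq' a))
  subst e
  exact boundedSign_injective hℓ lam (funext fun a => propext ((hq.1 a).symm.trans (hq'.1 a)))

theorem comp_mem_sliceWeights (lam : ℤ) (σ o : Equiv.Perm (Fin n)) (p : SliceArrow n ℓ w → ℂ)
    (h : p ∈ sliceWeights lam o) : (fun a => p (arrowPerm σ⁻¹ a)) ∈ sliceWeights lam (σ * o) := by
  obtain ⟨q, hq, hpq⟩ := h
  exact ⟨_, comp_arrowPerm_mem lam σ o hq, fun a => hpq _⟩

end Regions

/-! ## Bimodules of homomorphisms -/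

section HomBimodule
variable {A : Type} [Ring A] [Algebra ℂ A]

/-- Burnside's theorem: by Schur's lemma over `ℂ` the endomorphisms commuting with `A` are scalars,
so every linear map commutes with them, and the density theorem realizes it on a finite spanning
set. -/
theorem FDSimple.exists_smul_eq (L : FDSimple A) (T : Module.End ℂ L.carrier) :
    ∃ a : A, ∀ v, T v = a • v := by
  have hsurj := (IsSimpleModule.algebraMap_end_bijective_of_isAlgClosed (k := ℂ) (A := A)
    (V := L.carrier)).2
  let f : Module.End (Module.End A L.carrier) L.carrier :=
    { toFun := T
      map_add' := map_add T
      map_smul' := fun g v => by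
        obtain ⟨c, rfl⟩ := hsurj g
        exact map_smul T c v }
  obtain ⟨s, hs⟩ := (Module.finite_def (R := ℂ) (M := L.carrier)).1 inferInstance
  obtain ⟨a, ha⟩ := jacobson_density f s
  refine ⟨a, fun v => ?_⟩
  have : T = Algebra.lsmul ℂ ℂ L.carrier a := LinearMap.ext_on hs fun m hm => ha m hm
  rw [this]; rfl

variable (L L' : FDSimple A)

/-- The left multiplications on the linear maps from `L'` to `L`. -/
def homLeft : A →ₐ[ℂ] Module.End ℂ (L'.carrier →ₗ[ℂ] L.carrier) where
  toFun a := LinearMap.compRight ℂ (Algebra.lsmul ℂ ℂ L.carrier a)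
  map_one' := by ext; simp
  map_mul' a b := by ext; simp
  map_zero' := by ext; simp
  map_add' a b := by ext; simp
  commutes' c := by ext; simp

/-- The right multiplications on the linear maps from `L'` to `L`. -/
def homRight : Aᵐᵒᵖ →ₐ[ℂ] Module.End ℂ (L'.carrier →ₗ[ℂ] L.carrier) where
  toFun b := LinearMap.lcomp ℂ L.carrier (Algebra.lsmul ℂ ℂ L'.carrier b.unop)
  map_one' := by ext; simp
  map_mul' a b := by ext; simp
  map_zero' := by ext; simp
  map_add' a b := by ext; simp
  commutes' c := by ext; simp

theorem commute_homLeft_homRight (a : A) (b : Aᵐᵒᵖ) : Commute (homLeft L L' a) (homRight L L' b) :=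
  LinearMap.ext fun _ => rfl

/-- The action of the enveloping algebra on the linear maps from `L'` to `L`. -/
noncomputable def homRep : A ⊗[ℂ] Aᵐᵒᵖ →ₐ[ℂ] Module.End ℂ (L'.carrier →ₗ[ℂ] L.carrier) :=
  Algebra.TensorProduct.lift (homLeft L L') (homRight L L') (commute_homLeft_homRight L L')

theorem homRep_tmul (a : A) (b : Aᵐᵒᵖ) T (v : L'.carrier) :
    homRep L L' (a ⊗ₜ b) T v = a • T (b.unop • v) := by
  rw [homRep, Algebra.TensorProduct.lift_tmul]
  rfl

/-- Composing a nonzero `T` on both sides with elements of `A` produces every map of rank one, and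
these span. -/
theorem isSimpleModule_homRep : IsSimpleModule (A ⊗[ℂ] Aᵐᵒᵖ) (RepModule (homRep L L')) := by
  have := IsSimpleModule.nontrivial A L.carrier
  have := IsSimpleModule.nontrivial A L'.carrier
  have hnt : Nontrivial (RepModule (homRep L L')) :=
    inferInstanceAs (Nontrivial (L'.carrier →ₗ[ℂ] L.carrier))
  refine { eq_bot_or_eq_top := fun K => or_iff_not_imp_left.2 fun hK => ?_ }
  obtain ⟨T, hT, hT0⟩ : ∃ T : L'.carrier →ₗ[ℂ] L.carrier,
    (show RepModule (homRep L L') from T) ∈ K ∧ T ≠ 0 := K.ne_bot_iff.1 hK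
  obtain ⟨v, hv⟩ : ∃ v, T v ≠ 0 := by
    by_contra! h
    exact hT0 (LinearMap.ext h)
  have hrank : ∀ (φ : Module.Dual ℂ L'.carrier) (y : L.carrier),
      (show RepModule (homRep L L') from φ.smulRight y) ∈ K := by
    intro φ y
    -- The element `b` sends `u` to `φ u • v`, and `a` sends `T v` to `y`, so that `a ∘ T ∘ b` is `u
    -- ↦ φ u • y`.
    obtain ⟨χ, hχ⟩ := Module.Projective.exists_dual_ne_zero ℂ hv
    obtain ⟨a, ha⟩ := L.exists_smul_eq (χ.smulRight ((χ (T v))⁻¹ • y))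
    obtain ⟨b, hb⟩ := L'.exists_smul_eq (φ.smulRight v)
    have e : (show RepModule (homRep L L') from φ.smulRight y)
        = (a ⊗ₜ[ℂ] MulOpposite.op b) • (show RepModule (homRep L L') from T) := by
      refine LinearMap.ext fun u => ?_
      refine Eq.trans ?_ (homRep_tmul L L' a (MulOpposite.op b) T u).symm
      rw [MulOpposite.unop_op, ← hb, ← ha]
      simp only [LinearMap.smulRight_apply, map_smul]
      rw [smul_smul (χ (T v)), mul_inv_cancel₀ hχ, one_smul]
    rw [e]
    exact K.smul_mem _ hT
  have htop : ∀ S : L'.carrier →ₗ[ℂ] L.carrier, (show RepModule (homRep L L') from S) ∈ K := by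
    intro S
    let B := Module.finBasis ℂ L'.carrier
    have e : S = ∑ i, (B.coord i).smulRight (S (B i)) := by
      refine B.ext fun i => ?_
      simp [LinearMap.sum_apply, Finsupp.single_apply]
    rw [e]
    exact K.sum_mem fun i _ => hrank _ _
  exact eq_top_iff.2 fun S _ => htop S

/-- The bimodule of linear maps from `L'` to `L`. -/
@[reducible]
noncomputable def FDSimple.hom : FDSimple (A ⊗[ℂ] Aᵐᵒᵖ) where
  carrier := RepModule (homRep L L')
  isSimple := isSimpleModule_homRep L L'

end HomBimodule

/-! ### Simple bimodules from pairs of simple modules -/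

section BimoduleWeights
variable {A J X : Type} [Ring A] [Algebra ℂ A] (Θ : J → A) (Ω : X → Set (J → ℂ))

/-- The left and right multiplications by the family `Θ`. -/
noncomputable abbrev bimoduleFamily : J ⊕ J → A ⊗[ℂ] Aᵐᵒᵖ :=
  Sum.elim (fun j => Θ j ⊗ₜ[ℂ] (1 : Aᵐᵒᵖ)) fun j => (1 : A) ⊗ₜ[ℂ] MulOpposite.op (Θ j)

/-- Pairs of weights. -/
def bimoduleWeights (x : X × X) : Set (J ⊕ J → ℂ) :=
  {P | (fun j => P (Sum.inl j)) ∈ Ω x.1 ∧ (fun j => P (Sum.inr j)) ∈ Ω x.2}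

/-- A bimodule as a left module. -/
abbrev LeftModule (M : Type) [AddCommGroup M] [Module ℂ M] [Module (A ⊗[ℂ] Aᵐᵒᵖ) M]
    [IsScalarTower ℂ (A ⊗[ℂ] Aᵐᵒᵖ) M] : Type :=
  RepModule ((Algebra.lsmul ℂ ℂ M).comp
    (Algebra.TensorProduct.includeLeft : A →ₐ[ℂ] A ⊗[ℂ] Aᵐᵒᵖ))

/-- A bimodule as a right module. -/
abbrev RightModule (M : Type) [AddCommGroup M] [Module ℂ M] [Module (A ⊗[ℂ] Aᵐᵒᵖ) M]
    [IsScalarTower ℂ (A ⊗[ℂ] Aᵐᵒᵖ) M] : Type :=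
  RepModule ((Algebra.lsmul ℂ ℂ M).comp
    (Algebra.TensorProduct.includeRight : Aᵐᵒᵖ →ₐ[ℂ] A ⊗[ℂ] Aᵐᵒᵖ))

variable {Θ Ω}

section
variable {M : Type} [AddCommGroup M] [Module ℂ M] [Module (A ⊗[ℂ] Aᵐᵒᵖ) M]
    [IsScalarTower ℂ (A ⊗[ℂ] Aᵐᵒᵖ) M] {P : J ⊕ J → ℂ}

theorem IsWeightOf.left (h : IsWeightOf (bimoduleFamily Θ) M P) :
    IsWeightOf Θ (LeftModule (A := A) M) fun j => P (Sum.inl j) := by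
  obtain ⟨v, hv0, hv⟩ := h
  exact ⟨v, hv0, fun j => hv (Sum.inl j)⟩

theorem IsWeightOf.right (h : IsWeightOf (bimoduleFamily Θ) M P) :
    IsWeightOf (fun j => MulOpposite.op (Θ j)) (RightModule (A := A) M)
      fun j => P (Sum.inr j) := by
  obtain ⟨v, hv0, hv⟩ := h
  exact ⟨v, hv0, fun j => hv (Sum.inr j)⟩

end

/-- The map `u ↦ φ u • y` is an eigenvector on the left through `y` and on the right through `φ`;
hence the need for eigenfunctionals on `L'`. -/
theorem isWeightOf_hom {L L' : FDSimple A} {P : J ⊕ J → ℂ}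
    (hL : IsWeightOf Θ L.carrier fun j => P (Sum.inl j))
    (hL' : ∃ φ : Module.Dual ℂ L'.carrier, φ ≠ 0 ∧ ∀ j v, φ (Θ j • v) = P (Sum.inr j) * φ v) :
    IsWeightOf (bimoduleFamily Θ) (L.hom L').carrier P := by
  obtain ⟨y, hy0, hy⟩ := hL
  obtain ⟨φ, hφ0, hφ⟩ := hL'
  refine ⟨(φ.smulRight y : L'.carrier →ₗ[ℂ] L.carrier), fun e => ?_, ?_⟩
  · obtain ⟨v, hv⟩ : ∃ v, φ v ≠ 0 := by
      by_contra! h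
      exact hφ0 (LinearMap.ext h)
    exact smul_ne_zero hv hy0 (LinearMap.congr_fun e v)
  · rintro (j | j)
    · refine LinearMap.ext fun v => (homRep_tmul L L' _ _ _ v).trans ?_
      change Θ j • φ ((1 : A) • v) • y = P (Sum.inl j) • φ v • y
      rw [one_smul, smul_comm (Θ j) (φ v) y, hy, smul_comm]
    · refine LinearMap.ext fun v => (homRep_tmul L L' _ _ _ v).trans ?_
      change (1 : A) • φ (Θ j • v) • y = P (Sum.inr j) • φ v • y
      rw [one_smul, hφ, mul_smul]

/-- A joint eigenvector `T` is nonzero on some weight vector of `L'`, because these span. That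
vector carries the right weight of `T`, and its image in `L` the left one. -/
theorem isWeightOf_of_hom {L L' : FDSimple A} {P : J ⊕ J → ℂ}
    {x y : X} (hL : ∀ p, IsWeightOf Θ L.carrier p → p ∈ Ω x)
    (hL' : ∀ v : L'.carrier, v ∈ Submodule.span ℂ {v | ∃ p ∈ Ω y, ∀ j, Θ j • v = p j • v})
    (h : IsWeightOf (bimoduleFamily Θ) (L.hom L').carrier P) : P ∈ bimoduleWeights Ω (x, y) := by
  obtain ⟨T, hT0, hT⟩ : ∃ T : L'.carrier →ₗ[ℂ] L.carrier, T ≠ 0 ∧ ∀ j,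
    bimoduleFamily Θ j • (show (L.hom L').carrier from T)
      = P j • (show (L.hom L').carrier from T) := h
  have h1 : ∀ j v, Θ j • T v
      = P (Sum.inl j) • T v := fun j v => by
    have := (homRep_tmul L L' (Θ j) 1 T v).symm.trans (LinearMap.congr_fun (hT (Sum.inl j)) v)
    rw [MulOpposite.unop_one, one_smul] at this
    exact this
  have h2 : ∀ j v, T (Θ j • v)
      = P (Sum.inr j) • T v := fun j v => by
    have := (homRep_tmul L L' 1 (MulOpposite.op (Θ j)) T v).symm.trans
      (LinearMap.congr_fun (hT (Sum.inr j)) v)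
    rw [MulOpposite.unop_op, one_smul] at this
    exact this
  obtain ⟨v, ⟨p, hp, hv⟩, hTv⟩ : ∃ v ∈ {v | ∃ p ∈ Ω y, ∀ j, Θ j • v = p j • v},
      T v ≠ 0 := by
    by_contra! h0
    refine hT0 (LinearMap.ext_on (s := {v | ∃ p ∈ Ω y, ∀ j, Θ j • v = p j • v}) ?_ h0)
    exact eq_top_iff.2 fun v _ => hL' v
  refine ⟨hL _ ⟨_, hTv, fun j => h1 j v⟩, ?_⟩
  have e : (fun j => P (Sum.inr j)) = p := by
    funext j
    have := h2 j v
    rw [hv, map_smul] at this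
    exact (smul_left_injective ℂ hTv this).symm
  exact e ▸ hp

/-- The classification of the simple bimodules from that of the simple modules. -/
theorem classifiesSimple_bimodule (halg : IsWeightAlgebra Θ)
    (heq : ∀ {x y : X} {p : J → ℂ}, p ∈ Ω x → p ∈ Ω y → x = y)
    (hL : ∀ x, ∃ L : FDSimple A, (∀ p, IsWeightOf Θ L.carrier p ↔ p ∈ Ω x) ∧
      (∀ v : L.carrier, v ∈ Submodule.span ℂ {v | ∃ p ∈ Ω x, ∀ j, Θ j • v = p j • v}) ∧
      ∀ p ∈ Ω x, ∃ φ : Module.Dual ℂ L.carrier, φ ≠ 0 ∧ ∀ j v, φ (Θ j • v) = p j * φ v)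
    (hleft : ∀ (M : Type) [AddCommGroup M] [Module ℂ M] [FiniteDimensional ℂ M] [Module A M]
      [IsScalarTower ℂ A M] (p : J → ℂ), IsWeightOf Θ M p → ∃ x, p ∈ Ω x)
    (hright : ∀ (M : Type) [AddCommGroup M] [Module ℂ M] [FiniteDimensional ℂ M] [Module Aᵐᵒᵖ M]
      [IsScalarTower ℂ Aᵐᵒᵖ M] (p : J → ℂ),
      IsWeightOf (fun j => MulOpposite.op (Θ j)) M p → ∃ x, p ∈ Ω x) :
    ClassifiesSimple (bimoduleFamily Θ) (bimoduleWeights Ω) where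
  isWeightAlgebra := halg.tensor halg.op
  eq_of_mem hx hy := Prod.ext (heq hx.1 hy.1) (heq hx.2 hy.2)
  exists_simple := by
    rintro ⟨x, y⟩
    obtain ⟨L, h1, -, -⟩ := hL x
    obtain ⟨L', -, h2, h3⟩ := hL y
    exact ⟨L.hom L', fun P => ⟨isWeightOf_of_hom (fun p => (h1 p).1) h2,
      fun hP => isWeightOf_hom ((h1 _).2 hP.1) (h3 _ hP.2)⟩⟩
  exists_mem M P hP := by
    obtain ⟨x, hx⟩ := hleft _ _ hP.left
    obtain ⟨y, hy⟩ := hright _ _ hP.right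
    exact ⟨(x, y), hx, hy⟩

theorem IsEquivariantFamily.bimodule {G : Type} [Group G] [MulAction G X] {ψ : G →* (A →ₐ[ℂ] A)}
    {π : G → J → J} (h : IsEquivariantFamily ψ π Θ Ω) :
    IsEquivariantFamily (bimoduleAction ψ) (fun g => Sum.map (π g) (π g)) (bimoduleFamily Θ)
      (bimoduleWeights Ω) where
  apply_eq g := by
    rintro (j | j)
    · simp [bimoduleAction, h.apply_eq]
    · simp [bimoduleAction, h.apply_eq]
  comp_mem g x P hP := ⟨h.comp_mem g x.1 _ hP.1, h.comp_mem g x.2 _ hP.2⟩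

end BimoduleWeights

/-! ## Modules of Laurent monomials -/

namespace Weyl

section Laurent
variable {ι : Type} [DecidableEq ι] (s : ι → Prop) [DecidablePred s]

/-- Multiplication by a coordinate on families of coefficients of Laurent monomials, the monomials
being normalized according to the signs `s`. -/
def laurentX (a : ι) : Module.End ℂ ((ι → ℤ) → ℂ) where
  toFun f q := (if s a then 1 else (q a : ℂ)) * f (q - Pi.single a 1)
  map_add' f g := by funext q; simp [mul_add]
  map_smul' c f := by funext q; simp [mul_left_comm]

/-- The partial derivatives on families of coefficients of Laurent monomials. -/
def laurentD (a : ι) : Module.End ℂ ((ι → ℤ) → ℂ) where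
  toFun f q := (if s a then (q a + 1 : ℂ) else 1) * f (q + Pi.single a 1)
  map_add' f g := by funext q; simp [mul_add]
  map_smul' c f := by funext q; simp [mul_left_comm]

/-- The action of differential operators on families of coefficients of Laurent monomials. -/
def laurentRep : Weyl ι →ₐ[ℂ] Module.End ℂ ((ι → ℤ) → ℂ) :=
  lift (laurentX s) (laurentD s)
    (fun a b => by
      rcases eq_or_ne a b with rfl | hab
      · rfl
      refine LinearMap.ext fun f => funext fun q => ?_
      simp only [laurentX, Module.End.mul_apply, LinearMap.coe_mk, AddHom.coe_mk, Pi.sub_apply,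
        Pi.single_eq_of_ne hab, Pi.single_eq_of_ne hab.symm, sub_zero]
      rw [sub_right_comm]
      ring)
    (fun a b => by
      rcases eq_or_ne a b with rfl | hab
      · rfl
      refine LinearMap.ext fun f => funext fun q => ?_
      simp only [laurentD, Module.End.mul_apply, LinearMap.coe_mk, AddHom.coe_mk, Pi.add_apply,
        Pi.single_eq_of_ne hab, Pi.single_eq_of_ne hab.symm, add_zero]
      rw [add_right_comm]
      ring)
    (fun a b => by
      refine LinearMap.ext fun f => funext fun q => ?_
      rcases eq_or_ne a b with rfl | hab
      · simp only [laurentX, laurentD, Module.End.mul_apply, LinearMap.sub_apply, LinearMap.coe_mk,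
          AddHom.coe_mk, Pi.sub_apply, Pi.add_apply, Pi.single_eq_same, sub_add_cancel,
          add_sub_cancel_right, if_true, LinearMap.neg_apply, Module.End.one_apply, Pi.neg_apply]
        split_ifs <;> push_cast <;> ring
      · simp only [laurentX, laurentD, Module.End.mul_apply, LinearMap.sub_apply, LinearMap.coe_mk,
          AddHom.coe_mk, Pi.sub_apply, Pi.add_apply, Pi.single_eq_of_ne hab,
          Pi.single_eq_of_ne hab.symm, if_neg hab, neg_zero, LinearMap.zero_apply, Pi.zero_apply,
          add_zero, sub_zero]
        rw [sub_add_eq_add_sub]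
        ring)

theorem laurentRep_x (a : ι) (f : (ι → ℤ) → ℂ) (q : ι → ℤ) : laurentRep s (x a) f q
    = (if s a then 1 else (q a : ℂ)) * f (q - Pi.single a 1) := by
  rw [laurentRep, lift_x]; rfl

theorem laurentRep_d (a : ι) (f : (ι → ℤ) → ℂ) (q : ι → ℤ) : laurentRep s (d a) f q
    = (if s a then (q a + 1 : ℂ) else 1) * f (q + Pi.single a 1) := by
  rw [laurentRep, lift_d]; rfl

theorem laurentRep_euler (a : ι) (f : (ι → ℤ) → ℂ) (q : ι → ℤ) :
    laurentRep s (euler a) f q = q a * f q := by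
  rw [euler, map_mul, Module.End.mul_apply, laurentRep_x, laurentRep_d, sub_add_cancel]
  split_ifs <;> simp

/-- The families of coefficients supported on the exponents of signs `s`. -/
def signSupported : Submodule ℂ ((ι → ℤ) → ℂ) where
  carrier := {f | ∀ q, f q ≠ 0 → ∀ a, 0 ≤ q a ↔ s a}
  add_mem' {f g} hf hg q h a := by
    by_cases hq : f q = 0
    · exact hg q (by simpa [hq] using h) a
    · exact hf q hq a
  zero_mem' q h := (h rfl).elim
  smul_mem' c f hf q h := hf q (right_ne_zero_of_mul h)

/-- In this normalization the coefficients vanish exactly at the wall between `-1` and `0`: that of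
`∂ a` where `s a` holds, that of `x a` where it fails. So the orthant of signs `s` is never left. -/
theorem laurentRep_mem (u : Weyl ι) : ∀ f ∈ signSupported s, laurentRep s u f ∈ signSupported s := by
  let S : Subalgebra ℂ (Weyl ι) :=
    { carrier := {u | ∀ f ∈ signSupported s, laurentRep s u f ∈ signSupported s}
      mul_mem' := fun hu hv f hf => by
        rw [map_mul, Module.End.mul_apply]; exact hu _ (hv _ hf)
      add_mem' := fun hu hv f hf => by
        rw [map_add, LinearMap.add_apply]; exact add_mem (hu _ hf) (hv _ hf)
      algebraMap_mem' := fun r f hf => by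
        rw [AlgHom.commutes, Module.algebraMap_end_apply]; exact Submodule.smul_mem _ r hf }
  refine mem_of_generators S (fun a f hf q hq b => ?_) (fun a f hf q hq b => ?_) u
  · rw [laurentRep_x] at hq
    have h := hf _ (right_ne_zero_of_mul hq) b
    have h0 := left_ne_zero_of_mul hq
    rcases eq_or_ne b a with rfl | hb
    · rw [Pi.sub_apply, Pi.single_eq_same] at h
      split_ifs at h0 with hs
      · simp only [hs, iff_true] at h ⊢; omega
      · have : q b ≠ 0 := fun e => h0 (by rw [e, Int.cast_zero])
        simp only [hs, iff_false] at h ⊢; omega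
    · rwa [Pi.sub_apply, Pi.single_eq_of_ne hb, sub_zero] at h
  · rw [laurentRep_d] at hq
    have h := hf _ (right_ne_zero_of_mul hq) b
    have h0 := left_ne_zero_of_mul hq
    rcases eq_or_ne b a with rfl | hb
    · rw [Pi.add_apply, Pi.single_eq_same] at h
      split_ifs at h0 with hs
      · have : q b + 1 ≠ 0 := fun e => h0 (by exact_mod_cast congrArg (Int.cast (R := ℂ)) e)
        simp only [hs, iff_true] at h ⊢; omega
      · simp only [hs, iff_false] at h ⊢; omega
    · rwa [Pi.add_apply, Pi.single_eq_of_ne hb, add_zero] at h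

end Laurent

theorem factor_intCast_ne_zero {z k : ℤ} (h : 0 ≤ z ↔ 0 ≤ z + k) : factor z k ≠ 0 := by
  refine mul_ne_zero (Finset.prod_ne_zero_iff.2 fun i hi e => ?_)
    (Finset.prod_ne_zero_iff.2 fun i hi e => ?_)
  · rw [Finset.mem_range] at hi
    have : z + i + 1 = 0 := by exact_mod_cast e
    omega
  · rw [Finset.mem_range] at hi
    have : z - i = 0 := by exact_mod_cast e
    omega

end Weyl

/-! ### The simple module of a sign pattern -/

section SliceModule
variable {n ℓ w : ℕ} (lam : ℤ) (s : SliceArrow n ℓ w → Prop) [DecidablePred s]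

/-- The families of coefficients of signs `s` that satisfy the moment map equations. -/
noncomputable def sliceModule : Submodule ℂ ((SliceArrow n ℓ w → ℤ) → ℂ) :=
  Weyl.signSupported s ⊓ ⨅ η, LinearMap.ker
    (Weyl.laurentRep s (sliceComoment η - algebraMap ℂ _ (∑ i, (lam : ℂ) * η i)))

/-- The moment operators are diagonal: they multiply the coefficient at `q` by the defect of the
equations at `q`, so lying in their kernels is a condition on the support. -/
theorem mem_sliceModule (f : (SliceArrow n ℓ w → ℤ) → ℂ) :
    f ∈ sliceModule lam s ↔ ∀ q, f q ≠ 0 → q ∈ weightRegion lam s := by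
  have hcom : ∀ (η : Fin n → ℂ) q, Weyl.laurentRep s
      (sliceComoment η - algebraMap ℂ _ (∑ i, (lam : ℂ) * η i)) f q
      = (∑ i, η i * ((∑ a, vertexWeight i a * q a - lam : ℤ) : ℂ)) * f q := by
    intro η q
    have h1 : Weyl.laurentRep s (sliceComoment η) f q
        = (∑ a, sliceLieChar η a * (q a : ℂ)) * f q := by
      rw [sliceComoment, map_sum, LinearMap.sum_apply, Finset.sum_apply, Finset.sum_mul]
      refine Finset.sum_congr rfl fun a _ => ?_
      rw [map_smul, LinearMap.smul_apply, Pi.smul_apply, smul_eq_mul, mul_assoc]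
      exact congrArg _ (Weyl.laurentRep_euler s a f q)
    rw [map_sub, LinearMap.sub_apply, Pi.sub_apply, h1, AlgHom.commutes,
      Module.algebraMap_end_apply, Pi.smul_apply, smul_eq_mul, ← sub_mul]
    congr 1
    have h2 : ∀ a, sliceLieChar η a * (q a : ℂ)
        = ∑ i, η i * ((vertexWeight i a : ℂ) * q a) := by
      intro a
      rw [sliceLieChar_sum, Finset.sum_mul]
      exact Finset.sum_congr rfl fun i _ => by rw [sliceLieChar_single, mul_assoc]
    rw [Finset.sum_congr rfl fun a _ => h2 a, Finset.sum_comm, ← Finset.sum_sub_distrib]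
    refine Finset.sum_congr rfl fun i _ => ?_
    rw [← Finset.mul_sum, mul_comm (lam : ℂ), ← mul_sub]
    push_cast
    rfl
  rw [sliceModule, Submodule.mem_inf, Submodule.mem_iInf]
  refine ⟨fun ⟨h1, h2⟩ q hq => ⟨h1 q hq, fun i => ?_⟩, fun h => ⟨fun q hq => (h q hq).1, fun η =>
    funext fun q => ?_⟩⟩
  · have h3 := congrFun (LinearMap.mem_ker.1 (h2 (Pi.single i 1))) q
    rw [hcom, Pi.zero_apply] at h3
    have h4 := (mul_eq_zero.1 h3).resolve_right hq
    rw [Finset.sum_eq_single i, Pi.single_eq_same, one_mul] at h4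
    · exact sub_eq_zero.1 (Int.cast_eq_zero.1 h4)
    · intro j _ hj
      rw [Pi.single_eq_of_ne hj, zero_mul]
    · simp
  · rw [hcom, Pi.zero_apply]
    by_cases hq : f q = 0
    · rw [hq, mul_zero]
    · rw [Finset.sum_eq_zero, zero_mul]
      intro i _
      rw [(h q hq).2 i, sub_self, Int.cast_zero, mul_zero]

theorem laurentRep_mem_sliceModule (u : sliceInvariants n ℓ w) :
    ∀ f ∈ sliceModule lam s, Weyl.laurentRep s u.1 f ∈ sliceModule lam s := by
  intro f hf
  rw [sliceModule, Submodule.mem_inf, Submodule.mem_iInf] at hf ⊢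
  refine ⟨Weyl.laurentRep_mem s u.1 f hf.1, fun η => ?_⟩
  have h1 := hf.2 η
  rw [LinearMap.mem_ker] at h1 ⊢
  rw [← Module.End.mul_apply, ← map_mul, sub_mul, sliceComoment_commute η u.2, Algebra.commutes,
    ← mul_sub, map_mul, Module.End.mul_apply, h1, map_zero]

/-- The action of the invariant differential operators on `sliceModule`. -/
noncomputable def sliceInvariantsRep :
    sliceInvariants n ℓ w →ₐ[ℂ] Module.End ℂ (sliceModule lam s) where
  toFun u := (Weyl.laurentRep s u.1).restrict (laurentRep_mem_sliceModule lam s u)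
  map_one' := LinearMap.ext fun f => Subtype.ext (LinearMap.congr_fun (map_one (Weyl.laurentRep s)) f.1)
  map_mul' u v := LinearMap.ext fun f =>
    Subtype.ext (LinearMap.congr_fun (map_mul (Weyl.laurentRep s) u.1 v.1) f.1)
  map_zero' := LinearMap.ext fun f =>
    Subtype.ext (LinearMap.congr_fun (map_zero (Weyl.laurentRep s)) f.1)
  map_add' u v := LinearMap.ext fun f =>
    Subtype.ext (LinearMap.congr_fun (map_add (Weyl.laurentRep s) u.1 v.1) f.1)
  commutes' c := LinearMap.ext fun f =>
    Subtype.ext (LinearMap.congr_fun (AlgHom.commutes (Weyl.laurentRep s) c) f.1)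

/-- The action of the slice algebra on `sliceModule`. -/
noncomputable def sliceRep :
    SliceAlgebra n ℓ w (lam : ℂ) →ₐ[ℂ] Module.End ℂ (sliceModule lam s) :=
  Ideal.Quotient.liftₐ (sliceIdeal n ℓ w (lam : ℂ)) (sliceInvariantsRep lam s) fun u hu => by
    refine Submodule.span_induction (p := fun u _ => sliceInvariantsRep lam s u = 0)
      ?_ (map_zero _) (fun u v _ _ hu hv => by rw [map_add, hu, hv, add_zero])
      (fun c u _ hu => by rw [smul_eq_mul, map_mul, hu, mul_zero]) hu
    rintro _ ⟨η, rfl⟩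
    refine LinearMap.ext fun f => Subtype.ext ?_
    exact LinearMap.mem_ker.1 ((Submodule.mem_iInf _).1 (Submodule.mem_inf.1 f.2).2 η)

variable {lam s}

theorem sliceTheta_smul (a : SliceArrow n ℓ w) (f : sliceModule lam s) (q : SliceArrow n ℓ w → ℤ) :
    (sliceTheta (lam : ℂ) a • (show RepModule (sliceRep lam s) from f) : sliceModule lam s).1 q
      = q a * f.1 q :=
  Weyl.laurentRep_euler s a f.1 q

/-- The basis vectors of `sliceModule`. -/
noncomputable def sliceVector {q : SliceArrow n ℓ w → ℤ} (hq : q ∈ weightRegion lam s) :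
    sliceModule lam s :=
  ⟨Pi.single q 1, (mem_sliceModule lam s _).2 fun q' h => by
    by_contra hne
    exact h (Pi.single_eq_of_ne (fun e => hne (by rw [e]; exact hq)) _)⟩

theorem sliceVector_ne_zero {q : SliceArrow n ℓ w → ℤ} (hq : q ∈ weightRegion lam s) :
    sliceVector hq ≠ 0 := fun e => by
  have := congrFun (congrArg Subtype.val e) q
  simp [sliceVector] at this

theorem sliceTheta_smul_vector {q : SliceArrow n ℓ w → ℤ} (hq : q ∈ weightRegion lam s)
    (a : SliceArrow n ℓ w) :
    sliceTheta (lam : ℂ) a • (show RepModule (sliceRep lam s) from sliceVector hq)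
      = (q a : ℂ) • (show RepModule (sliceRep lam s) from sliceVector hq) := by
  refine Subtype.ext (funext fun q' => (sliceTheta_smul a _ q').trans ?_)
  change (q' a : ℂ) * (Pi.single q 1 : (SliceArrow n ℓ w → ℤ) → ℂ) q'
    = (q a : ℂ) * (Pi.single q 1 : (SliceArrow n ℓ w → ℤ) → ℂ) q'
  rcases eq_or_ne q' q with rfl | h
  · rfl
  · rw [Pi.single_eq_of_ne h, mul_zero, mul_zero]

/-- Distinct exponents are distinct weights, so a weight vector has a single nonzero coefficient. -/
theorem eq_smul_sliceVector {f : sliceModule lam s} (hf0 : f ≠ 0) {p : SliceArrow n ℓ w → ℂ}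
    (hf : ∀ a, sliceTheta (lam : ℂ) a • (show RepModule (sliceRep lam s) from f)
      = p a • (show RepModule (sliceRep lam s) from f)) :
    ∃ (q : SliceArrow n ℓ w → ℤ) (hq : q ∈ weightRegion lam s) (c : ℂ),
      (∀ a, p a = q a) ∧ c ≠ 0 ∧ f = c • sliceVector hq := by
  obtain ⟨q, hq⟩ : ∃ q, f.1 q ≠ 0 := by
    by_contra! h
    exact hf0 (Subtype.ext (funext h))
  have hval : ∀ a q', (q' a : ℂ) * f.1 q' = p a * f.1 q' := fun a q' =>
    (sliceTheta_smul a f q').symm.trans (congrFun (congrArg Subtype.val (hf a)) q')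
  have hp : ∀ a, p a = q a := fun a => (mul_right_cancel₀ hq (hval a q)).symm
  refine ⟨q, (mem_sliceModule lam s _).1 f.2 q hq, f.1 q, hp, hq, Subtype.ext (funext fun q' => ?_)⟩
  change f.1 q' = f.1 q * (Pi.single q 1 : (SliceArrow n ℓ w → ℤ) → ℂ) q'
  rcases eq_or_ne q' q with rfl | h
  · rw [Pi.single_eq_same, mul_one]
  · rw [Pi.single_eq_of_ne h, mul_zero]
    obtain ⟨a, ha⟩ := Function.ne_iff.1 h
    by_contra h0
    have := mul_right_cancel₀ h0 (hval a q')
    rw [hp] at this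
    exact ha (Int.cast_injective this)

theorem isWeightOf_sliceRep_iff (p : SliceArrow n ℓ w → ℂ) :
    IsWeightOf (sliceTheta (lam : ℂ)) (RepModule (sliceRep lam s)) p
      ↔ ∃ q ∈ weightRegion lam s, ∀ a, p a = q a := by
  constructor
  · rintro ⟨f, hf0, hf⟩
    obtain ⟨q, hq, -, hp, -⟩ := eq_smul_sliceVector hf0 hf
    exact ⟨q, hq, hp⟩
  · rintro ⟨q, hq, hp⟩
    exact ⟨sliceVector hq, sliceVector_ne_zero hq, fun a => by
      rw [hp]; exact sliceTheta_smul_vector hq a⟩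

section Finite
variable (hfin : (weightRegion lam s).Finite)
include hfin

theorem eq_sum_sliceVector (f : sliceModule lam s) :
    f = ∑ q ∈ hfin.toFinset.attach, f.1 q.1 • sliceVector (hfin.mem_toFinset.1 q.2) := by
  classical
  refine Subtype.ext (funext fun q' => ?_)
  rw [AddSubmonoidClass.coe_finsetSum, Finset.sum_apply]
  have h1 : ∀ q : hfin.toFinset, ((f.1 q.1 • sliceVector (hfin.mem_toFinset.1 q.2) :
      sliceModule lam s) : (SliceArrow n ℓ w → ℤ) → ℂ) q' = if q.1 = q' then f.1 q' else 0 := by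
    intro q
    change f.1 q.1 * (Pi.single q.1 1 : (SliceArrow n ℓ w → ℤ) → ℂ) q' = _
    split_ifs with h
    · rw [h, Pi.single_eq_same, mul_one]
    · rw [Pi.single_eq_of_ne (Ne.symm h), mul_zero]
  rw [Finset.sum_congr rfl fun q _ => h1 q,
    Finset.sum_attach hfin.toFinset fun q => if q = q' then f.1 q' else 0, Finset.sum_ite_eq']
  split_ifs with h
  · rfl
  · by_contra h0
    exact h (hfin.mem_toFinset.2 ((mem_sliceModule lam s _).1 f.2 q' h0))

theorem finiteDimensional_sliceModule : FiniteDimensional ℂ (sliceModule lam s) := by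
  classical
  refine Module.finite_def.2 ⟨hfin.toFinset.attach.image
    fun q => sliceVector (hfin.mem_toFinset.1 q.2), eq_top_iff.2 fun f _ => ?_⟩
  rw [eq_sum_sliceVector hfin f]
  exact Submodule.sum_mem _ fun q hq => Submodule.smul_mem _ _
    (Submodule.subset_span (Finset.mem_coe.2 (Finset.mem_image_of_mem _ hq)))

/-- A nonzero submodule contains a weight vector, hence a basis vector at some `q`. For `q'` in the
region, the invariant monomial with exponents `q' - q` stays on one side of every wall, so it takes
this vector to a nonzero multiple of the one at `q'`. -/
theorem isSimpleModule_sliceRep (hne : (weightRegion lam s).Nonempty) :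
    IsSimpleModule (SliceAlgebra n ℓ w (lam : ℂ)) (RepModule (sliceRep lam s)) := by
  have hfd := finiteDimensional_sliceModule hfin
  obtain ⟨q₁, hq₁⟩ := hne
  have hnt : Nontrivial (RepModule (sliceRep lam s)) :=
    ⟨⟨sliceVector hq₁, 0, sliceVector_ne_zero hq₁⟩⟩
  refine { eq_bot_or_eq_top := fun K => or_iff_not_imp_left.2 fun hK => ?_ }
  have hntK : Nontrivial K := Submodule.nontrivial_iff_ne_bot.2 hK
  have hfdK : FiniteDimensional ℂ K :=
    inferInstanceAs (FiniteDimensional ℂ (K.restrictScalars ℂ))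
  obtain ⟨p, ⟨⟨f, hfK⟩, hf0, hf⟩⟩ :=
    exists_isWeightOf (M := K) (isWeightAlgebra_sliceTheta (n := n) (ℓ := ℓ) (w := w) (lam : ℂ)).commute
  obtain ⟨q, hq, c, -, hc, hfc⟩ := eq_smul_sliceVector (f := f) (p := p)
    (fun e => hf0 (Subtype.ext e)) fun a => congrArg Subtype.val (hf a)
  have hqK : (show RepModule (sliceRep lam s) from sliceVector hq) ∈ K := by
    have h1 := (K.restrictScalars ℂ).smul_mem c⁻¹ hfK
    have h2 : c⁻¹ • f = (show RepModule (sliceRep lam s) from sliceVector hq) := by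
      refine (congrArg (fun g : sliceModule lam s => c⁻¹ • g) hfc).trans ?_
      rw [smul_smul, inv_mul_cancel₀ hc, one_smul]
    rwa [h2] at h1
  have hall : ∀ {q'} (hq' : q' ∈ weightRegion lam s),
      (show RepModule (sliceRep lam s) from sliceVector hq') ∈ K := by
    intro q' hq'
    have hbal : IsBalanced (q' - q) := fun i => by
      simp only [Pi.sub_apply, mul_sub, Finset.sum_sub_distrib]
      rw [hq'.2, hq.2, sub_self]
    obtain ⟨h1, h2⟩ := exists_weight_vector_left (sliceInvariantsRep lam s)
      (p := fun a => (q a : ℂ)) (sliceVector_ne_zero hq) (fun a => sliceTheta_smul_vector hq a) hbal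
      fun a => Weyl.factor_intCast_ne_zero (by
        rw [Pi.sub_apply, add_sub_cancel, hq.1, hq'.1])
    obtain ⟨q'', hq'', c', hp'', hc', hfc'⟩ := eq_smul_sliceVector h1 fun a => h2 a
    have e : q'' = q' := by
      funext a
      have := hp'' a
      rw [Pi.sub_apply] at this
      push_cast at this
      have h3 : ((q'' a : ℤ) : ℂ) = (q' a : ℤ) := by rw [← this]; ring
      exact Int.cast_injective h3
    subst e
    have h4 := K.smul_mem (Ideal.Quotient.mkₐ ℂ (sliceIdeal n ℓ w (lam : ℂ))
      ⟨_, hbal.monomial_mem⟩) hqK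
    have h5 := (K.restrictScalars ℂ).smul_mem c'⁻¹ h4
    have h6 : c'⁻¹ • sliceInvariantsRep lam s ⟨_, hbal.monomial_mem⟩ (sliceVector hq)
        = sliceVector hq'' := by
      rw [hfc', smul_smul, inv_mul_cancel₀ hc', one_smul]
    exact h6 ▸ h5
  have hsum : ∀ g : sliceModule lam s, (show RepModule (sliceRep lam s) from g) ∈ K := by
    intro g
    rw [eq_sum_sliceVector hfin g]
    exact (K.restrictScalars ℂ).sum_mem fun q _ =>
      (K.restrictScalars ℂ).smul_mem _ (hall (hfin.mem_toFinset.1 q.2))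
  exact eq_top_iff.2 fun g _ => hsum g

end Finite

end SliceModule

/-! ### Classification over the slice algebra and proof of the theorem -/

section Main
variable {n ℓ w : ℕ}

theorem isEquivariantFamily_sliceTheta (lam : ℤ) :
    IsEquivariantFamily (slicePerm n ℓ w (lam : ℂ)) (fun σ => arrowPerm σ)
      (sliceTheta (lam : ℂ)) (sliceWeights lam) where
  apply_eq σ a := congrArg (Ideal.Quotient.mk _) (Subtype.ext (by
    change Weyl.perm (arrowPerm σ) (Weyl.euler a) = Weyl.euler (arrowPerm σ a)
    rw [Weyl.euler, Weyl.euler, map_mul, Weyl.perm_x, Weyl.perm_d]))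
  comp_mem σ o p h := comp_mem_sliceWeights lam σ o p h

section Range
variable (hn : 2 ≤ n) (hℓ : 2 ≤ ℓ) (hw : 1 ≤ w) {lam : ℤ}
  (hlam : ((n : ℤ) - 1) * ((ℓ : ℤ) - 1) + (w : ℤ) ≤ lam ∨ lam ≤ -(((n : ℤ) - 1) * ((ℓ : ℤ) - 1)))
include hn hℓ hw hlam

/-- Besides the weights, the passage to bimodules needs spanning by weight vectors and
eigenfunctionals; the latter are the coefficients at the points of the region. -/
theorem exists_simple_sliceWeights (o : Equiv.Perm (Fin n)) :
    ∃ L : FDSimple (SliceAlgebra n ℓ w (lam : ℂ)),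
      (∀ p, IsWeightOf (sliceTheta (n := n) (ℓ := ℓ) (w := w) (lam : ℂ)) L.carrier p
        ↔ p ∈ sliceWeights lam o) ∧
      (∀ v : L.carrier, v ∈ Submodule.span ℂ {v : L.carrier |
        ∃ p ∈ sliceWeights (ℓ := ℓ) (w := w) lam o, ∀ a,
          sliceTheta (n := n) (ℓ := ℓ) (w := w) (lam : ℂ) a • v = p a • v}) ∧
      ∀ p ∈ sliceWeights (ℓ := ℓ) (w := w) lam o, ∃ φ : Module.Dual ℂ L.carrier, φ ≠ 0 ∧
        ∀ a (v : L.carrier),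
          φ (sliceTheta (n := n) (ℓ := ℓ) (w := w) (lam : ℂ) a • v) = p a * φ v := by
  classical
  have hfin := finite_weightRegion (ℓ := ℓ) (w := w) lam o
  have hfd := finiteDimensional_sliceModule hfin
  have hs := isSimpleModule_sliceRep hfin (nonempty_weightRegion hn hℓ hw hlam o)
  refine ⟨{ carrier := RepModule (sliceRep lam (boundedSign (ℓ := ℓ) (w := w) lam o)) }, isWeightOf_sliceRep_iff,
    fun f => ?_, ?_⟩
  · have h := eq_sum_sliceVector hfin f
    rw [h]
    refine Submodule.sum_mem _ fun q _ => Submodule.smul_mem _ _ (Submodule.subset_span ?_)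
    have hq := hfin.mem_toFinset.1 q.2
    exact ⟨fun a => q.1 a, ⟨q.1, hq, fun _ => rfl⟩, fun a => sliceTheta_smul_vector hq a⟩
  · rintro p ⟨q, hq, hp⟩
    let φ : Module.Dual ℂ (sliceModule lam (boundedSign (ℓ := ℓ) (w := w) lam o)) :=
      (LinearMap.proj q).comp (Submodule.subtype _)
    refine ⟨φ, fun e => ?_, fun a f => ?_⟩
    · have h : (Pi.single q 1 : (SliceArrow n ℓ w → ℤ) → ℂ) q = 0 :=
        LinearMap.congr_fun e (sliceVector hq)
      rw [Pi.single_eq_same] at h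
      exact one_ne_zero h
    · rw [hp]
      exact sliceTheta_smul a f q

theorem classifiesSimple_slice :
    ClassifiesSimple (sliceTheta (n := n) (ℓ := ℓ) (w := w) (lam : ℂ)) (sliceWeights lam) where
  isWeightAlgebra := isWeightAlgebra_sliceTheta _
  eq_of_mem := eq_of_mem_sliceWeights hℓ
  exists_simple o :=
    let ⟨L, hL, _⟩ := exists_simple_sliceWeights hn hℓ hw hlam o
    ⟨L, hL⟩
  exists_mem _ _ hp :=
    let ⟨h1, h2⟩ := isBoundedWeight_of_isWeightOf hp
    h1.exists_mem_weightRegion hn hℓ hw hlam h2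

theorem classifiesSimple_slice_bimodule :
    ClassifiesSimple (bimoduleFamily (sliceTheta (n := n) (ℓ := ℓ) (w := w) (lam : ℂ)))
      (bimoduleWeights (sliceWeights lam)) :=
  classifiesSimple_bimodule (isWeightAlgebra_sliceTheta _) (eq_of_mem_sliceWeights hℓ)
    (exists_simple_sliceWeights hn hℓ hw hlam)
    (fun _ _ _ _ _ _ _ hp =>
      let ⟨h1, h2⟩ := isBoundedWeight_of_isWeightOf hp
      h1.exists_mem_weightRegion hn hℓ hw hlam h2)
    fun _ _ _ _ _ _ _ hp =>
      let ⟨h1, h2⟩ := isBoundedWeight_of_isWeightOf_op hp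
      h1.exists_mem_weightRegion hn hℓ hw hlam h2

theorem nonempty_fdSimpleClasses_slice :
    Nonempty (FDSimpleClasses (SliceAlgebra n ℓ w (lam : ℂ))) :=
  let ⟨L, _⟩ := exists_simple_sliceWeights hn hℓ hw hlam 1
  ⟨Quotient.mk _ L⟩

theorem exists_perm_smul_eq (M N : FDSimpleClasses (SliceAlgebra n ℓ w (lam : ℂ))) :
    ∃ σ : Equiv.Perm (Fin n), σ • M = N := by
  induction M, N using Quotient.inductionOn₂ with
  | h M N =>
  obtain ⟨σ, h⟩ := (classifiesSimple_slice hn hℓ hw hlam).exists_twist_equiv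
    (isEquivariantFamily_sliceTheta lam) M N
  exact ⟨σ, Quotient.sound h⟩

theorem eq_one_of_perm_smul_eq (σ : Equiv.Perm (Fin n))
    (M : FDSimpleClasses (SliceAlgebra n ℓ w (lam : ℂ))) (h : σ • M = M) : σ = 1 := by
  induction M using Quotient.inductionOn with
  | h M =>
  obtain ⟨e⟩ : Nonempty ((M.twist (slicePerm n ℓ w (lam : ℂ)) σ).carrier
      ≃ₗ[SliceAlgebra n ℓ w (lam : ℂ)] M.carrier) := Quotient.exact h
  exact (classifiesSimple_slice hn hℓ hw hlam).eq_one_of_twist_equiv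
    (isEquivariantFamily_sliceTheta lam) (fun g x hg => mul_eq_right.1 hg) M σ e

theorem card_equivariant_bimodules :
    Nat.card (EquivariantFDSimpleClasses (bimoduleAction (slicePerm n ℓ w (lam : ℂ))))
      = n.factorial := by
  -- Labels are pairs of orders under diagonal left translation, and each orbit contains exactly one
  -- pair with first entry `1`.
  have h := (classifiesSimple_slice_bimodule hn hℓ hw hlam).card_equivariant
    (isEquivariantFamily_sliceTheta lam).bimodule (fun g x hg => mul_eq_right.1 (Prod.ext_iff.1 hg).1)
    (fun t : Equiv.Perm (Fin n) => ((1 : Equiv.Perm (Fin n)), t))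
    (fun x => ⟨x.1⁻¹, x.1⁻¹ * x.2, Prod.ext (inv_mul_cancel x.1) rfl⟩)
    (fun g t t' hg => by
      have h1 : g = 1 := (mul_one g).symm.trans (Prod.ext_iff.1 hg).1
      have h2 : g * t = t' := (Prod.ext_iff.1 hg).2
      rwa [h1, one_mul] at h2)
  rw [h, Nat.card_eq_fintype_card, Fintype.card_perm, Fintype.card_fin]

end Range

/-- The slice algebra has no nonzero finite-dimensional bimodules for the parameters between the
two bounds. -/
theorem subsingleton_bimodule (hn : 2 ≤ n) (hℓ : 2 ≤ ℓ) {lam : ℝ}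
    (h1 : -(((n : ℝ) - 1) * ((ℓ : ℝ) - 1)) < lam)
    (h2 : lam < ((n : ℝ) - 1) * ((ℓ : ℝ) - 1) + (w : ℝ)) (M : Type) [AddCommGroup M] [Module ℂ M]
    [FiniteDimensional ℂ M]
    [Module (SliceAlgebra n ℓ w (lam : ℂ) ⊗[ℂ] (SliceAlgebra n ℓ w (lam : ℂ))ᵐᵒᵖ) M]
    [IsScalarTower ℂ (SliceAlgebra n ℓ w (lam : ℂ) ⊗[ℂ] (SliceAlgebra n ℓ w (lam : ℂ))ᵐᵒᵖ) M] :
    Subsingleton M := by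
  by_contra h
  have := not_subsingleton_iff_nontrivial.1 h
  have halg := isWeightAlgebra_sliceTheta (n := n) (ℓ := ℓ) (w := w) (lam : ℂ)
  obtain ⟨P, hP⟩ := exists_isWeightOf (M := M) (halg.tensor halg.op).commute
  -- The left action alone already excludes every weight.
  obtain ⟨h3, h4⟩ := isBoundedWeight_of_isWeightOf (IsWeightOf.left hP)
  exact h3.not_conserved hn hℓ h1 h2 h4

end Main

theorem mainTheorem5 (n ℓ w : ℕ) (hn : 2 ≤ n) (hℓ : 2 ≤ ℓ) (hw : 1 ≤ w) :
    (∀ lam : ℤ,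
      (((n : ℤ) - 1) * ((ℓ : ℤ) - 1) + (w : ℤ) ≤ lam ∨ lam ≤ -(((n : ℤ) - 1) * ((ℓ : ℤ) - 1))) →
      (Nonempty (FDSimpleClasses (SliceAlgebra n ℓ w (lam : ℂ))) ∧
        (∀ M N : FDSimpleClasses (SliceAlgebra n ℓ w (lam : ℂ)),
          ∃ σ : Equiv.Perm (Fin n), σ • M = N) ∧
        (∀ (σ : Equiv.Perm (Fin n)) (M : FDSimpleClasses (SliceAlgebra n ℓ w (lam : ℂ))),
          σ • M = M → σ = 1)) ∧
      Nat.card (EquivariantFDSimpleClasses (bimoduleAction (slicePerm n ℓ w (lam : ℂ))))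
        = n.factorial) ∧
    (∀ lam : ℝ,
      -(((n : ℝ) - 1) * ((ℓ : ℝ) - 1)) < lam →
      lam < ((n : ℝ) - 1) * ((ℓ : ℝ) - 1) + (w : ℝ) →
      IsEmpty (FDSimple (SliceAlgebra n ℓ w (lam : ℂ) ⊗[ℂ] (SliceAlgebra n ℓ w (lam : ℂ))ᵐᵒᵖ)) ∧
      IsEmpty (EquivariantFDSimple (bimoduleAction (slicePerm n ℓ w (lam : ℂ))))) := by
  refine ⟨fun lam hlam => ⟨⟨nonempty_fdSimpleClasses_slice hn hℓ hw hlam,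
    exists_perm_smul_eq hn hℓ hw hlam, eq_one_of_perm_smul_eq hn hℓ hw hlam⟩,
    card_equivariant_bimodules hn hℓ hw hlam⟩, fun lam h1 h2 => ⟨⟨fun M => ?_⟩, ⟨fun M => ?_⟩⟩⟩
  · have := IsSimpleModule.nontrivial
      (SliceAlgebra n ℓ w (lam : ℂ) ⊗[ℂ] (SliceAlgebra n ℓ w (lam : ℂ))ᵐᵒᵖ) M.carrier
    exact not_subsingleton M.carrier (subsingleton_bimodule hn hℓ h1 h2 M.carrier)
  · have := M.nontrivial
    exact not_subsingleton M.carrier (subsingleton_bimodule hn hℓ h1 h2 M.carrier)
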